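/- Let $n$ be a positive integer and $b>0$. Let $X$ be an $n\times n$ complex Gaussian matrix and $\vec x$ a real Gaussian vector of length $2n$, where the real and imaginary parts of the entries of $X$ and the entries of $\vec x$ are all independent normal variables with mean $0$ and variance $1/2$. Let $\bar X$ be the $2n\times 2n$ real matrix obtained from $X$ by replacing each entry $u+iv$ by the block $\begin{bmatrix} u & v\\ -v & u\end{bmatrix}$, and let $$M=\bar X^{T}\bar X+b\,\vec x\,\vec x^{\,T}.$$ List the eigenvalues of $M$ in decreasing order as $x_1,\dots,x_{2n}$. Let $\mathrm{LUE}_n$ and $\mathrm{LOE}_n$ denote the random point sets of $n$ points on $[0,\infty)$ whose joint densities are proportional to $\prod_{l=1}^n e^{-t_l}\prod_{j<k}|t_k-t_j|^2$ and $\prod_{l=1}^n e^{-t_l/2}\prod_{j<k}|t_k-t_j|$ respectively. Let $\mathrm{LOE}_n\cup\mathrm{LOE}_n$ be the union of two independent copies of $\mathrm{LOE}_n$, and let $\mathrm{even}(\cdot)$ denote the even-labelled points $x_2,x_4,\dots,x_{2n}$ when the $2n$ points are listed in decreasing order. Then: 1. $(x_1,\dots,x_{2n})$ has the probability density $$\frac1C\prod_{j=1}^{2n}e^{-x_j/2}\prod_{j=1}^{n}e^{A(x_{2j-1}-x_{2j})/2}\prod_{1\le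 j<k\le n}(x_{2j-1}-x_{2k-1})(x_{2j}-x_{2k}),\qquad x_1>x_2>\cdots>x_{2n}\ge 0,$$ and $0$ elsewhere, with $A=1-2/b$ and $C\in(0,\infty)$ the normalization constant. 2. $\mathrm{even}(M)=\mathrm{LUE}_n$ in distribution, for every $b>0$. 3. For $b=2$ the eigenvalues of $M$ have the same distribution as $\mathrm{LOE}_n\cup\mathrm{LOE}_n$. 4. Consequently $\mathrm{even}(\mathrm{LOE}_n\cup\mathrm{LOE}_n)=\mathrm{LUE}_n$ in distribution. -/

import Mathlib

open MeasureTheory ProbabilityTheory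

noncomputable section

/-- The `2n × 2n` real matrix obtained from an `n × n` complex matrix by replacing each entry
`u + i v` by the block `[u, v; -v, u]`. The index `(i, s)` is row (or column) `s` of block `i`. -/
def realRep {n : ℕ} (X : Matrix (Fin n) (Fin n) ℂ) :
    Matrix (Fin n × Fin 2) (Fin n × Fin 2) ℝ :=
  Matrix.of fun p q =>
    !![(X p.1 q.1).re, (X p.1 q.1).im; -(X p.1 q.1).im, (X p.1 q.1).re] p.2 q.2

/-- `X̄ᵀ X̄ + b x xᵀ`, where `X̄` is the real representation of `X`. -/
def perturbedGram {n : ℕ} (b : ℝ) (X : Matrix (Fin n) (Fin n) ℂ) (x : Fin n × Fin 2 → ℝ) :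
    Matrix (Fin n × Fin 2) (Fin n × Fin 2) ℝ :=
  (realRep X).transpose * realRep X + b • Matrix.vecMulVec x x

theorem perturbedGram_isHermitian {n : ℕ} (b : ℝ) (X : Matrix (Fin n) (Fin n) ℂ)
    (x : Fin n × Fin 2 → ℝ) : (perturbedGram b X x).IsHermitian := by
  ext p q
  simp [perturbedGram, Matrix.mul_apply, Matrix.vecMulVec_apply, mul_comm]

theorem card_index (n : ℕ) : 2 * n = Fintype.card (Fin n × Fin 2) := by
  simp [mul_comm]

/-- The eigenvalues, with multiplicity, of `X̄ᵀ X̄ + b x xᵀ` in decreasing order. The eigenvalue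
labelled `i` when counting from `1` has index `i - 1` here. -/
def perturbedGramEigenvalues {n : ℕ} (b : ℝ) (X : Matrix (Fin n) (Fin n) ℂ)
    (x : Fin n × Fin 2 → ℝ) : Fin (2 * n) → ℝ :=
  fun i => (perturbedGram_isHermitian b X x).eigenvalues₀ (Fin.cast (card_index n) i)

/-- All the real components: real and imaginary parts of the entries of `X`, and the entries
of `x`. -/
def realComponents {Ω : Type*} {n : ℕ} (X : Ω → Matrix (Fin n) (Fin n) ℂ)
    (x : Ω → Fin n × Fin 2 → ℝ) :
    ((Fin n × Fin n) × Fin 2) ⊕ (Fin n × Fin 2) → Ω → ℝ :=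
  Sum.elim (fun p ω => ![(X ω p.1.1 p.1.2).re, (X ω p.1.1 p.1.2).im] p.2) (fun q ω => x ω q)

/-- `x_{2j-1}` for `j = 1, …, n`; labels start from `1`, indices from `0`. -/
def oddLabelled {n : ℕ} (z : Fin (2 * n) → ℝ) : Fin n → ℝ :=
  fun j => z ⟨2 * j, by omega⟩

/-- `x_{2j}` for `j = 1, …, n`; labels start from `1`, indices from `0`. -/
def evenLabelled {n : ℕ} (z : Fin (2 * n) → ℝ) : Fin n → ℝ :=
  fun j => z ⟨2 * j + 1, by omega⟩

/-- The measure on `ℝ^N` with density `f / C`, where `C = ∫ f`. -/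
def normalizedMeasure {N : ℕ} (f : (Fin N → ℝ) → ℝ) : Measure (Fin N → ℝ) :=
  volume.withDensity fun z => ENNReal.ofReal (f z / ∫ y, f y)

open Classical in
/-- The unnormalized density of the interpolating ensemble with parameter `A`, supported on
`x_1 > x_2 > ⋯ > x_{2n} ≥ 0`. -/
def interpolatingDensity (n : ℕ) (A : ℝ) (z : Fin (2 * n) → ℝ) : ℝ :=
  if StrictAnti z ∧ ∀ i, 0 ≤ z i then
    (∏ i, Real.exp (-z i / 2)) *
    (∏ j : Fin n, Real.exp (A * (oddLabelled z j - evenLabelled z j) / 2)) *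
    ∏ j : Fin n, ∏ k ∈ Finset.Ioi j,
      (oddLabelled z j - oddLabelled z k) * (evenLabelled z j - evenLabelled z k)
  else 0

/-- The unnormalized density `∏ g(x_l) ∏_{j<k} |x_k - x_j|^β`. -/
def ensembleDensity (β : ℕ) (g : ℝ → ℝ) (N : ℕ) (z : Fin N → ℝ) : ℝ :=
  (∏ l, g (z l)) * ∏ j : Fin N, ∏ k ∈ Finset.Ioi j, |z k - z j| ^ β

/-- The weight `e^{-c t}` on `t ≥ 0`. -/
def laguerreWeight (c t : ℝ) : ℝ :=
  if 0 ≤ t then Real.exp (-c * t) else 0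

/-- `LOE_n` with `a = 0`: weight `e^{-t/2}`, `β = 1`. -/
def laguerreOrthogonal (n : ℕ) : Measure (Fin n → ℝ) :=
  normalizedMeasure (ensembleDensity 1 (laguerreWeight (1 / 2)) n)

/-- `LUE_n` with `a = 0`: weight `e^{-t}`, `β = 2`. -/
def laguerreUnitary (n : ℕ) : Measure (Fin n → ℝ) :=
  normalizedMeasure (ensembleDensity 2 (laguerreWeight 1) n)

/-- Decreasing rearrangement. -/
def sortDesc {N : ℕ} (z : Fin N → ℝ) : Fin N → ℝ :=
  fun i => z (Tuple.sort z i.rev)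

/-- The law of the points of `LUE_n` in decreasing order. -/
def orderedLaguerreUnitary (n : ℕ) : Measure (Fin n → ℝ) :=
  (laguerreUnitary n).map sortDesc

/-- The law, in decreasing order, of the `2n` points of `LOE_n ∪ LOE_n`, the superposition of two
independent copies of `LOE_n`. -/
def orderedLaguerreOrthogonalUnion (n : ℕ) : Measure (Fin (2 * n) → ℝ) :=
  ((laguerreOrthogonal n).prod (laguerreOrthogonal n)).map fun p =>
    sortDesc fun i => Fin.append p.1 p.2 (Fin.cast (two_mul n) i)

end

/-! Let t_1 > ... > t_n be the eigenvalues of X^*X. In the realification each is doubled, so almost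
surely a positive rank-one perturbation keeps one copy of every t_j and creates one new eigenvalue
above each, with z_1 > t_1 > z_2 > t_2 > .... Hence the even-labelled eigenvalues are the t_j
themselves, whatever b is. What remains is the law of t and the law of z given t.

The z_j are the zeros of 1 - ∑ w_j/(s - t_j), where w_j is b times the squared length of the
projection of the Gaussian vector onto the j-th eigenspace. By orthogonal invariance the w_j are
independent Gamma variables (`exists_perturbation_weights`). The map z ↦ w is a bijection from the
tuples interlacing t onto the positive orthant, with Jacobian vdm z / vdm t (`lintegral_residues`),
and ∑ w = ∑ z - ∑ t. This gives an explicit transition density (`exists_perturbation_points`).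

The same mechanism yields the LUE law. X^*X is the sum of n rank-one matrices, one per row of X.
After m rows there are m positive eigenvalues and a zero of multiplicity n - m. The old eigenvalues
are integrated out because the Vandermonde product of a tuple, integrated over the box interlaced
with l, is a constant times vdm l (`lintegral_vdm_box`, `exists_map_detSeq_wishart`). One more
perturbation, with parameter b, multiplies the LUE density by the transition density, and the
product is the interpolating density with A = 1 - 2/b.

At b = 2 the factor with A disappears. The density of the sorted superposition of two LOE samples is
a sum of |vdm| |vdm| over splittings into two halves. With suitable signs this sum is the Laplace
expansion of a single determinant, which column operations reduce to the Vandermonde products of the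
odd and even points (`sum_abs_vdm_halves`). The last claim compares the two descriptions at b = 2.

Two devices recur. Constants are not computed: probability measures proportional to a common measure
coincide (`eq_of_eq_smul`). Spectra are encoded by the values of characteristic polynomials at the
positive integers, from which a Borel left inverse recovers the ordered eigenvalues
(`exists_nodeSeq_leftInverse`). -/

noncomputable section

/-! ### Vandermonde products -/

/-- `∏_{j<k} (z_j - z_k)`. -/
def vdm {N : ℕ} (z : Fin N → ℝ) : ℝ := ∏ j, ∏ k ∈ Finset.Ioi j, (z j - z k)

theorem vdm_pos {N : ℕ} {z : Fin N → ℝ} (hz : StrictAnti z) : 0 < vdm z :=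
  Finset.prod_pos fun _ _ => Finset.prod_pos fun _ hk => sub_pos.2 (hz (Finset.mem_Ioi.1 hk))

theorem abs_det_vandermonde {N : ℕ} (z : Fin N → ℝ) :
    |(Matrix.vandermonde z).det| = |vdm z| := by
  simp [Matrix.det_vandermonde, vdm, Finset.abs_prod, abs_sub_comm]

theorem prod_erase_eq_Ioi_mul_Iio {N : ℕ} (j : Fin N) (f : Fin N → ℝ) :
    ∏ k ∈ Finset.univ.erase j, f k = (∏ k ∈ Finset.Ioi j, f k) * ∏ k ∈ Finset.Iio j, f k := by
  rw [← Finset.prod_union]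
  · refine Finset.prod_congr ?_ fun _ _ => rfl
    ext k
    simp [lt_or_lt_iff_ne, eq_comm]
  · exact Finset.disjoint_left.2 fun k hk hk' =>
      lt_asymm (Finset.mem_Ioi.1 hk) (Finset.mem_Iio.1 hk')

theorem prod_erase_eq_mul_Ioi {N : ℕ} (f : Fin N → Fin N → ℝ) :
    ∏ j, ∏ k ∈ Finset.univ.erase j, f j k = ∏ j, ∏ k ∈ Finset.Ioi j, (f j k * f k j) := by
  simp_rw [prod_erase_eq_Ioi_mul_Iio, Finset.prod_mul_distrib]
  congr 1
  exact Finset.prod_comm' (fun x y => by simp)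

theorem abs_prod_erase_sub {N : ℕ} (z : Fin N → ℝ) :
    |∏ j, ∏ k ∈ Finset.univ.erase j, (z j - z k)| = |vdm z| ^ 2 := by
  rw [prod_erase_eq_mul_Ioi, vdm]
  simp_rw [Finset.abs_prod, abs_mul, ← Finset.prod_pow]
  refine Finset.prod_congr rfl fun j _ => Finset.prod_congr rfl fun k _ => ?_
  rw [abs_sub_comm (z k), sq]

open Polynomial in
/-- The absolute value of the determinant of `∏_{l ≠ k} (t_j - z_l)`. -/
theorem abs_det_prod_erase {N : ℕ} (t z : Fin N → ℝ) (hz : Function.Injective z) :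
    |(Matrix.of fun j k : Fin N => ∏ l ∈ Finset.univ.erase k, (t j - z l)).det| =
      |vdm t| * |vdm z| := by
  classical
  let P : Fin N → ℝ[X] := fun k => ∏ l ∈ Finset.univ.erase k, (X - C (z l))
  let Q : Matrix (Fin N) (Fin N) ℝ := Matrix.of fun i k => (P k).coeff i
  have hdeg : ∀ k, (P k).natDegree < N := by
    intro k
    simp only [P]
    rw [natDegree_prod_of_monic _ _ fun l _ => monic_X_sub_C _]
    simpa using k.pos
  have hV : ∀ v : Fin N → ℝ, (Matrix.of fun j k : Fin N =>
      ∏ l ∈ Finset.univ.erase k, (v j - z l)) = Matrix.vandermonde v * Q := by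
    intro v
    ext j k
    have : (P k).eval (v j) = ∏ l ∈ Finset.univ.erase k, (v j - z l) := by
      simp [P, eval_prod]
    rw [Matrix.of_apply, ← this, Matrix.mul_apply, eval_eq_sum_range' (hdeg k),
      ← Fin.sum_univ_eq_sum_range (fun i => (P k).coeff i * v j ^ i)]
    simp [Q, Matrix.vandermonde_apply, mul_comm]
  -- The factor `Q` does not depend on the evaluation points. Evaluating at z itself makes the
  -- matrix diagonal, which gives |det Q| = |vdm z|.
  have hz1 : (Matrix.of fun j k : Fin N => ∏ l ∈ Finset.univ.erase k, (z j - z l)) =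
      Matrix.diagonal fun j => ∏ l ∈ Finset.univ.erase j, (z j - z l) := by
    ext j k
    by_cases h : j = k
    · subst h; simp
    · rw [Matrix.diagonal_apply_ne _ h, Matrix.of_apply]
      exact Finset.prod_eq_zero (Finset.mem_erase.2 ⟨h, Finset.mem_univ j⟩) (sub_self _)
  have h2 := congrArg (fun M => |M.det|) ((hV z).symm.trans hz1)
  simp only [Matrix.det_mul, Matrix.det_diagonal, abs_mul, abs_det_vandermonde,
    abs_prod_erase_sub] at h2
  have hne : |vdm z| ≠ 0 := by
    rw [← abs_det_vandermonde]
    exact abs_ne_zero.2 (Matrix.det_vandermonde_ne_zero_iff.2 hz)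
  rw [hV t, Matrix.det_mul, abs_mul, abs_det_vandermonde]
  congr 1
  exact mul_left_cancel₀ hne (by rw [h2, sq])

/-! ### Interlacing tuples and the secular polynomial -/

/-- Tuples `z` with `z_1 > t_1 > z_2 > t_2 > ⋯ > z_N > t_N`. -/
def Interlace {N : ℕ} (t : Fin N → ℝ) : Set (Fin N → ℝ) :=
  {z | (∀ j, t j < z j) ∧ ∀ j k, j < k → z k < t j}

/-- The residues `w_j` for which `∏ (X - z_k) = ∏ (X - t_k) - ∑_j w_j ∏_{k ≠ j} (X - t_k)`. -/
def residues {N : ℕ} (t z : Fin N → ℝ) (j : Fin N) : ℝ :=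
  -(∏ k, (t j - z k)) / ∏ k ∈ Finset.univ.erase j, (t j - t k)

theorem Interlace.strictAnti {N : ℕ} {t z : Fin N → ℝ} (h : z ∈ Interlace t) : StrictAnti z :=
  fun j k hjk => (h.2 j k hjk).trans (h.1 j)

theorem prod_erase_sub_ne_zero {N : ℕ} {t : Fin N → ℝ} (ht : Function.Injective t) (j : Fin N) :
    ∏ k ∈ Finset.univ.erase j, (t j - t k) ≠ 0 :=
  Finset.prod_ne_zero_iff.2 fun _ hk => sub_ne_zero.2 (ht.ne (Finset.ne_of_mem_erase hk).symm)

/-- The secular polynomial `∏ (X - t_k) - ∑_j w_j ∏_{k ≠ j} (X - t_k)`. -/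
def secular {N : ℕ} (t w : Fin N → ℝ) : Polynomial ℝ :=
  ∏ k, (Polynomial.X - Polynomial.C (t k)) -
    ∑ j, Polynomial.C (w j) * ∏ k ∈ Finset.univ.erase j, (Polynomial.X - Polynomial.C (t k))

open Polynomial in
theorem secular_eval_node {N : ℕ} (t w : Fin N → ℝ) (j : Fin N) :
    (secular t w).eval (t j) = -(w j * ∏ k ∈ Finset.univ.erase j, (t j - t k)) := by
  have h : ∀ i, i ≠ j → ∏ k ∈ Finset.univ.erase i, (t j - t k) = 0 := fun i hi =>
    Finset.prod_eq_zero (Finset.mem_erase.2 ⟨hi.symm, Finset.mem_univ j⟩) (sub_self _)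
  simp only [secular, eval_sub, eval_prod, eval_X, eval_C, eval_finsetSum, eval_mul]
  rw [Finset.prod_eq_zero (Finset.mem_univ j) (sub_self _), zero_sub,
    Finset.sum_eq_single j (fun i _ hi => by rw [h i hi, mul_zero]) (by simp)]

open Polynomial in
theorem degree_sum_erase_lt {N : ℕ} (t w : Fin N → ℝ) :
    (∑ j, C (w j) * ∏ k ∈ Finset.univ.erase j, (X - C (t k))).degree < N := by
  refine (degree_sum_le _ _).trans_lt ((Finset.sup_lt_iff (by simp)).2 fun j _ => ?_)
  refine (degree_mul_le _ _).trans_lt ?_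
  rw [degree_prod]
  simp only [degree_X_sub_C, Finset.sum_const, Finset.card_erase_of_mem (Finset.mem_univ j),
    Finset.card_univ, Fintype.card_fin]
  refine (add_le_add_left degree_C_le _).trans_lt ?_
  have := j.pos
  rw [zero_add, nsmul_one, Nat.cast_lt]
  omega

open Polynomial in
theorem degree_prod_X_sub_C {N : ℕ} (t : Fin N → ℝ) : (∏ k, (X - C (t k))).degree = (N : WithBot ℕ) := by
  rw [degree_prod]; simp

open Polynomial in
theorem monic_secular {N : ℕ} (t w : Fin N → ℝ) : (secular t w).Monic := by
  refine (monic_prod_of_monic _ _ fun k _ => monic_X_sub_C _).sub_of_left ?_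
  rw [degree_prod_X_sub_C]
  exact degree_sum_erase_lt t w

open Polynomial in
theorem natDegree_secular {N : ℕ} (t w : Fin N → ℝ) : (secular t w).natDegree = N := by
  refine natDegree_eq_of_degree_eq_some ?_
  rw [secular, degree_sub_eq_left_of_degree_lt, degree_prod_X_sub_C]
  rw [degree_prod_X_sub_C]
  exact degree_sum_erase_lt t w

open Polynomial in
-- Both sides are monic of degree N, so their difference has degree below N and is determined by its
-- values at the N distinct nodes. The values at t_j agree exactly when w_j is the residue.
theorem prod_eq_secular_iff {N : ℕ} {t : Fin N → ℝ} (ht : Function.Injective t)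
    (w z : Fin N → ℝ) : ∏ k, (X - C (z k)) = secular t w ↔ residues t z = w := by
  have hz : ∀ j, (∏ k, (X - C (z k))).eval (t j) = ∏ k, (t j - z k) := fun j => by
    simp [eval_prod]
  constructor
  · intro h
    funext j
    have := congrArg (eval (t j)) h
    rw [hz, secular_eval_node] at this
    rw [residues, this, neg_neg, mul_div_cancel_right₀ _ (prod_erase_sub_ne_zero ht j)]
  · rintro rfl
    refine eq_of_degree_sub_lt_of_eval_index_eq (s := Finset.univ) (v := t) ht.injOn ?_ ?_
    · have h1 : (∏ k, (X - C (z k)) - ∏ k, (X - C (t k))).degree < (N : WithBot ℕ) := by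
        rw [← degree_prod_X_sub_C z]
        refine degree_sub_lt_left (by rw [degree_prod_X_sub_C, degree_prod_X_sub_C])
          (Finset.prod_ne_zero_iff.2 fun k _ => X_sub_C_ne_zero _) ?_
        rw [(monic_prod_of_monic _ _ fun k _ => monic_X_sub_C _).leadingCoeff,
          (monic_prod_of_monic _ _ fun k _ => monic_X_sub_C _).leadingCoeff]
      rw [secular, ← sub_add,  Finset.card_univ, Fintype.card_fin]
      exact (degree_add_le _ _).trans_lt (max_lt h1 (degree_sum_erase_lt t _))
    · intro j _
      rw [hz, secular_eval_node, residues, div_mul_cancel₀ _ (prod_erase_sub_ne_zero ht j),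
        neg_neg]

open Polynomial in
-- Comparison of the coefficients of X^(N-1). It turns the exponential factors of the Gamma
-- densities into exponentials of ∑ z and ∑ t.
theorem sum_residues {N : ℕ} {t : Fin N → ℝ} (ht : Function.Injective t) (z : Fin N → ℝ) :
    ∑ j, residues t z j = ∑ j, z j - ∑ j, t j := by
  rcases Nat.eq_zero_or_pos N with rfl | hN
  · simp
  have h := congrArg (fun p => p.coeff (N - 1)) ((prod_eq_secular_iff ht _ z).2 rfl)
  have hc : ∀ v : Fin N → ℝ, (∏ k, (X - C (v k))).coeff (N - 1) = - ∑ k, v k := by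
    intro v
    simpa using prod_X_sub_C_coeff_card_pred Finset.univ v (by simpa using hN)
  have he : ∀ j : Fin N, (∏ k ∈ Finset.univ.erase j, (X - C (t k))).coeff (N - 1) = 1 := by
    intro j
    have hm : (∏ k ∈ Finset.univ.erase j, (X - C (t k))).Monic :=
      monic_prod_of_monic _ _ fun k _ => monic_X_sub_C _
    have hd : (∏ k ∈ Finset.univ.erase j, (X - C (t k))).natDegree = N - 1 := by
      rw [natDegree_prod_of_monic _ _ fun l _ => monic_X_sub_C _]; simp
    rw [← hd]
    exact hm.coeff_natDegree
  simp only [secular, coeff_sub, finsetSum_coeff, coeff_C_mul, hc, he, mul_one] at h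
  linarith

/-- For k ≠ j interlacing puts z_k and t_k on the same side of t_j, so each quotient of paired
factors is positive; the unpaired factor is z_j - t_j. -/
theorem residues_pos {N : ℕ} {t z : Fin N → ℝ} (ht : StrictAnti t) (hz : z ∈ Interlace t)
    (j : Fin N) : 0 < residues t z j := by
  have h : residues t z j = (z j - t j) *
      ∏ k ∈ Finset.univ.erase j, ((t j - z k) / (t j - t k)) := by
    rw [residues, ← Finset.mul_prod_erase _ _ (Finset.mem_univ j), Finset.prod_div_distrib]
    ring
  rw [h]
  refine mul_pos (sub_pos.2 (hz.1 j)) (Finset.prod_pos fun k hk => ?_)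
  rcases lt_or_gt_of_ne (Finset.ne_of_mem_erase hk) with hkj | hkj
  · exact div_pos_of_neg_of_neg (sub_neg.2 ((ht hkj).trans (hz.1 k))) (sub_neg.2 (ht hkj))
  · exact div_pos (sub_pos.2 (hz.2 j k hkj)) (sub_pos.2 (ht hkj))

theorem prod_erase_sub_sign {N : ℕ} {t : Fin N → ℝ} (ht : StrictAnti t) (j : Fin N) :
    0 < (-1) ^ (j : ℕ) * ∏ k ∈ Finset.univ.erase j, (t j - t k) := by
  have h : ∏ k ∈ Finset.Iio j, (t j - t k) =
      (-1) ^ (j : ℕ) * ∏ k ∈ Finset.Iio j, (t k - t j) := by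
    rw [← Fin.card_Iio j, ← Finset.prod_const, ← Finset.prod_mul_distrib]
    exact Finset.prod_congr rfl fun k _ => by ring
  rw [prod_erase_eq_Ioi_mul_Iio, h, mul_left_comm, ← mul_assoc (_ ^ _), ← mul_pow]
  norm_num
  exact mul_pos (Finset.prod_pos fun k hk => sub_pos.2 (ht (Finset.mem_Ioi.1 hk)))
    (Finset.prod_pos fun k hk => sub_pos.2 (ht (Finset.mem_Iio.1 hk)))

theorem secular_eval_sign {N : ℕ} {t w : Fin N → ℝ} (ht : StrictAnti t) (hw : ∀ j, 0 < w j)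
    (j : Fin N) : (-1) ^ (j : ℕ) * (secular t w).eval (t j) < 0 := by
  rw [secular_eval_node]
  have := mul_pos (hw j) (prod_erase_sub_sign ht j)
  linarith

/-- The secular polynomial alternates in sign along the nodes, so the intermediate value theorem
gives a root between consecutive nodes. Above the largest node it climbs from a negative value to
+∞. -/
theorem exists_root_secular {N : ℕ} {t w : Fin N → ℝ} (ht : StrictAnti t) (hw : ∀ j, 0 < w j)
    (j : Fin N) : ∃ x, t j < x ∧ (∀ i, i < j → x < t i) ∧ (secular t w).eval x = 0 := by
  have hc : ∀ s, ContinuousOn (fun x => (secular t w).eval x) s := fun s =>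
    (secular t w).continuous.continuousOn
  have hj := secular_eval_sign ht hw j
  rcases Nat.eq_zero_or_pos (j : ℕ) with h0 | h0
  · have hlim : Filter.Tendsto (fun x => (secular t w).eval x) Filter.atTop Filter.atTop := by
      refine Polynomial.tendsto_atTop_of_leadingCoeff_nonneg _ ?_ ?_
      · rw [Polynomial.degree_eq_natDegree (monic_secular t w).ne_zero, natDegree_secular]
        exact_mod_cast j.pos
      · rw [(monic_secular t w).leadingCoeff]; exact zero_le_one
    obtain ⟨y, hy0, hy⟩ := ((hlim.eventually_gt_atTop 0).and
      (Filter.eventually_gt_atTop (t j))).exists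
    rw [h0, pow_zero, one_mul] at hj
    obtain ⟨x, hx, hx0⟩ := intermediate_value_Ioo hy.le (hc _) ⟨hj, hy0⟩
    refine ⟨x, hx.1, fun i hi => ?_, hx0⟩
    have := Fin.lt_def.1 hi
    omega
  · let i : Fin N := ⟨j - 1, by omega⟩
    have hij : i < j := Fin.lt_def.2 (by simp only [i]; omega)
    have hi := secular_eval_sign ht hw i
    have hpow : (-1 : ℝ) ^ (j : ℕ) = -(-1) ^ (i : ℕ) := by
      rw [show (j : ℕ) = i + 1 by simp only [i]; omega, pow_succ]; ring
    have key : ∃ x ∈ Set.Ioo (t j) (t i), (secular t w).eval x = 0 := by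
      rcases neg_one_pow_eq_or ℝ (i : ℕ) with h | h
      · rw [hpow, h] at hj
        rw [h] at hi
        exact intermediate_value_Ioo' (ht hij).le (hc _) ⟨by linarith, by linarith⟩
      · rw [hpow, h] at hj
        rw [h] at hi
        exact intermediate_value_Ioo (ht hij).le (hc _) ⟨by linarith, by linarith⟩
    obtain ⟨x, hx, hx0⟩ := key
    refine ⟨x, hx.1, fun k hk => hx.2.trans_le (ht.antitone ?_), hx0⟩
    have := Fin.lt_def.1 hk
    exact Fin.le_def.2 (by simp only [i]; omega)

open Polynomial in
theorem exists_interlace_prod_eq_secular {N : ℕ} {t w : Fin N → ℝ} (ht : StrictAnti t)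
    (hw : ∀ j, 0 < w j) : ∃ z ∈ Interlace t, ∏ k, (X - C (z k)) = secular t w := by
  choose z hz1 hz2 hz3 using exists_root_secular ht hw
  have hz : z ∈ Interlace t := ⟨hz1, fun j k hjk => hz2 k j hjk⟩
  refine ⟨z, hz, ?_⟩
  -- The N roots found are distinct, so they exhaust a monic polynomial of degree N.
  refine eq_of_degree_sub_lt_of_eval_index_eq (s := Finset.univ) (v := z)
    (Interlace.strictAnti hz).injective.injOn ?_ ?_
  · rw [Finset.card_univ, Fintype.card_fin, ← degree_prod_X_sub_C z]
    refine degree_sub_lt_left ?_ (Finset.prod_ne_zero_iff.2 fun k _ => X_sub_C_ne_zero _) ?_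
    · rw [degree_prod_X_sub_C, degree_eq_natDegree (monic_secular t w).ne_zero, natDegree_secular]
    · rw [(monic_prod_of_monic _ _ fun k _ => monic_X_sub_C _).leadingCoeff,
        (monic_secular t w).leadingCoeff]
  · intro j _
    rw [hz3, eval_prod]
    exact Finset.prod_eq_zero (Finset.mem_univ j) (by simp)

theorem exists_residues_eq {N : ℕ} {t w : Fin N → ℝ} (ht : StrictAnti t)
    (hw : ∀ j, 0 < w j) : ∃ z ∈ Interlace t, residues t z = w := by
  obtain ⟨z, hz, h⟩ := exists_interlace_prod_eq_secular ht hw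
  exact ⟨z, hz, (prod_eq_secular_iff ht.injective w z).1 h⟩

open Polynomial in
theorem antitone_eq_of_map_eq {N : ℕ} {a b : Fin N → ℝ} (ha : Antitone a) (hb : Antitone b)
    (h : Multiset.map a Finset.univ.val = Multiset.map b Finset.univ.val) : a = b := by
  have hl : List.ofFn a = List.ofFn b := by
    refine List.Perm.eq_of_pairwise (le := (· ≥ ·)) (fun _ _ _ _ h1 h2 => le_antisymm h2 h1)
      ?_ ?_ ?_
    · exact List.pairwise_ofFn.2 fun i j hij => ha hij.le
    · exact List.pairwise_ofFn.2 fun i j hij => hb hij.le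
    · simpa [Fin.univ_val_map] using h
  exact List.ofFn_injective hl

open Polynomial in
theorem antitone_eq_of_prod_eq {N : ℕ} {a b : Fin N → ℝ} (ha : Antitone a) (hb : Antitone b)
    (h : ∏ k, (X - C (a k)) = ∏ k, (X - C (b k))) : a = b := by
  refine antitone_eq_of_map_eq ha hb ?_
  have hr : ∀ v : Fin N → ℝ, (∏ k, (X - C (v k))).roots = Multiset.map v Finset.univ.val := by
    intro v
    exact roots_multiset_prod_X_sub_C (Multiset.map v Finset.univ.val) ▸ by
      simp [Finset.prod, Function.comp_def]
  rw [← hr, ← hr, h]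

theorem residues_injOn {N : ℕ} {t : Fin N → ℝ} (ht : StrictAnti t) :
    Set.InjOn (residues t) (Interlace t) := by
  intro z hz z' hz' h
  refine antitone_eq_of_prod_eq (Interlace.strictAnti hz).antitone
    (Interlace.strictAnti hz').antitone ?_
  rw [(prod_eq_secular_iff ht.injective _ z).2 h, (prod_eq_secular_iff ht.injective _ z').2 rfl]

theorem image_residues {N : ℕ} {t : Fin N → ℝ} (ht : StrictAnti t) :
    residues t '' Interlace t = {w | ∀ j, 0 < w j} := by
  ext w
  constructor
  · rintro ⟨z, hz, rfl⟩ j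
    exact residues_pos ht hz j
  · intro hw
    obtain ⟨z, hz, h⟩ := exists_residues_eq ht hw
    exact ⟨z, hz, h⟩

/-! ### The residue map as a change of variables -/

theorem measurableSet_interlace {N : ℕ} (t : Fin N → ℝ) : MeasurableSet (Interlace t) := by
  simp only [Interlace]
  measurability

/-- The Jacobian matrix of `residues t`. -/
def residuesJacobian {N : ℕ} (t z : Fin N → ℝ) : Matrix (Fin N) (Fin N) ℝ :=
  Matrix.diagonal (fun j => (∏ k ∈ Finset.univ.erase j, (t j - t k))⁻¹) *
    Matrix.of fun j k => ∏ l ∈ Finset.univ.erase k, (t j - z l)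

theorem hasFDerivAt_residues {N : ℕ} (t z : Fin N → ℝ) :
    HasFDerivAt (residues t)
      (LinearMap.toContinuousLinearMap (Matrix.toLin' (residuesJacobian t z))) z := by
  rw [hasFDerivAt_pi']
  intro j
  have h1 : ∀ k ∈ (Finset.univ : Finset (Fin N)), HasFDerivAt (fun y : Fin N → ℝ => t j - y k)
      (-ContinuousLinearMap.proj (R := ℝ) (φ := fun _ : Fin N => ℝ) k) z :=
    fun k _ => (ContinuousLinearMap.proj (R := ℝ) (φ := fun _ : Fin N => ℝ) k).hasFDerivAt.const_sub _
  have h2 := ((HasFDerivAt.finsetProd h1).neg).mul_const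
    (∏ k ∈ Finset.univ.erase j, (t j - t k))⁻¹
  refine (h2.congr_fderiv ?_).congr_of_eventuallyEq ?_
  · ext v
    simp [residuesJacobian, Matrix.mulVec, dotProduct, Finset.mul_sum, mul_assoc]
  · exact Filter.Eventually.of_forall fun y => by simp [residues, div_eq_mul_inv]

/-- A Cauchy-type determinant: the polynomial matrix contributes vdm t · vdm z, and the diagonal of
denominators contributes (vdm t)^(-2). -/
theorem abs_det_residuesJacobian {N : ℕ} {t z : Fin N → ℝ} (ht : StrictAnti t)
    (hz : StrictAnti z) : |(residuesJacobian t z).det| = vdm z / vdm t := by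
  rw [residuesJacobian, Matrix.det_mul, Matrix.det_diagonal, abs_mul,
    abs_det_prod_erase t z hz.injective, Finset.prod_inv_distrib, abs_inv, abs_prod_erase_sub,
    abs_of_pos (vdm_pos ht), abs_of_pos (vdm_pos hz)]
  field_simp [(vdm_pos ht).ne']

theorem lintegral_residues {N : ℕ} {t : Fin N → ℝ} (ht : StrictAnti t)
    (φ : (Fin N → ℝ) → ENNReal) :
    ∫⁻ w in {w | ∀ j, 0 < w j}, φ w =
      ∫⁻ z in Interlace t, ENNReal.ofReal (vdm z / vdm t) * φ (residues t z) := by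
  rw [← image_residues ht, lintegral_image_eq_lintegral_abs_det_fderiv_mul volume
    (measurableSet_interlace t) (fun z _ => (hasFDerivAt_residues t z).hasFDerivWithinAt)
    (residues_injOn ht)]
  refine setLIntegral_congr_fun (measurableSet_interlace t) fun z hz => ?_

  rw [LinearMap.det_toContinuousLinearMap, LinearMap.det_toLin',
    abs_det_residuesJacobian ht (Interlace.strictAnti hz)]

/-! ### Gaussian vectors and Gamma laws -/

theorem lintegral_fin_prod {n : ℕ} {E : Type*} [MeasurableSpace E] (μ : Fin n → Measure E)
    [∀ i, SigmaFinite (μ i)] {f : Fin n → E → ENNReal} (hf : ∀ i, Measurable (f i)) :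
    ∫⁻ x : Fin n → E, ∏ i, f i (x i) ∂(Measure.pi μ) = ∏ i, ∫⁻ x, f i x ∂(μ i) := by
  induction n with
  | zero => simp
  | succ n ih =>
    rw [← ((measurePreserving_piFinSuccAbove μ 0).symm).lintegral_comp_emb
      (MeasurableEquiv.measurableEmbedding _)]
    simp_rw [MeasurableEquiv.piFinSuccAbove_symm_apply, Fin.insertNthEquiv,
      Fin.prod_univ_succ, Fin.insertNth_zero, Equiv.coe_fn_mk, Fin.cons_succ, Fin.cons_zero, cast_eq,
      Fin.zero_succAbove]
    rw [lintegral_prod_mul (hf 0).aemeasurable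
      (g := fun x : Fin n → E => ∏ i : Fin n, f (Fin.succ i) (x i))
      (Finset.measurable_prod _ fun i _ => (hf _).comp (measurable_pi_apply i)).aemeasurable]
    congr 1
    exact ih (fun i => μ i.succ) (fun i => hf _)

theorem lintegral_fintype_prod {ι : Type*} [Fintype ι] {E : Type*} [MeasurableSpace E]
    (μ : ι → Measure E) [∀ i, SigmaFinite (μ i)] {f : ι → E → ENNReal}
    (hf : ∀ i, Measurable (f i)) :
    ∫⁻ x : ι → E, ∏ i, f i (x i) ∂(Measure.pi μ) = ∏ i, ∫⁻ x, f i x ∂(μ i) := by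
  let e := (Fintype.equivFin ι).symm
  rw [← (measurePreserving_piCongrLeft _ e).lintegral_comp_emb
    (MeasurableEquiv.measurableEmbedding _)]
  simp_rw [← e.prod_comp, MeasurableEquiv.coe_piCongrLeft, Equiv.piCongrLeft_apply_apply]
  exact lintegral_fin_prod (fun i => μ (e i)) fun i => hf (e i)

theorem pi_withDensity {ι : Type*} [Fintype ι] {E : Type*} [MeasurableSpace E]
    (μ : ι → Measure E) [∀ i, SigmaFinite (μ i)] {f : ι → E → ENNReal}
    (hf : ∀ i, Measurable (f i)) [∀ i, SigmaFinite ((μ i).withDensity (f i))] :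
    Measure.pi (fun i => (μ i).withDensity (f i)) =
      (Measure.pi μ).withDensity fun x => ∏ i, f i (x i) := by
  refine Measure.pi_eq fun s hs => ?_
  rw [withDensity_apply _ (MeasurableSet.univ_pi hs), Measure.restrict_pi_pi,
    lintegral_fintype_prod _ hf]
  exact Finset.prod_congr rfl fun i _ => (withDensity_apply _ (hs i)).symm

/-- Serves to group independent coordinates into blocks, one for each eigenvalue. -/
theorem pi_map_sigma {ι α : Type*} [Fintype ι] [Fintype α] {κ : ι → Type*} [∀ i, Fintype (κ i)]
    {E : Type*} [MeasurableSpace E] (μ : Measure E) [SigmaFinite μ] (e : (Σ i, κ i) ≃ α) :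
    (Measure.pi fun i => Measure.pi fun _ : κ i => μ).map
      (fun y a => y (e.symm a).1 (e.symm a).2) = Measure.pi fun _ : α => μ := by
  refine (Measure.pi_eq fun s hs => ?_).symm
  rw [Measure.map_apply (by fun_prop) (MeasurableSet.univ_pi hs)]
  have : (fun (y : ∀ i, κ i → E) a => y (e.symm a).1 (e.symm a).2) ⁻¹' Set.univ.pi s =
      Set.univ.pi fun i => Set.univ.pi fun k => s (e ⟨i, k⟩) := by
    ext y
    simp only [Set.mem_preimage, Set.mem_univ_pi]
    exact ⟨fun h i k => by
      have := h (e ⟨i, k⟩)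
      rwa [e.symm_apply_apply] at this, fun h a => by
      simpa using h (e.symm a).1 (e.symm a).2⟩
  rw [this]
  simp_rw [Measure.pi_pi]
  rw [← e.prod_comp, Fintype.prod_sigma]

/-- Polar coordinates for a radial integrand. -/
theorem lintegral_fun_norm {E : Type*} [NormedAddCommGroup E] [NormedSpace ℝ E]
    [MeasurableSpace E] [BorelSpace E] [FiniteDimensional ℝ E] [Nontrivial E] (μ : Measure E)
    [μ.IsAddHaarMeasure] {f : ℝ → ENNReal} (hf : Measurable f) :
    ∫⁻ x, f ‖x‖ ∂μ = μ.toSphere Set.univ *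
      ∫⁻ r in Set.Ioi (0 : ℝ), ENNReal.ofReal (r ^ (Module.finrank ℝ E - 1)) * f r := by
  have h1 : ∫⁻ x, f ‖x‖ ∂μ = ∫⁻ x : ({(0)}ᶜ : Set E), f ‖x.1‖ ∂(μ.comap (↑)) := by
    rw [lintegral_subtype_comap (measurableSet_singleton _).compl fun x => f ‖x‖,
      restrict_compl_singleton]
  have h2 := μ.measurePreserving_homeomorphUnitSphereProd.lintegral_comp
    (f := fun p => f p.2.1) (by fun_prop)
  simp only [homeomorphUnitSphereProd_apply_snd_coe] at h2
  rw [h1, h2]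
  have h3 := lintegral_prod_mul (μ := μ.toSphere)
    (ν := Measure.volumeIoiPow (Module.finrank ℝ E - 1)) (f := fun _ => 1)
    (g := fun r => f r.1) aemeasurable_const (by fun_prop)
  simp only [one_mul, lintegral_const] at h3
  rw [h3, Measure.volumeIoiPow, lintegral_withDensity_eq_lintegral_mul _ (by fun_prop)
    (by fun_prop)]
  congr 1
  exact lintegral_subtype_comap measurableSet_Ioi
    fun r => ENNReal.ofReal (r ^ (Module.finrank ℝ E - 1)) * f r

/-- The unnormalized Gamma density `w^{k-1} e^{-w/b}` on `w > 0`. -/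
def gammaDensity (k : ℕ) (b w : ℝ) : ENNReal :=
  (Set.Ioi (0 : ℝ)).indicator (fun w => ENNReal.ofReal (w ^ (k - 1) * Real.exp (-w / b))) w

@[fun_prop]
theorem measurable_gammaDensity (k : ℕ) (b : ℝ) : Measurable (gammaDensity k b) :=
  Measurable.indicator (by fun_prop) measurableSet_Ioi

/-- The total mass forces the factor, so densities need to be known only up to a constant. -/
theorem eq_inv_smul_of_eq_smul {α : Type*} [MeasurableSpace α] {μ ν : Measure α}
    [IsProbabilityMeasure μ] {c : ENNReal} (h : μ = c • ν) : μ = (ν Set.univ)⁻¹ • ν := by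
  have h1 : c * ν Set.univ = 1 := by
    rw [← smul_eq_mul, ← Measure.smul_apply, ← h, measure_univ]
  rw [h, ENNReal.eq_inv_of_mul_eq_one_left h1]

theorem gaussianReal_half_density (x : ℝ) :
    gaussianPDF 0 (1 / 2) x = ENNReal.ofReal (Real.sqrt Real.pi)⁻¹ *
      ENNReal.ofReal (Real.exp (-x ^ 2)) := by
  rw [gaussianPDF, gaussianPDFReal, ← ENNReal.ofReal_mul (by positivity)]
  congr 2
  · norm_num
    field_simp
  · norm_num

theorem pi_gaussian_eq {α : Type*} [Fintype α] :
    Measure.pi (fun _ : α => gaussianReal 0 (1 / 2)) =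
      ENNReal.ofReal (Real.sqrt Real.pi)⁻¹ ^ Fintype.card α •
        volume.withDensity fun x => ENNReal.ofReal (Real.exp (-∑ i, x i ^ 2)) := by
  have h1 : gaussianReal 0 (1 / 2) = volume.withDensity (gaussianPDF 0 (1 / 2)) :=
    gaussianReal_of_var_ne_zero _ (by norm_num)
  have : SigmaFinite ((volume : Measure ℝ).withDensity (gaussianPDF 0 (1 / 2))) := by
    rw [← h1]; infer_instance
  simp_rw [h1]
  rw [pi_withDensity (fun _ : α => (volume : Measure ℝ)) fun _ => measurable_gaussianPDF _ _,
    ← withDensity_smul _ (by fun_prop)]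
  congr 1
  funext x
  simp only [gaussianReal_half_density, Finset.prod_mul_distrib, Finset.prod_const,
    Finset.card_univ, Pi.smul_apply, smul_eq_mul]
  rw [← ENNReal.ofReal_prod_of_nonneg fun _ _ => (Real.exp_pos _).le, ← Real.exp_sum,
    Finset.sum_neg_distrib]

theorem lintegral_gammaDensity {k : ℕ} (hk : 0 < k) {b : ℝ} (hb : 0 < b) (h : ℝ → ENNReal) :
    ∫⁻ w, gammaDensity k b w * h w = ENNReal.ofReal (2 * b ^ k) *
      ∫⁻ r in Set.Ioi (0 : ℝ), ENNReal.ofReal (r ^ (2 * k - 1)) *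
        (ENNReal.ofReal (Real.exp (-r ^ 2)) * h (b * r ^ 2)) := by
  -- Substitution w = b r²: the Jacobian 2br times w^(k-1) is 2 b^k r^(2k-1), the radial weight in
  -- dimension 2k.
  have himg : (fun r : ℝ => b * r ^ 2) '' Set.Ioi 0 = Set.Ioi 0 := by
    ext w
    constructor
    · rintro ⟨r, hr, rfl⟩
      exact mul_pos hb (pow_pos hr 2)
    · intro hw
      refine ⟨Real.sqrt (w / b), Real.sqrt_pos.2 (div_pos hw hb), ?_⟩
      dsimp only
      rw [Real.sq_sqrt (div_pos hw hb).le, mul_div_cancel₀ _ hb.ne']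
  have hinj : Set.InjOn (fun r : ℝ => b * r ^ 2) (Set.Ioi 0) := fun r hr s hs hrs =>
    (pow_left_inj₀ (le_of_lt hr) (le_of_lt hs) two_ne_zero).1 (mul_left_cancel₀ hb.ne' hrs)
  have h1 : ∫⁻ w, gammaDensity k b w * h w = ∫⁻ w in Set.Ioi (0 : ℝ),
      ENNReal.ofReal (w ^ (k - 1) * Real.exp (-w / b)) * h w := by
    rw [← lintegral_indicator measurableSet_Ioi]
    refine lintegral_congr fun w => ?_
    by_cases hw : w ∈ Set.Ioi (0 : ℝ) <;> simp [gammaDensity, hw]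
  have hd : ∀ r ∈ Set.Ioi (0 : ℝ), HasDerivWithinAt (fun r : ℝ => b * r ^ 2) (b * (2 * r))
      (Set.Ioi 0) r := fun r _ => by
    simpa using ((hasDerivAt_pow 2 r).const_mul b).hasDerivWithinAt
  rw [h1, ← himg, lintegral_image_eq_lintegral_abs_deriv_mul measurableSet_Ioi hd hinj, himg,
    ← lintegral_const_mul' _ _ ENNReal.ofReal_ne_top]
  refine setLIntegral_congr_fun measurableSet_Ioi fun r hr => ?_
  have hr : 0 < r := hr
  simp only [← mul_assoc]
  rw [← ENNReal.ofReal_mul (by positivity), ← ENNReal.ofReal_mul (by positivity),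
    abs_of_pos (by positivity)]
  rw [← ENNReal.ofReal_mul (by positivity)]
  congr 2
  obtain ⟨m, rfl⟩ := Nat.exists_eq_succ_of_ne_zero hk.ne'
  rw [show -(b * r ^ 2) / b = -r ^ 2 by field_simp, show 2 * (m + 1) - 1 = 2 * m + 1 by omega,
    Nat.succ_sub_one, Nat.succ_eq_add_one]
  ring

theorem map_gaussian_sum_sq {α : Type*} [Fintype α] {k : ℕ} (hk : 0 < k)
    (hα : Fintype.card α = 2 * k) {b : ℝ} (hb : 0 < b) :
    (Measure.pi fun _ : α => gaussianReal 0 (1 / 2)).map (fun x => b * ∑ i, x i ^ 2) =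
      (volume.withDensity (gammaDensity k b) Set.univ)⁻¹ •
        volume.withDensity (gammaDensity k b) := by
  have hm : Measurable fun x : α → ℝ => b * ∑ i, x i ^ 2 := by fun_prop
  have : IsProbabilityMeasure ((Measure.pi fun _ : α => gaussianReal 0 (1 / 2)).map
      (fun x => b * ∑ i, x i ^ 2)) := Measure.isProbabilityMeasure_map hm.aemeasurable
  have : Nonempty α := Fintype.card_pos_iff.1 (by omega)
  set A := ENNReal.ofReal (Real.sqrt Real.pi)⁻¹ ^ Fintype.card α
  set S := (volume : Measure (EuclideanSpace ℝ α)).toSphere Set.univ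
  have hc0 : ENNReal.ofReal (2 * b ^ k) ≠ 0 := by
    rw [Ne, ENNReal.ofReal_eq_zero, not_le]; positivity
  refine eq_inv_smul_of_eq_smul (c := A * S * (ENNReal.ofReal (2 * b ^ k))⁻¹) ?_
  refine Measure.ext_of_lintegral _ fun h hh => ?_
  rw [lintegral_map hh hm, pi_gaussian_eq, lintegral_smul_measure,
    lintegral_withDensity_eq_lintegral_mul _ (by fun_prop)
      (g := fun x : α → ℝ => h (b * ∑ i, x i ^ 2)) (hh.comp hm), lintegral_smul_measure,
    lintegral_withDensity_eq_lintegral_mul _ (by fun_prop) hh]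
  have h1 := (EuclideanSpace.volume_preserving_symm_measurableEquiv_toLp α).lintegral_comp
    (f := fun x => ENNReal.ofReal (Real.exp (-∑ i, x i ^ 2)) * h (b * ∑ i, x i ^ 2))
    (by fun_prop)
  have h2 := lintegral_fun_norm (volume : Measure (EuclideanSpace ℝ α))
    (f := fun r => ENNReal.ofReal (Real.exp (-r ^ 2)) * h (b * r ^ 2)) (by fun_prop)
  simp only [EuclideanSpace.real_norm_sq_eq, finrank_euclideanSpace, hα] at h2
  have h3 := lintegral_gammaDensity hk hb h
  simp only [Pi.mul_apply, smul_eq_mul]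
  rw [h3, ← h1]
  erw [h2]
  rw [mul_assoc, mul_assoc, ← mul_assoc (_)⁻¹,
    ENNReal.inv_mul_cancel hc0 ENNReal.ofReal_ne_top, one_mul]

/-- The fibres of ρ are disjoint blocks of independent coordinates, so their sums of squares are
independent. Each block has even size 2k_j, so its Gamma law has integer shape k_j. -/
theorem map_gaussian_fiber_sum_sq {α : Type*} [Fintype α] {N : ℕ} (ρ : α → Fin N)
    {k : Fin N → ℕ} (hk : ∀ j, 0 < k j) (hα : ∀ j, Fintype.card {i // ρ i = j} = 2 * k j)
    {b : ℝ} (hb : 0 < b) :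
    (Measure.pi fun _ : α => gaussianReal 0 (1 / 2)).map
      (fun x j => b * ∑ i : {i // ρ i = j}, x i ^ 2) =
      (∏ j, (volume.withDensity (gammaDensity (k j) b) Set.univ)⁻¹) •
        volume.withDensity fun w => ∏ j, gammaDensity (k j) b (w j) := by
  have hprob : ∀ j, IsProbabilityMeasure ((volume.withDensity (gammaDensity (k j) b)
      Set.univ)⁻¹ • volume.withDensity (gammaDensity (k j) b)) := fun j => by
    rw [← map_gaussian_sum_sq (hk j) (hα j) hb]
    exact Measure.isProbabilityMeasure_map (Measurable.aemeasurable (by fun_prop))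
  have h1 : ∀ j, (volume.withDensity (gammaDensity (k j) b) Set.univ)⁻¹ •
      volume.withDensity (gammaDensity (k j) b) = volume.withDensity
        ((volume.withDensity (gammaDensity (k j) b) Set.univ)⁻¹ • gammaDensity (k j) b) :=
    fun j => (withDensity_smul _ (by fun_prop)).symm
  have : ∀ j, SigmaFinite ((volume : Measure ℝ).withDensity
      ((volume.withDensity (gammaDensity (k j) b) Set.univ)⁻¹ • gammaDensity (k j) b)) :=
    fun j => by rw [← h1]; have := hprob j; infer_instance
  rw [← pi_map_sigma (gaussianReal 0 (1 / 2)) (Equiv.sigmaFiberEquiv ρ),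
    Measure.map_map (by fun_prop) (by fun_prop)]
  have h2 : ((fun (x : α → ℝ) j => b * ∑ i : {i // ρ i = j}, x i ^ 2) ∘
      fun (y : ∀ j, {i // ρ i = j} → ℝ) a => y ((Equiv.sigmaFiberEquiv ρ).symm a).1
        ((Equiv.sigmaFiberEquiv ρ).symm a).2) = fun y j => b * ∑ i, y j i ^ 2 := by
    funext y j
    simp only [Function.comp_apply]
    congr 1
    refine Finset.sum_congr rfl fun i _ => ?_
    obtain ⟨i, rfl⟩ := i
    rfl
  have : ∀ j, SigmaFinite ((Measure.pi fun _ : {i // ρ i = j} => gaussianReal 0 (1 / 2)).map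
      fun x => b * ∑ i, x i ^ 2) := fun j => by
    rw [map_gaussian_sum_sq (hk j) (hα j) hb]; have := hprob j; infer_instance
  rw [h2, Measure.pi_map_pi (f := fun j (x : {i // ρ i = j} → ℝ) => b * ∑ i, x i ^ 2)
    (fun j => Measurable.aemeasurable (by fun_prop))]
  simp_rw [fun j => map_gaussian_sum_sq (hk j) (hα j) hb, h1]
  rw [pi_withDensity (fun _ : Fin N => (volume : Measure ℝ)) (fun j => by fun_prop),
    ← withDensity_smul _ (by fun_prop)]
  congr 1
  funext w
  simp [Finset.prod_mul_distrib]

/-- An orthogonal matrix has determinant ±1 and preserves ∑ x_i², on which the Gaussian density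
depends. -/
theorem map_mulVec_pi_gaussian {α : Type*} [Fintype α] [DecidableEq α] {M : Matrix α α ℝ}
    (hM : M.transpose * M = 1) :
    (Measure.pi fun _ : α => gaussianReal 0 (1 / 2)).map (fun x => M.mulVec x) =
      Measure.pi fun _ : α => gaussianReal 0 (1 / 2) := by
  have hdet : M.det * M.det = 1 := by
    have := congrArg Matrix.det hM
    rwa [Matrix.det_mul, Matrix.det_transpose, Matrix.det_one] at this
  have habs : |M.det⁻¹| = 1 := by
    rcases mul_self_eq_one_iff.1 hdet with h | h <;> simp [h]
  have hmeas : Measurable fun x : α → ℝ => M.mulVec x :=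
    (Continuous.matrix_mulVec continuous_const continuous_id).measurable
  have hvol : MeasurePreserving (fun x : α → ℝ => M.mulVec x) volume volume := by
    refine ⟨hmeas, ?_⟩
    have := Real.map_matrix_volume_pi_eq_smul_volume_pi (M := M) (by
      intro h; rw [h] at hdet; simp at hdet)
    rwa [habs, ENNReal.ofReal_one, one_smul] at this
  have hsq : ∀ x : α → ℝ, ∑ i, M.mulVec x i ^ 2 = ∑ i, x i ^ 2 := by
    intro x
    have : M.mulVec x ⬝ᵥ M.mulVec x = x ⬝ᵥ x := by
      rw [Matrix.dotProduct_mulVec, ← Matrix.mulVec_transpose, Matrix.mulVec_mulVec, hM,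
        Matrix.one_mulVec]
    simpa [dotProduct, sq] using this
  refine Measure.ext_of_lintegral _ fun h hh => ?_
  rw [lintegral_map hh hmeas, pi_gaussian_eq, lintegral_smul_measure, lintegral_smul_measure,
    lintegral_withDensity_eq_lintegral_mul _ (by fun_prop)
      (g := fun x : α → ℝ => h (M.mulVec x)) (hh.comp hmeas),
    lintegral_withDensity_eq_lintegral_mul _ (by fun_prop) hh]
  congr 1
  exact (lintegral_congr fun x => by simp [hsq]).trans (hvol.lintegral_comp
    (f := fun x => ENNReal.ofReal (Real.exp (-∑ i, x i ^ 2)) * h x) (by fun_prop))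

/-! ### Rank-one perturbation of a Hermitian matrix and of its realification -/

theorem det_diagonal_add_vecMulVec {K α : Type*} [Field K] [Fintype α] [DecidableEq α]
    {a : α → K} (ha : ∀ i, a i ≠ 0) (u v : α → K) :
    (Matrix.diagonal a + Matrix.vecMulVec u v).det = (∏ i, a i) * (1 + ∑ i, u i * v i / a i) := by
  have h : Matrix.diagonal a + Matrix.vecMulVec u v =
      Matrix.diagonal a * (1 + Matrix.vecMulVec (fun i => u i / a i) v) := by
    rw [mul_add, mul_one, Matrix.mul_vecMulVec]
    congr 2
    funext i
    rw [Matrix.mulVec_diagonal, mul_div_cancel₀ _ (ha i)]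
  rw [h, Matrix.det_mul, Matrix.det_diagonal, Matrix.vecMulVec_eq Unit,
    Matrix.det_one_add_replicateCol_mul_replicateRow]
  congr 2
  exact Finset.sum_congr rfl fun i _ => by ring

/-- Conjugation to diagonal form, then the matrix determinant lemma. Allowing any inverse pair V, W
covers the complex unitary and the real orthogonal diagonalization at once. -/
theorem det_sub_add_vecMulVec {K α : Type*} [Field K] [Fintype α] [DecidableEq α]
    {V W : Matrix α α K} (hVW : V * W = 1) (d : α → K) (b s : K) (hs : ∀ i, s ≠ d i)
    (u v : α → K) :
    (Matrix.scalar α s - (V * Matrix.diagonal d * W + b • Matrix.vecMulVec u v)).det =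
      (∏ i, (s - d i)) * (1 - b * ∑ i, W.mulVec u i * Matrix.vecMul v V i / (s - d i)) := by
  have hWV : W * V = 1 := mul_eq_one_comm.1 hVW
  have h : Matrix.scalar α s - (V * Matrix.diagonal d * W + b • Matrix.vecMulVec u v) =
      V * (Matrix.diagonal (fun i => s - d i) +
        Matrix.vecMulVec (-b • W.mulVec u) (Matrix.vecMul v V)) * W := by
    have h1 : Matrix.diagonal (fun i => s - d i) = Matrix.scalar α s - Matrix.diagonal d := by
      ext i j; by_cases hij : i = j <;> simp [hij]
    have h2 : V * Matrix.scalar α s * W = Matrix.scalar α s := by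
      rw [← (Matrix.scalar_commute s (Commute.all s) V).eq, mul_assoc, hVW, mul_one]
    have h3 : V * Matrix.vecMulVec (-b • W.mulVec u) (Matrix.vecMul v V) * W =
        -(b • Matrix.vecMulVec u v) := by
      rw [Matrix.mul_vecMulVec, Matrix.vecMulVec_mul, Matrix.mulVec_smul, Matrix.mulVec_mulVec,
        Matrix.vecMul_vecMul, hVW, Matrix.one_mulVec, Matrix.vecMul_one, neg_smul]
      ext i j; simp [Matrix.vecMulVec_apply, mul_assoc]
    rw [h1, mul_add, add_mul, h3, mul_sub, sub_mul, h2]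
    abel
  rw [h, Matrix.det_mul, Matrix.det_mul, mul_right_comm, ← Matrix.det_mul, hVW, Matrix.det_one,
    one_mul, det_diagonal_add_vecMulVec fun i => sub_ne_zero.2 (hs i)]
  congr 1
  rw [sub_eq_add_neg, Finset.mul_sum, ← Finset.sum_neg_distrib]
  congr 1
  exact Finset.sum_congr rfl fun i _ => by simp; ring

/-- The complex vector with entries `x_{j0} - i x_{j1}`. -/
def complexVec {n : ℕ} (x : Fin n × Fin 2 → ℝ) (j : Fin n) : ℂ := ⟨x (j, 0), -x (j, 1)⟩

theorem realRep_mul {n : ℕ} (A B : Matrix (Fin n) (Fin n) ℂ) :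
    realRep (A * B) = realRep A * realRep B := by
  ext ⟨i, s⟩ ⟨j, r⟩
  rw [Matrix.mul_apply, Fintype.sum_prod_type]
  simp only [Fin.sum_univ_two]
  fin_cases s <;> fin_cases r <;>
    simp [realRep, Matrix.mul_apply, Finset.sum_add_distrib, Finset.sum_sub_distrib] <;> ring

theorem realRep_conjTranspose {n : ℕ} (A : Matrix (Fin n) (Fin n) ℂ) :
    realRep A.conjTranspose = (realRep A).transpose := by
  ext ⟨i, s⟩ ⟨j, r⟩
  fin_cases s <;> fin_cases r <;> simp [realRep]

theorem realRep_diagonal {n : ℕ} (d : Fin n → ℝ) :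
    realRep (Matrix.diagonal fun i => (d i : ℂ)) = Matrix.diagonal fun p => d p.1 := by
  ext ⟨i, s⟩ ⟨j, r⟩
  by_cases hij : i = j
  · subst hij
    fin_cases s <;> fin_cases r <;> simp [realRep, Matrix.diagonal_apply]
  · fin_cases s <;> fin_cases r <;> simp [realRep, Matrix.diagonal_apply, hij]

theorem realRep_one {n : ℕ} : realRep (1 : Matrix (Fin n) (Fin n) ℂ) = 1 := by
  have := realRep_diagonal (n := n) fun _ => 1
  simpa using this

/-- The minus sign in `complexVec` is forced here: the block with rows (u, v) and (-v, u) acts on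
(a, c) as multiplication by u + iv acts on a - ic. -/
theorem complexVec_realRep_mulVec {n : ℕ} (A : Matrix (Fin n) (Fin n) ℂ)
    (x : Fin n × Fin 2 → ℝ) :
    complexVec ((realRep A).mulVec x) = A.mulVec (complexVec x) := by
  funext i
  apply Complex.ext
  · simp [complexVec, Matrix.mulVec, dotProduct, Fintype.sum_prod_type, realRep]
  · simp only [complexVec, Matrix.mulVec, dotProduct, Fintype.sum_prod_type, realRep,
      Fin.sum_univ_two, Complex.im_sum, ← Finset.sum_neg_distrib]
    exact Finset.sum_congr rfl fun j _ => by simp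

/-- The roots of the characteristic polynomial are the eigenvalues with multiplicity, so the fibre
of ρ over j indexes an orthonormal basis of the eigenspace of t_j. -/
theorem exists_spectral_index {n N : ℕ} {H : Matrix (Fin n) (Fin n) ℂ} (hH : H.IsHermitian)
    {t : Fin N → ℝ} (ht : Function.Injective t) (k : Fin N → ℕ)
    (hc : H.charpoly = ∏ j, (Polynomial.X - Polynomial.C (t j : ℂ)) ^ k j) :
    ∃ ρ : Fin n → Fin N, (∀ i, hH.eigenvalues i = t (ρ i)) ∧
      ∀ j, Fintype.card {i // ρ i = j} = k j := by
  classical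
  have hroots : H.charpoly.roots = ∑ j, k j • ({(t j : ℂ)} : Multiset ℂ) := by
    rw [hc, Polynomial.roots_prod _ _ (Finset.prod_ne_zero_iff.2 fun j _ =>
      pow_ne_zero _ (Polynomial.X_sub_C_ne_zero _))]
    simp [Multiset.bind, Finset.sum, Multiset.join]
  have h2 : Multiset.map (fun i => (hH.eigenvalues i : ℂ)) Finset.univ.val =
      ∑ j, k j • ({(t j : ℂ)} : Multiset ℂ) := by
    rw [← hroots, hH.roots_charpoly_eq_eigenvalues]; rfl
  have h3 : ∀ i, ∃ j, hH.eigenvalues i = t j := by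
    intro i
    have : (hH.eigenvalues i : ℂ) ∈ ∑ j, k j • ({(t j : ℂ)} : Multiset ℂ) := by
      rw [← h2]; exact Multiset.mem_map_of_mem _ (Finset.mem_univ i)
    obtain ⟨j, _, hj⟩ := Multiset.mem_sum.1 this
    refine ⟨j, ?_⟩
    have := Multiset.mem_of_mem_nsmul hj
    exact_mod_cast Multiset.mem_singleton.1 this
  choose ρ hρ using h3
  refine ⟨ρ, hρ, fun j => ?_⟩
  have h4 := congrArg (Multiset.count (t j : ℂ)) h2
  rw [Multiset.count_map, Multiset.count_sum'] at h4
  have h5 : ∀ i, Multiset.count (t j : ℂ) (k i • ({(t i : ℂ)} : Multiset ℂ)) =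
      if i = j then k j else 0 := by
    intro i
    rw [Multiset.count_nsmul, Multiset.count_singleton]
    by_cases h : i = j
    · simp [h]
    · have : (t j : ℂ) ≠ t i := by exact_mod_cast fun h' => h (ht h').symm
      simp [h, this]
  simp only [h5, Finset.sum_ite_eq', Finset.mem_univ, if_true] at h4
  rw [← h4, Fintype.card_subtype, ← Finset.filter_val, Finset.card_val]
  congr 1
  ext i
  simp only [Finset.mem_filter, Finset.mem_univ, true_and, hρ]
  constructor
  · rintro rfl; rfl
  · intro h; exact (ht (by exact_mod_cast h)).symm

/-- The weight w_j is b times the squared norm of the projection of x onto the j-th eigenspace, of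
real dimension 2k_j. The realified eigenvector matrix diagonalizes the realification, so the complex
and the real determinant share these weights; only the multiplicities of the nodes differ. -/
theorem exists_perturbation_weights {n N : ℕ} {H : Matrix (Fin n) (Fin n) ℂ}
    (hH : H.IsHermitian) {t : Fin N → ℝ} (ht : Function.Injective t) {k : Fin N → ℕ}
    (hk : ∀ j, 0 < k j)
    (hc : H.charpoly = ∏ j, (Polynomial.X - Polynomial.C (t j : ℂ)) ^ k j)
    {b : ℝ} (hb : 0 < b) :
    ∃ w : (Fin n × Fin 2 → ℝ) → Fin N → ℝ, Measurable w ∧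
      (Measure.pi fun _ : Fin n × Fin 2 => gaussianReal 0 (1 / 2)).map w =
        (∏ j, (volume.withDensity (gammaDensity (k j) b) Set.univ)⁻¹) •
          volume.withDensity (fun w => ∏ j, gammaDensity (k j) b (w j)) ∧
      ∀ x (s : ℝ), (∀ j, s ≠ t j) →
        (Matrix.scalar (Fin n) (s : ℂ) - (H + (b : ℂ) • Matrix.vecMulVec (complexVec x)
          (star (complexVec x)))).det =
          (((∏ j, (s - t j) ^ k j) * (1 - ∑ j, w x j / (s - t j)) : ℝ) : ℂ) ∧
        (Matrix.scalar (Fin n × Fin 2) s - (realRep H + b • Matrix.vecMulVec x x)).det =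
          (∏ j, (s - t j) ^ k j) ^ 2 * (1 - ∑ j, w x j / (s - t j)) := by
  classical
  obtain ⟨ρ, hρ, hcard⟩ := exists_spectral_index hH ht k hc
  set U : Matrix (Fin n) (Fin n) ℂ := (hH.eigenvectorUnitary : Matrix (Fin n) (Fin n) ℂ)
  have hU1 : U * U.conjTranspose = 1 := Unitary.coe_mul_star_self hH.eigenvectorUnitary
  have hU2 : U.conjTranspose * U = 1 := Unitary.coe_star_mul_self hH.eigenvectorUnitary
  have hspec : H = U * Matrix.diagonal (fun i => ((t (ρ i) : ℝ) : ℂ)) * U.conjTranspose := by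
    conv_lhs => rw [hH.spectral_theorem]
    rw [Unitary.conjStarAlgAut_apply]
    have : (RCLike.ofReal ∘ hH.eigenvalues : Fin n → ℂ) = fun i => ((t (ρ i) : ℝ) : ℂ) := by
      funext i; simp [hρ]
    rw [this]
    rfl
  set V := realRep U
  have hV1 : V * V.transpose = 1 := by
    rw [← realRep_conjTranspose, ← realRep_mul, hU1, realRep_one]
  have hV2 : V.transpose * V = 1 := mul_eq_one_comm.1 hV1
  have hspecR : realRep H = V * Matrix.diagonal (fun p => t (ρ p.1)) * V.transpose := by
    rw [hspec, realRep_mul, realRep_mul, realRep_conjTranspose, realRep_diagonal]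
  let σ : Fin n × Fin 2 → Fin N := fun p => ρ p.1
  let g : (Fin n × Fin 2 → ℝ) → Fin N → ℝ := fun y j => b * ∑ p : {p // σ p = j}, y p ^ 2
  have hmV : Measurable fun x : Fin n × Fin 2 → ℝ => V.transpose.mulVec x :=
    (Continuous.matrix_mulVec continuous_const continuous_id).measurable
  have hmg : Measurable g := by fun_prop
  have hprod : ∀ s : ℝ, ∏ i, (s - t (ρ i)) = ∏ j, (s - t j) ^ k j := by
    intro s
    rw [← Fintype.prod_fiberwise ρ]
    refine Finset.prod_congr rfl fun j _ => ?_
    rw [Finset.prod_congr rfl (g := fun _ => s - t j) fun i _ => by rw [i.2], Finset.prod_const,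
      Finset.card_univ, hcard]
  have hsum : ∀ (y : Fin n × Fin 2 → ℝ) (s : ℝ),
      b * ∑ p, y p ^ 2 / (s - t (σ p)) = ∑ j, g y j / (s - t j) := by
    intro y s
    rw [← Fintype.sum_fiberwise σ, Finset.mul_sum]
    refine Finset.sum_congr rfl fun j _ => ?_
    simp only [g]
    rw [mul_div_assoc, Finset.sum_div]
    congr 1
    exact Finset.sum_congr rfl fun p _ => by rw [p.2]
  refine ⟨fun x => g (V.transpose.mulVec x), hmg.comp hmV, ?_, fun x s hs => ⟨?_, ?_⟩⟩
  · have hσ : ∀ j, Fintype.card {p // σ p = j} = 2 * k j := by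
      intro j
      rw [← hcard j, Fintype.card_subtype, Fintype.card_subtype]
      have : (Finset.univ.filter fun p => σ p = j) =
          (Finset.univ.filter fun i => ρ i = j) ×ˢ (Finset.univ : Finset (Fin 2)) := by
        ext p; simp [σ]
      rw [this, Finset.card_product]
      simp [mul_comm]
    rw [← map_gaussian_fiber_sum_sq σ hk hσ hb]
    conv_rhs => rw [← map_mulVec_pi_gaussian (M := V.transpose) (by simpa using hV1)]
    rw [Measure.map_map hmg hmV]
    rfl
  · rw [hspec, det_sub_add_vecMulVec hU1 _ _ _ fun i => by exact_mod_cast hs (ρ i)]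
    rw [← hsum, ← hprod]
    push_cast
    congr 3
    rw [Fintype.sum_prod_type]
    refine Finset.sum_congr rfl fun i _ => ?_
    have hv : Matrix.vecMul (star (complexVec x)) U = star (U.conjTranspose.mulVec (complexVec x)) := by
      rw [Matrix.star_mulVec, Matrix.conjTranspose_conjTranspose]
    rw [hv, ← complexVec_realRep_mulVec, realRep_conjTranspose, Fin.sum_univ_two, ← add_div]
    congr 1
    -- For one complex coordinate y_0 - i y_1, the product with its conjugate is y_0² + y_1², the
    -- contribution of two real coordinates.
    apply Complex.ext <;> simp [complexVec, V, ← Complex.ofReal_pow] <;> ring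
  · rw [hspecR, det_sub_add_vecMulVec hV1 _ _ _ fun p => hs (ρ p.1)]
    have hv : Matrix.vecMul x V = V.transpose.mulVec x := (Matrix.mulVec_transpose _ _).symm
    rw [hv, ← hsum, Fintype.prod_prod_type]
    simp only [Fin.prod_univ_two]
    rw [← hprod, sq, Finset.prod_mul_distrib]
    congr 3
    exact Finset.sum_congr rfl fun p _ => by rw [sq]

/-! ### The law of the perturbed eigenvalues -/

/-- By Lusin–Souslin an injective map continuous on a Borel set is a measurable embedding. This
gives measurability of ordered roots without a formula for them. -/
theorem exists_measurable_leftInverse {X Y : Type*} [MeasurableSpace X] [TopologicalSpace X]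
    [PolishSpace X] [BorelSpace X] [Nonempty X] [MeasurableSpace Y] [TopologicalSpace Y]
    [T2Space Y] [SecondCountableTopology Y] [BorelSpace Y] {f : X → Y} {s : Set X}
    (hs : MeasurableSet s) (hf : ContinuousOn f s) (hi : Set.InjOn f s) :
    ∃ g : Y → X, Measurable g ∧ ∀ x ∈ s, g (f x) = x := by
  obtain ⟨g, hg, h⟩ := (hf.measurableEmbedding hs hi).exists_measurable_extend
    (measurable_subtype_coe (p := fun x => x ∈ s)) fun _ => inferInstance
  exact ⟨g, hg, fun x hx => congrFun h ⟨x, hx⟩⟩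

/-- The density of the points `z` interlacing `t` whose residues have independent Gamma laws. -/
def interlaceDensity {N : ℕ} (k : Fin N → ℕ) (b : ℝ) (t z : Fin N → ℝ) : ENNReal :=
  (Interlace t).indicator (fun z => ENNReal.ofReal (vdm z / vdm t) *
    ∏ j, gammaDensity (k j) b (residues t z j)) z

@[fun_prop]
theorem measurable_vdm {N : ℕ} : Measurable (vdm (N := N)) := by
  unfold vdm
  fun_prop

@[fun_prop]
theorem measurable_residues_uncurry {N : ℕ} (j : Fin N) :
    Measurable fun p : (Fin N → ℝ) × (Fin N → ℝ) => residues p.1 p.2 j := by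
  unfold residues
  fun_prop

theorem measurableSet_interlace_uncurry {N : ℕ} :
    MeasurableSet {p : (Fin N → ℝ) × (Fin N → ℝ) | p.2 ∈ Interlace p.1} := by
  have : {p : (Fin N → ℝ) × (Fin N → ℝ) | p.2 ∈ Interlace p.1} =
      (⋂ j, {p | p.1 j < p.2 j}) ∩ ⋂ j, ⋂ k, ⋂ _ : j < k, {p | p.2 k < p.1 j} := by
    ext p
    simp [Interlace]
  rw [this]
  refine MeasurableSet.inter (MeasurableSet.iInter fun j => ?_) (MeasurableSet.iInter fun j =>
    MeasurableSet.iInter fun k => MeasurableSet.iInter fun _ => ?_)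
  · exact measurableSet_lt (f := fun p : (Fin N → ℝ) × (Fin N → ℝ) => p.1 j) (by fun_prop)
      (by fun_prop)
  · exact measurableSet_lt (f := fun p : (Fin N → ℝ) × (Fin N → ℝ) => p.2 k) (by fun_prop)
      (by fun_prop)

theorem measurable_interlaceDensity_uncurry {N : ℕ} (k : Fin N → ℕ) (b : ℝ) :
    Measurable fun p : (Fin N → ℝ) × (Fin N → ℝ) => interlaceDensity k b p.1 p.2 := by
  have : (fun p : (Fin N → ℝ) × (Fin N → ℝ) => interlaceDensity k b p.1 p.2) =
      {p : (Fin N → ℝ) × (Fin N → ℝ) | p.2 ∈ Interlace p.1}.indicator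
        (fun p => ENNReal.ofReal (vdm p.2 / vdm p.1) *
          ∏ j, gammaDensity (k j) b (residues p.1 p.2 j)) := by
    funext p
    by_cases hp : p.2 ∈ Interlace p.1 <;> simp [interlaceDensity, hp]
  rw [this]
  exact Measurable.indicator (by fun_prop) measurableSet_interlace_uncurry

theorem continuous_residues {N : ℕ} (t : Fin N → ℝ) : Continuous (residues t) :=
  continuous_iff_continuousAt.2 fun z => (hasFDerivAt_residues t z).continuousAt

open Polynomial in
theorem eval_secular {N : ℕ} {t : Fin N → ℝ} (w : Fin N → ℝ) {s : ℝ} (hs : ∀ j, s ≠ t j) :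
    (secular t w).eval s = (∏ j, (s - t j)) * (1 - ∑ j, w j / (s - t j)) := by
  simp only [secular, eval_sub, eval_prod, eval_X, eval_C, eval_finsetSum, eval_mul]
  rw [mul_sub, mul_one, Finset.mul_sum]
  congr 1
  refine Finset.sum_congr rfl fun j _ => ?_
  rw [← Finset.mul_prod_erase _ _ (Finset.mem_univ j)]
  field_simp [sub_ne_zero.2 (hs j)]

theorem infinite_ne_nodes {N : ℕ} (t : Fin N → ℝ) : {s : ℝ | ∀ j, s ≠ t j}.Infinite := by
  have : {s : ℝ | ∀ j, s ≠ t j} = (Set.range t)ᶜ := by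
    ext s; simp [eq_comm]
  rw [this]
  exact (Set.finite_range t).infinite_compl

open Polynomial in
-- Z inverts the residue map on the Gamma weights. A node of multiplicity k_j loses one copy in the
-- complex matrix and its 2k_j copies lose one in the real matrix; the same N new points appear in
-- both.
theorem exists_perturbation_points {n N : ℕ} {H : Matrix (Fin n) (Fin n) ℂ}
    (hH : H.IsHermitian) {t : Fin N → ℝ} (ht : StrictAnti t) {k : Fin N → ℕ}
    (hk : ∀ j, 0 < k j) (hc : H.charpoly = ∏ j, (X - C (t j : ℂ)) ^ k j)
    {b : ℝ} (hb : 0 < b) :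
    ∃ Z : (Fin n × Fin 2 → ℝ) → Fin N → ℝ, Measurable Z ∧
      (Measure.pi fun _ : Fin n × Fin 2 => gaussianReal 0 (1 / 2)).map Z =
        (∏ j, (volume.withDensity (gammaDensity (k j) b) Set.univ)⁻¹) •
          volume.withDensity (interlaceDensity k b t) ∧
      ∀ᵐ x ∂(Measure.pi fun _ : Fin n × Fin 2 => gaussianReal 0 (1 / 2)),
        Z x ∈ Interlace t ∧
        (H + (b : ℂ) • Matrix.vecMulVec (complexVec x) (star (complexVec x))).charpoly =
          (∏ j, (X - C (t j : ℂ)) ^ (k j - 1)) * ∏ j, (X - C (Z x j : ℂ)) ∧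
        (realRep H + b • Matrix.vecMulVec x x).charpoly =
          (∏ j, (X - C (t j)) ^ (2 * k j - 1)) * ∏ j, (X - C (Z x j)) := by
  obtain ⟨w, hw, hlaw, hdet⟩ := exists_perturbation_weights hH ht.injective hk hc hb
  obtain ⟨g, hg, hgr⟩ := exists_measurable_leftInverse (measurableSet_interlace t)
    (continuous_residues t).continuousOn (residues_injOn ht)
  have hpos : MeasurableSet {w : Fin N → ℝ | ∀ j, 0 < w j} := by
    measurability
  have hG : Measurable fun w : Fin N → ℝ => ∏ j, gammaDensity (k j) b (w j) := by fun_prop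
  have hG0 : ∀ w : Fin N → ℝ, ¬ (∀ j, 0 < w j) → ∏ j, gammaDensity (k j) b (w j) = 0 := by
    intro w hw
    obtain ⟨j, hj⟩ := not_forall.1 hw
    exact Finset.prod_eq_zero (Finset.mem_univ j) (Set.indicator_of_notMem hj _)
  have hκ : Measurable (interlaceDensity k b t) :=
    (measurable_interlaceDensity_uncurry k b).comp measurable_prodMk_left
  refine ⟨fun x => g (w x), hg.comp hw, ?_, ?_⟩
  · change Measure.map (g ∘ w) _ = _
    rw [← Measure.map_map hg hw, hlaw, Measure.map_smul]
    congr 1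
    refine Measure.ext_of_lintegral _ fun h hh => ?_
    rw [lintegral_map hh hg, lintegral_withDensity_eq_lintegral_mul _ hG
      (g := fun w => h (g w)) (hh.comp hg), lintegral_withDensity_eq_lintegral_mul _ hκ hh]
    have h1 : ∫⁻ w, ((fun w : Fin N → ℝ => ∏ j, gammaDensity (k j) b (w j)) *
        fun w => h (g w)) w = ∫⁻ w in {w | ∀ j, 0 < w j},
          (∏ j, gammaDensity (k j) b (w j)) * h (g w) := by
      rw [← lintegral_indicator hpos]
      refine lintegral_congr fun w => ?_
      by_cases hw : ∀ j, 0 < w j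
      · rw [Set.indicator_of_mem (s := {w : Fin N → ℝ | ∀ j, 0 < w j}) hw]; rfl
      · rw [Set.indicator_of_notMem (s := {w : Fin N → ℝ | ∀ j, 0 < w j}) hw, Pi.mul_apply,
          hG0 w hw, zero_mul]
    rw [h1, lintegral_residues ht, ← lintegral_indicator (measurableSet_interlace t)]
    refine lintegral_congr fun z => ?_
    by_cases hz : z ∈ Interlace t
    · simp [interlaceDensity, hz, hgr z hz, mul_assoc]
    · simp [interlaceDensity, hz]
  · have hae : ∀ᵐ x ∂(Measure.pi fun _ : Fin n × Fin 2 => gaussianReal 0 (1 / 2)),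
        ∀ j, 0 < w x j := by
      refine ae_of_ae_map hw.aemeasurable (p := fun w : Fin N → ℝ => ∀ j, 0 < w j) ?_
      rw [hlaw]
      refine Measure.ae_smul_measure ?_ _
      rw [ae_withDensity_iff hG]
      exact Filter.Eventually.of_forall fun w h => by
        by_contra hcon
        exact h (hG0 w hcon)
    filter_upwards [hae] with x hx
    obtain ⟨z, hz, hzw⟩ := exists_residues_eq ht hx
    have hgz : g (w x) = z := by rw [← hzw, hgr z hz]
    have hsec := (prod_eq_secular_iff ht.injective (w x) z).2 hzw
    have hev : ∀ s : ℝ, (∀ j, s ≠ t j) →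
        ∏ j, (s - z j) = (∏ j, (s - t j)) * (1 - ∑ j, w x j / (s - t j)) := by
      intro s hs
      rw [← eval_secular _ hs, ← hsec]
      simp [eval_prod]
    rw [hgz]
    refine ⟨hz, ?_, ?_⟩
    -- The determinant formula holds only off the nodes, but infinitely many real arguments suffice
    -- to identify polynomials.
    · refine eq_of_infinite_eval_eq _ _ (((infinite_ne_nodes t).image
        (Complex.ofReal_injective.injOn)).mono ?_)
      rintro _ ⟨s, hs, rfl⟩
      have h1 : ∏ j, (s - t j) ^ k j = (∏ j, (s - t j) ^ (k j - 1)) * ∏ j, (s - t j) := by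
        rw [← Finset.prod_mul_distrib]
        exact Finset.prod_congr rfl fun j _ => by
          rw [← pow_succ, Nat.sub_add_cancel (hk j)]
      rw [Set.mem_ofPred_eq, Matrix.eval_charpoly, (hdet x s hs).1, h1, mul_assoc, ← hev s hs]
      simp [eval_prod]
    · refine eq_of_infinite_eval_eq _ _ ((infinite_ne_nodes t).mono fun s hs => ?_)
      have h1 : (∏ j, (s - t j) ^ k j) ^ 2 =
          (∏ j, (s - t j) ^ (2 * k j - 1)) * ∏ j, (s - t j) := by
        rw [← Finset.prod_mul_distrib, ← Finset.prod_pow]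
        exact Finset.prod_congr rfl fun j _ => by
          rw [← pow_succ, ← pow_mul]
          congr 1
          have := hk j
          omega
      rw [Set.mem_ofPred_eq, Matrix.eval_charpoly, (hdet x s hs).2, h1, mul_assoc, ← hev s hs]
      simp [eval_prod]

/-! ### The Vandermonde integral over an interlacing box -/

theorem exists_sign_det_vandermonde (m : ℕ) : ∃ ε : ℝ, |ε| = 1 ∧
    ∀ t : Fin m → ℝ, (Matrix.vandermonde t).det = ε * vdm t := by
  refine ⟨∏ j : Fin m, ∏ _k ∈ Finset.Ioi j, (-1), by simp [Finset.abs_prod], fun t => ?_⟩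
  rw [Matrix.det_vandermonde, vdm, ← Finset.prod_mul_distrib]
  refine Finset.prod_congr rfl fun j _ => ?_
  rw [← Finset.prod_mul_distrib]
  exact Finset.prod_congr rfl fun k _ => by ring

/-- Subtract from each row of the Vandermonde matrix of l the row before it, then expand along the
first column, whose only remaining nonzero entry is the leading 1. -/
theorem abs_det_pow_sub {m : ℕ} (l : Fin (m + 1) → ℝ) :
    |(Matrix.of fun i j : Fin m =>
      (l i.castSucc ^ ((j : ℕ) + 1) - l i.succ ^ ((j : ℕ) + 1))).det| = |vdm l| := by
  rw [← abs_det_vandermonde]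
  let B : Matrix (Fin (m + 1)) (Fin (m + 1)) ℝ := Matrix.of fun i j =>
    Fin.cases (l 0 ^ (j : ℕ)) (fun i => l i.succ ^ (j : ℕ) - l i.castSucc ^ (j : ℕ)) i
  have h1 : (Matrix.vandermonde l).det = B.det :=
    Matrix.det_eq_of_forall_row_eq_smul_add_pred (fun _ => 1)
      (fun j => by simp [B, Matrix.vandermonde_apply])
      (fun i j => by simp [B, Matrix.vandermonde_apply])
  have h2 : B.det = (Matrix.of fun i j : Fin m =>
      (l i.succ ^ ((j : ℕ) + 1) - l i.castSucc ^ ((j : ℕ) + 1))).det := by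
    rw [Matrix.det_succ_column_zero, Fin.sum_univ_succ]
    simp only [B, Matrix.of_apply, Fin.cases_zero, Fin.cases_succ, Fin.val_zero, pow_zero,
      sub_self, mul_zero, zero_mul, Finset.sum_const_zero, add_zero, one_mul]
    congr 1
  have h3 : (Matrix.of fun i j : Fin m =>
      (l i.castSucc ^ ((j : ℕ) + 1) - l i.succ ^ ((j : ℕ) + 1))) = -(Matrix.of fun i j : Fin m =>
      (l i.succ ^ ((j : ℕ) + 1) - l i.castSucc ^ ((j : ℕ) + 1))) := by
    ext i j; simp
  rw [h1, h2, h3, Matrix.det_neg, abs_mul]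
  simp

theorem continuous_vdm {N : ℕ} : Continuous (vdm (N := N)) := by
  unfold vdm
  fun_prop

theorem setIntegral_Ioo_pow {a b : ℝ} (hab : a ≤ b) (k : ℕ) :
    ∫ x in Set.Ioo a b, x ^ k = (b ^ (k + 1) - a ^ (k + 1)) / (k + 1) := by
  rw [← integral_Ioc_eq_integral_Ioo, ← intervalIntegral.integral_of_le hab, integral_pow]

/-- Each variable occurs in a single row, so in every Leibniz term the integral factors into
integrals of monomials over intervals. -/
theorem integral_det_vandermonde_box {m : ℕ} {l : Fin (m + 1) → ℝ} (hl : StrictAnti l) :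
    ∫ t in Set.univ.pi fun i : Fin m => Set.Ioo (l i.succ) (l i.castSucc),
      (Matrix.vandermonde t).det =
    (∏ j : Fin m, ((j : ℝ) + 1)⁻¹) * (Matrix.of fun i j : Fin m =>
      (l i.castSucc ^ ((j : ℕ) + 1) - l i.succ ^ ((j : ℕ) + 1))).det := by
  have hle : ∀ i : Fin m, l i.succ ≤ l i.castSucc := fun i => (hl i.castSucc_lt_succ).le
  have hint : ∀ σ : Equiv.Perm (Fin m), Integrable (fun t : Fin m → ℝ =>
      ∏ i, t i ^ (σ i : ℕ)) (Measure.pi fun i : Fin m =>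
        volume.restrict (Set.Ioo (l i.succ) (l i.castSucc))) := fun σ =>
    Integrable.fintype_prod (f := fun (i : Fin m) (x : ℝ) => x ^ (σ i : ℕ)) fun i =>
      ((continuous_pow _).integrableOn_Icc (a := l i.succ) (b := l i.castSucc)).mono_set
        Set.Ioo_subset_Icc_self
  rw [volume_pi, Measure.restrict_pi_pi]
  rw [← Matrix.det_transpose (Matrix.of _)]
  simp_rw [← Matrix.det_transpose (Matrix.vandermonde _), Matrix.det_apply,
    Matrix.transpose_apply, Matrix.vandermonde_apply, Matrix.of_apply]
  rw [integral_finsetSum _ fun σ _ => by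
    simpa [Units.smul_def] using (hint σ).const_mul (((Equiv.Perm.sign σ : ℤˣ) : ℤ) : ℝ)]
  rw [Finset.mul_sum]
  refine Finset.sum_congr rfl fun σ _ => ?_
  simp only [Units.smul_def, zsmul_eq_mul]
  rw [integral_const_mul, integral_fintype_prod_eq_prod (fun i (x : ℝ) => x ^ (σ i : ℕ))]
  rw [Finset.prod_congr rfl fun i _ => setIntegral_Ioo_pow (hle i) _, Finset.prod_div_distrib,
    Equiv.prod_comp σ (fun j => ((j : ℕ) : ℝ) + 1), Finset.prod_inv_distrib]
  field_simp

/-- On the box the tuple is decreasing, so its Vandermonde product has constant sign and absolute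
values can be moved through the determinant integral. This is the integral that eliminates the old
eigenvalues. -/
theorem lintegral_vdm_box {m : ℕ} {l : Fin (m + 1) → ℝ} (hl : StrictAnti l) :
    ∫⁻ t in Set.univ.pi fun i : Fin m => Set.Ioo (l i.succ) (l i.castSucc),
      ENNReal.ofReal (vdm t) =
    ENNReal.ofReal (∏ j : Fin m, ((j : ℝ) + 1)⁻¹) * ENNReal.ofReal (vdm l) := by
  obtain ⟨ε, hε, hV⟩ := exists_sign_det_vandermonde m
  have hbox : MeasurableSet (Set.univ.pi fun i : Fin m => Set.Ioo (l i.succ) (l i.castSucc)) :=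
    MeasurableSet.univ_pi fun _ => measurableSet_Ioo
  have hpos : ∀ t ∈ Set.univ.pi fun i : Fin m => Set.Ioo (l i.succ) (l i.castSucc),
      0 < vdm t := by
    intro t ht
    refine vdm_pos fun i j hij => ?_
    refine (ht j trivial).2.trans_le ((hl.antitone ?_).trans (ht i trivial).1.le)
    exact Fin.le_def.2 (by have := Fin.lt_def.1 hij; simp; omega)
  have hint : IntegrableOn (vdm (N := m))
      (Set.univ.pi fun i : Fin m => Set.Ioo (l i.succ) (l i.castSucc)) :=
    (continuous_vdm.continuousOn.integrableOn_compact
      (isCompact_univ_pi fun i : Fin m => isCompact_Icc (a := l i.succ)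
        (b := l i.castSucc))).mono_set (Set.pi_mono fun i _ => Set.Ioo_subset_Icc_self)
  have hae : 0 ≤ᵐ[volume.restrict (Set.univ.pi fun i : Fin m =>
      Set.Ioo (l i.succ) (l i.castSucc))] vdm (N := m) :=
    (ae_restrict_iff' hbox).2 (Filter.Eventually.of_forall fun t ht => (hpos t ht).le)
  rw [← ofReal_integral_eq_lintegral_ofReal hint hae, ← ENNReal.ofReal_mul (by positivity)]
  congr 1
  have h := congrArg abs (integral_det_vandermonde_box hl)
  simp_rw [hV] at h
  rw [integral_const_mul, abs_mul, hε, one_mul, abs_of_nonneg (integral_nonneg_of_ae hae),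
    abs_mul, abs_det_pow_sub, abs_of_pos (vdm_pos hl), abs_of_nonneg (by positivity)] at h
  exact h

theorem vdm_snoc {m : ℕ} (t : Fin m → ℝ) (a : ℝ) :
    vdm (Fin.snoc t a : Fin (m + 1) → ℝ) = vdm t * ∏ j, (t j - a) := by
  have h : ∀ {N : ℕ} (z : Fin N → ℝ), vdm z = ∏ j, ∏ k, if j < k then z j - z k else 1 := by
    intro N z
    refine Finset.prod_congr rfl fun j _ => ?_
    rw [← Finset.prod_filter]
    exact Finset.prod_congr (by ext; simp) fun _ _ => rfl
  rw [h, h, Fin.prod_univ_castSucc]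
  simp only [Fin.prod_univ_castSucc, Fin.snoc_castSucc, Fin.snoc_last, Fin.castSucc_lt_castSucc_iff,
    Fin.castSucc_lt_last, if_true, lt_irrefl, if_false, mul_one, Finset.prod_mul_distrib,
    not_lt_of_gt (Fin.castSucc_lt_last _), Finset.prod_const_one]

/-! ### Adding one row: the recursion for densities -/

/-- Decreasing tuples of positive numbers. -/
def posChamber (m : ℕ) : Set (Fin m → ℝ) := {t | StrictAnti t ∧ ∀ j, 0 < t j}

/-- The unnormalized density of the decreasingly ordered `LUE_m` with parameter `r`. -/
def orderedLaguerreDensity (r m : ℕ) (t : Fin m → ℝ) : ENNReal :=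
  (posChamber m).indicator
    (fun t => ENNReal.ofReal ((∏ j, t j ^ r * Real.exp (-t j)) * vdm t ^ 2)) t

theorem measurableSet_strictAnti (m : ℕ) : MeasurableSet {t : Fin m → ℝ | StrictAnti t} := by
  simp only [StrictAnti]
  measurability

theorem measurableSet_posChamber (m : ℕ) : MeasurableSet (posChamber m) := by
  have h : MeasurableSet {t : Fin m → ℝ | ∀ j, 0 < t j} := by measurability
  exact (measurableSet_strictAnti m).inter h

@[fun_prop]
theorem measurable_orderedLaguerreDensity (r m : ℕ) :
    Measurable (orderedLaguerreDensity r m) :=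
  Measurable.indicator (by fun_prop) (measurableSet_posChamber m)

/-- The open box of tuples strictly interlaced with the `m + 1` points `l`. -/
def interlaceBox {m : ℕ} (l : Fin (m + 1) → ℝ) : Set (Fin m → ℝ) :=
  Set.univ.pi fun i : Fin m => Set.Ioo (l i.succ) (l i.castSucc)

/-- With 0 appended as lowest node, the last interlacing condition says that the smallest new point
is positive. Reading the constraints from l instead of t exposes the box of integration. -/
theorem mem_posChamber_and_mem_interlace_snoc_iff {m : ℕ} (t : Fin m → ℝ)
    (l : Fin (m + 1) → ℝ) :
    (t ∈ posChamber m ∧ l ∈ Interlace (Fin.snoc t 0 : Fin (m + 1) → ℝ)) ↔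
      l ∈ posChamber (m + 1) ∧ t ∈ interlaceBox l := by
  constructor
  · rintro ⟨⟨_, ht0⟩, hl⟩
    have h1 : ∀ i : Fin m, t i < l i.castSucc := fun i => by simpa using hl.1 i.castSucc
    have h2 : 0 < l (Fin.last m) := by simpa using hl.1 (Fin.last m)
    refine ⟨⟨Interlace.strictAnti hl, fun j => ?_⟩, fun i _ => ⟨?_, h1 i⟩⟩
    · exact h2.trans_le ((Interlace.strictAnti hl).antitone (Fin.le_last j))
    · simpa using hl.2 i.castSucc i.succ i.castSucc_lt_succ
  · rintro ⟨⟨hl, hl0⟩, ht⟩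
    refine ⟨⟨fun i j hij => ?_, fun j => (hl0 _).trans (ht j trivial).1⟩, fun j => ?_,
      fun j k hjk => ?_⟩
    · refine (ht j trivial).2.trans_le ((hl.antitone ?_).trans (ht i trivial).1.le)
      exact Fin.le_def.2 (by have := Fin.lt_def.1 hij; simp; omega)
    · refine Fin.lastCases ?_ (fun i => ?_) j
      · simpa using hl0 _
      · simpa using (ht i trivial).2
    · obtain ⟨i, rfl⟩ : ∃ i : Fin m, j = i.castSucc :=
        ⟨j.castPred (ne_of_lt (hjk.trans_le (Fin.le_last k))), by simp⟩
      simp only [Fin.snoc_castSucc]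
      exact (hl.antitone (Fin.le_def.2 (by have := Fin.lt_def.1 hjk; simp at this ⊢; omega))).trans_lt (ht i trivial).1

theorem strictAnti_snoc_zero {m : ℕ} {t : Fin m → ℝ} (ht : t ∈ posChamber m) :
    StrictAnti (Fin.snoc t 0 : Fin (m + 1) → ℝ) := by
  intro j k hjk
  obtain ⟨i, rfl⟩ : ∃ i : Fin m, j = i.castSucc :=
    ⟨j.castPred (ne_of_lt (hjk.trans_le (Fin.le_last k))), by simp⟩
  revert hjk
  refine Fin.lastCases (fun _ => ?_) (fun k hjk => ?_) k
  · simpa using ht.2 i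
  · simpa using ht.1 (Fin.castSucc_lt_castSucc_iff.1 hjk)

theorem residues_snoc_zero_last {m : ℕ} {t : Fin m → ℝ} (ht : ∀ j, t j ≠ 0)
    (l : Fin (m + 1) → ℝ) :
    residues (Fin.snoc t 0 : Fin (m + 1) → ℝ) l (Fin.last m) = (∏ j, l j) / ∏ j, t j := by
  have herase : (Finset.univ.erase (Fin.last m)) = Finset.univ.map Fin.castSuccEmb := by
    ext j
    refine Fin.lastCases ?_ (fun i => ?_) j
    · simp [Fin.ext_iff]
      exact fun i => i.isLt.ne
    · simp [Fin.ext_iff]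
      exact i.isLt.ne
  have h0 : ∏ j, t j ≠ 0 := Finset.prod_ne_zero_iff.2 fun j _ => ht j
  simp only [residues, herase, Finset.prod_map, Fin.snoc_last, zero_sub, Fin.coe_castSuccEmb,
    Fin.snoc_castSucc, Finset.prod_neg, Finset.card_map, Finset.card_univ, Fintype.card_fin]
  rw [pow_succ]
  rcases neg_one_pow_eq_or ℝ m with h | h <;> rw [h] <;> field_simp

theorem prod_gammaDensity {N : ℕ} (k : Fin N → ℕ) (b : ℝ) {w : Fin N → ℝ} (hw : ∀ j, 0 < w j) :
    ∏ j, gammaDensity (k j) b (w j) =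
      ENNReal.ofReal ((∏ j, w j ^ (k j - 1)) * Real.exp (-(∑ j, w j) / b)) := by
  have : ∀ j, gammaDensity (k j) b (w j) =
      ENNReal.ofReal (w j ^ (k j - 1) * Real.exp (-w j / b)) := fun j =>
    Set.indicator_of_mem (s := Set.Ioi (0 : ℝ)) (hw j) _
  simp_rw [this]
  rw [← ENNReal.ofReal_prod_of_nonneg fun j _ =>
    mul_nonneg (pow_nonneg (hw j).le _) (Real.exp_pos _).le, Finset.prod_mul_distrib,
    ← Real.exp_sum, ← Finset.sum_div, Finset.sum_neg_distrib]

/-- The residue at 0 is ∏ l / ∏ t and enters with power r, while the node 0 makes the denominator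
vdm t · ∏ t. All powers of ∏ t cancel, as does e^(-∑ t), leaving one factor vdm t and a function of
l. -/
theorem orderedLaguerreDensity_mul_interlaceDensity (r m : ℕ) (t : Fin m → ℝ)
    (l : Fin (m + 1) → ℝ) :
    orderedLaguerreDensity (r + 1) m t * interlaceDensity
      (Fin.snoc (fun _ : Fin m => 1) (r + 1) : Fin (m + 1) → ℕ) 1
      (Fin.snoc t 0 : Fin (m + 1) → ℝ) l =
    (posChamber (m + 1)).indicator (fun l => ENNReal.ofReal
      ((∏ j, l j ^ r * Real.exp (-l j)) * vdm l)) l *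
      (interlaceBox l).indicator (fun t => ENNReal.ofReal (vdm t)) t := by
  have hiff := mem_posChamber_and_mem_interlace_snoc_iff t l
  by_cases h : t ∈ posChamber m ∧ l ∈ Interlace (Fin.snoc t 0 : Fin (m + 1) → ℝ)
  · obtain ⟨hl, hb⟩ := hiff.1 h
    obtain ⟨ht, hi⟩ := h
    have hsn := strictAnti_snoc_zero ht
    have hvt := vdm_pos ht.1
    have hvl := vdm_pos hl.1
    have hpt : 0 < ∏ j, t j := Finset.prod_pos fun j _ => ht.2 j
    have hpl : 0 < ∏ j, l j := Finset.prod_pos fun j _ => hl.2 j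
    rw [orderedLaguerreDensity, interlaceDensity, Set.indicator_of_mem ht,
      Set.indicator_of_mem hi, Set.indicator_of_mem hl, Set.indicator_of_mem hb,
      prod_gammaDensity _ _ (residues_pos hsn hi), sum_residues hsn.injective,
      Fin.prod_univ_castSucc (fun j => residues _ l j ^ _)]
    simp only [Fin.snoc_castSucc, Fin.snoc_last, Nat.sub_self, pow_zero, Finset.prod_const_one,
      one_mul, Nat.add_sub_cancel, div_one, Fin.sum_univ_castSucc (Fin.snoc t 0), add_zero]
    rw [residues_snoc_zero_last fun j => (ht.2 j).ne', vdm_snoc]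
    simp only [sub_zero]
    have hexp : ∀ {N : ℕ} (z : Fin N → ℝ), ∏ j, z j ^ r * Real.exp (-z j) =
        (∏ j, z j) ^ r * Real.exp (-∑ j, z j) := fun z => by
      rw [Finset.prod_mul_distrib, Finset.prod_pow, ← Real.exp_sum, Finset.sum_neg_distrib]
    have hexp' : ∏ j, t j ^ (r + 1) * Real.exp (-t j) =
        (∏ j, t j) ^ (r + 1) * Real.exp (-∑ j, t j) := by
      rw [Finset.prod_mul_distrib, Finset.prod_pow, ← Real.exp_sum, Finset.sum_neg_distrib]
    rw [hexp, hexp', ← ENNReal.ofReal_mul (by positivity), ← ENNReal.ofReal_mul (by positivity),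
      ← ENNReal.ofReal_mul (by positivity)]
    congr 1
    rw [show -(∑ j, l j - ∑ j, t j) = -(∑ j, l j) - -(∑ j, t j) by ring, Real.exp_sub]
    have := (Real.exp_pos (-∑ j, t j)).ne'
    rw [div_pow]
    field_simp
    ring
  · rw [hiff] at h
    have h' := h
    rw [← hiff] at h'
    rw [not_and_or] at h h'
    trans 0
    · rcases h' with h' | h' <;> simp [orderedLaguerreDensity, interlaceDensity, h']
    · rcases h with h | h <;> simp [h]

theorem lintegral_orderedLaguerreDensity_mul_interlaceDensity (r m : ℕ) (l : Fin (m + 1) → ℝ) :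
    ∫⁻ t, orderedLaguerreDensity (r + 1) m t * interlaceDensity
      (Fin.snoc (fun _ : Fin m => 1) (r + 1) : Fin (m + 1) → ℕ) 1
      (Fin.snoc t 0 : Fin (m + 1) → ℝ) l =
    ENNReal.ofReal (∏ j : Fin m, ((j : ℝ) + 1)⁻¹) * orderedLaguerreDensity r (m + 1) l := by
  simp_rw [orderedLaguerreDensity_mul_interlaceDensity]
  by_cases hl : l ∈ posChamber (m + 1)
  · have hvl := vdm_pos hl.1
    have hp : 0 ≤ ∏ j, l j ^ r * Real.exp (-l j) := Finset.prod_nonneg fun j _ =>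
      mul_nonneg (pow_nonneg (hl.2 j).le _) (Real.exp_pos _).le
    have hbox : MeasurableSet (interlaceBox l) :=
      MeasurableSet.univ_pi fun _ => measurableSet_Ioo
    rw [lintegral_const_mul _ (Measurable.indicator (by fun_prop) hbox),
      lintegral_indicator hbox, interlaceBox,
      lintegral_vdm_box hl.1, orderedLaguerreDensity, Set.indicator_of_mem hl,
      Set.indicator_of_mem hl, mul_left_comm, ← ENNReal.ofReal_mul (by positivity)]
    congr 2
    ring
  · simp [orderedLaguerreDensity, hl]

/-! ### Transporting laws through encodings and transitions -/

/-- Upgrades an equality of laws to an almost sure identity: R reads the points off the observed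
data D, and the set where this decoding succeeds is measurable and has full measure under the common
law. -/
theorem exists_section_of_map_eq {Ω X S : Type*} [MeasurableSpace Ω] [MeasurableSpace X]
    [MeasurableSpace S] [MeasurableEq S] {P : Measure Ω} {ν : Measure X} {D : Ω → S} {Φ : X → S}
    {R : S → X} (hD : Measurable D) (hΦ : Measurable Φ) (hR : Measurable R)
    (hRΦ : ∀ᵐ t ∂ν, R (Φ t) = t) (h : P.map D = ν.map Φ) :
    P.map (fun ω => R (D ω)) = ν ∧ ∀ᵐ ω ∂P, D ω = Φ (R (D ω)) := by
  constructor
  · change P.map (R ∘ D) = ν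
    rw [← Measure.map_map hR hD, h, Measure.map_map hR hΦ,
      Measure.map_congr (g := id) (by filter_upwards [hRΦ] with t ht using ht), Measure.map_id]
  · refine ae_of_ae_map hD.aemeasurable (p := fun s => s = Φ (R s)) ?_
    have hs : MeasurableSet {s | s = Φ (R s)} := measurableSet_eq_fun measurable_id (hΦ.comp hR)
    rw [h, ae_map_iff hΦ.aemeasurable hs]
    filter_upwards [hRΦ] with t ht
    rw [ht]

/-- Tonelli with a conditional density. Z may be chosen separately for each ω, with no measurability
in ω, because only its law enters; joint measurability is needed for D and κ. -/
theorem map_prod_of_transition {Ω E Y : Type*} [MeasurableSpace Ω] [MeasurableSpace E]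
    [MeasurableSpace Y] {p q : ℕ} {P : Measure Ω} [SFinite P] {γ : Measure E} [SFinite γ]
    {T : Ω → Fin p → ℝ} (hT : Measurable T) {f : (Fin p → ℝ) → ENNReal} (hf : Measurable f)
    {c C : ENNReal} (hlaw : P.map T = c • volume.withDensity f)
    {κ : (Fin p → ℝ) → (Fin q → ℝ) → ENNReal} (hκ : Measurable (Function.uncurry κ))
    {g : (Fin p → ℝ) × (Fin q → ℝ) → Y} (hg : Measurable g) {D : E × Ω → Y} (hD : Measurable D)
    (h : ∀ᵐ ω ∂P, ∃ Z : E → Fin q → ℝ, Measurable Z ∧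
      γ.map Z = C • volume.withDensity (κ (T ω)) ∧ ∀ᵐ x ∂γ, D (x, ω) = g (T ω, Z x)) :
    (γ.prod P).map D = (c * C) • ((volume.prod volume).withDensity
      fun z => f z.1 * κ z.1 z.2).map g := by
  have hfκ : Measurable fun z : (Fin p → ℝ) × (Fin q → ℝ) => f z.1 * κ z.1 z.2 :=
    (hf.comp measurable_fst).mul hκ
  refine Measure.ext_of_lintegral _ fun φ hφ => ?_
  rw [lintegral_map hφ hD, lintegral_prod_symm (fun z => φ (D z)) (hφ.comp hD).aemeasurable,
    lintegral_smul_measure, lintegral_map hφ hg,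
    lintegral_withDensity_eq_lintegral_mul _ hfκ (g := fun z => φ (g z)) (hφ.comp hg)]
  have h1 : ∀ᵐ ω ∂P, ∫⁻ x, φ (D (x, ω)) ∂γ = C * ∫⁻ z, κ (T ω) z * φ (g (T ω, z)) := by
    filter_upwards [h] with ω hω
    obtain ⟨Z, hZ, hZlaw, hZD⟩ := hω
    have hφg : Measurable fun z => φ (g (T ω, z)) := (hφ.comp hg).comp measurable_prodMk_left
    rw [lintegral_congr_ae (g := fun x => φ (g (T ω, Z x)))
      (by filter_upwards [hZD] with x hx using by rw [hx]),
      ← lintegral_map (f := fun z => φ (g (T ω, z))) hφg hZ, hZlaw, lintegral_smul_measure,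
      lintegral_withDensity_eq_lintegral_mul _ (f := κ (T ω)) (hκ.comp measurable_prodMk_left) hφg]
    rfl
  have h2 : Measurable fun t => ∫⁻ z, κ t z * φ (g (t, z)) :=
    Measurable.lintegral_prod_right' (f := fun z : (Fin p → ℝ) × (Fin q → ℝ) =>
      κ z.1 z.2 * φ (g z)) (hκ.mul (hφ.comp hg))
  have h3 : Measurable fun z : (Fin p → ℝ) × (Fin q → ℝ) => f z.1 * κ z.1 z.2 * φ (g z) :=
    hfκ.mul (hφ.comp hg)
  rw [lintegral_congr_ae h1, ← lintegral_map (f := fun t => C * ∫⁻ z, κ t z * φ (g (t, z)))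
    (h2.const_mul C) hT, hlaw, lintegral_smul_measure,
    lintegral_withDensity_eq_lintegral_mul _ hf (h2.const_mul C)]
  simp only [Pi.mul_apply, smul_eq_mul]
  rw [lintegral_prod _ h3.aemeasurable, mul_assoc]
  congr 1
  rw [← lintegral_const_mul C h3.lintegral_prod_right']
  refine lintegral_congr fun t => ?_
  simp only [mul_assoc]
  rw [lintegral_const_mul (f t), mul_left_comm]
  exact (hκ.mul (hφ.comp hg)).comp measurable_prodMk_left

theorem map_snd_withDensity {X Y : Type*} [MeasurableSpace X] [MeasurableSpace Y]
    {μ : Measure X} {ν : Measure Y} [SFinite μ] [SFinite ν] {F : X × Y → ENNReal}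
    (hF : Measurable F) :
    ((μ.prod ν).withDensity F).map Prod.snd = ν.withDensity fun y => ∫⁻ x, F (x, y) ∂μ := by
  refine Measure.ext_of_lintegral _ fun φ hφ => ?_
  rw [lintegral_map hφ measurable_snd, lintegral_withDensity_eq_lintegral_mul _ hF
    (g := fun z => φ z.2) (hφ.comp measurable_snd),
    lintegral_withDensity_eq_lintegral_mul _ hF.lintegral_prod_left' hφ,
    lintegral_prod_symm (F * fun z : X × Y => φ z.2) (hF.mul (hφ.comp measurable_snd)).aemeasurable]
  refine lintegral_congr fun y => ?_
  simp only [Pi.mul_apply]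
  rw [lintegral_mul_const]
  · exact hF.comp measurable_prodMk_right

/-! ### Encoding of spectra and the eigenvalue law of the Wishart sums -/

/-- The values of the characteristic polynomial of `M` at the positive integers. -/
def detSeq {n : ℕ} (M : Matrix (Fin n) (Fin n) ℂ) (k : ℕ) : ℂ :=
  (Matrix.scalar (Fin n) ((k : ℂ) + 1) - M).det

/-- The values of `X^r ∏ (X - t_j)` at the positive integers. -/
def nodeSeq (r : ℕ) {m : ℕ} (t : Fin m → ℝ) (k : ℕ) : ℂ :=
  ((k : ℂ) + 1) ^ r * ∏ j, ((k : ℂ) + 1 - t j)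

theorem infinite_natCast_add_one : (Set.range fun k : ℕ => (k : ℂ) + 1).Infinite :=
  Set.infinite_range_of_injective fun a b h => by simpa using h

open Polynomial in
theorem charpoly_eq_of_detSeq_eq {n : ℕ} {M : Matrix (Fin n) (Fin n) ℂ} {p : ℂ[X]}
    (h : ∀ k : ℕ, detSeq M k = p.eval ((k : ℂ) + 1)) : M.charpoly = p := by
  refine eq_of_infinite_eval_eq _ _ (infinite_natCast_add_one.mono ?_)
  rintro _ ⟨k, rfl⟩
  rw [Set.mem_ofPred_eq, Matrix.eval_charpoly, ← h k]
  rfl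

open Polynomial in
theorem nodeSeq_injOn (r m : ℕ) : Set.InjOn (nodeSeq r (m := m)) {t | Antitone t} := by
  intro s hs t ht hst
  refine antitone_eq_of_prod_eq hs ht ?_
  refine Polynomial.map_injective Complex.ofRealHom Complex.ofReal_injective ?_
  refine eq_of_infinite_eval_eq _ _ (infinite_natCast_add_one.mono ?_)
  rintro _ ⟨k, rfl⟩
  have h := congrFun hst k
  simp only [nodeSeq] at h
  -- Evaluating at k + 1 instead of k keeps the factor X^r nonzero, so it can be cancelled.
  have := mul_left_cancel₀ (pow_ne_zero r (by exact_mod_cast k.succ_ne_zero)) h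
  simpa [Polynomial.map_prod, eval_prod] using this

theorem continuous_nodeSeq (r m : ℕ) : Continuous (nodeSeq r (m := m)) := by
  unfold nodeSeq
  fun_prop

theorem measurableSet_antitone (m : ℕ) : MeasurableSet {t : Fin m → ℝ | Antitone t} := by
  simp only [Antitone]
  measurability

theorem exists_nodeSeq_leftInverse (r m : ℕ) : ∃ R : (ℕ → ℂ) → Fin m → ℝ, Measurable R ∧
    ∀ t, Antitone t → R (nodeSeq r t) = t :=
  exists_measurable_leftInverse (measurableSet_antitone m) (continuous_nodeSeq r m).continuousOn
    (nodeSeq_injOn r m)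

/-- The law of a vector with `2n` independent normal entries of variance `1/2`. -/
abbrev gaussVec (n : ℕ) : Measure (Fin n × Fin 2 → ℝ) :=
  Measure.pi fun _ => gaussianReal 0 (1 / 2)

/-- The sum of the rank one matrices `x_i x_i^*`. -/
def wishart {n m : ℕ} (x : Fin m → Fin n × Fin 2 → ℝ) : Matrix (Fin n) (Fin n) ℂ :=
  ∑ i, Matrix.vecMulVec (complexVec (x i)) (star (complexVec (x i)))

theorem wishart_isHermitian {n m : ℕ} (x : Fin m → Fin n × Fin 2 → ℝ) :
    (wishart x).IsHermitian := by
  refine Matrix.isHermitian_iff_isSelfAdjoint.2 (isSelfAdjoint_sum _ fun i _ => ?_)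
  rw [← Matrix.isHermitian_iff_isSelfAdjoint, Matrix.IsHermitian, Matrix.conjTranspose_vecMulVec,
    star_star]

theorem continuous_complexVec {n : ℕ} : Continuous (complexVec (n := n)) := by
  refine continuous_pi fun j => ?_
  have : (fun x : Fin n × Fin 2 → ℝ => complexVec x j) =
      fun x => (x (j, 0) : ℂ) - x (j, 1) * Complex.I := by
    funext x; apply Complex.ext <;> simp [complexVec]
  rw [this]
  fun_prop

theorem continuous_wishart {n m : ℕ} : Continuous (wishart (n := n) (m := m)) := by
  unfold wishart
  refine continuous_finsetSum _ fun i _ => ?_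
  have := (continuous_complexVec (n := n)).comp (continuous_apply (A := fun _ : Fin m => Fin n × Fin 2 → ℝ) i)
  exact this.matrix_vecMulVec this.star

theorem continuous_detSeq {n : ℕ} : Continuous (detSeq (n := n)) := by
  unfold detSeq
  exact continuous_pi fun k => (continuous_const.sub continuous_id).matrix_det

theorem ae_posChamber {r m : ℕ} (c : ENNReal) :
    ∀ᵐ t ∂(c • volume.withDensity (orderedLaguerreDensity r m)), t ∈ posChamber m := by
  refine Measure.ae_smul_measure ?_ _
  rw [ae_withDensity_iff (by fun_prop)]
  exact Filter.Eventually.of_forall fun t ht => by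
    by_contra h
    exact ht (Set.indicator_of_notMem h _)

/-- Turns the inductive hypothesis, an equality of laws of characteristic polynomials, into
eigenvalues defined on the Gaussian space, as needed to perturb them. -/
theorem exists_points_of_map_detSeq {n m r : ℕ} {c : ENNReal}
    (h : (Measure.pi fun _ : Fin m => gaussVec n).map (fun x => detSeq (wishart x)) =
      (c • volume.withDensity (orderedLaguerreDensity r m)).map (nodeSeq r)) :
    ∃ T : (Fin m → Fin n × Fin 2 → ℝ) → Fin m → ℝ, Measurable T ∧
      (Measure.pi fun _ : Fin m => gaussVec n).map T =
        c • volume.withDensity (orderedLaguerreDensity r m) ∧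
      ∀ᵐ x ∂(Measure.pi fun _ : Fin m => gaussVec n),
        T x ∈ posChamber m ∧ detSeq (wishart x) = nodeSeq r (T x) := by
  obtain ⟨R, hR, hRt⟩ := exists_nodeSeq_leftInverse r m
  have hD : Measurable fun x : Fin m → Fin n × Fin 2 → ℝ => detSeq (wishart x) :=
    (continuous_detSeq.comp continuous_wishart).measurable
  have hsec := exists_section_of_map_eq hD (continuous_nodeSeq r m).measurable hR
    (by filter_upwards [ae_posChamber c] with t ht using hRt t ht.1.antitone) h
  refine ⟨fun x => R (detSeq (wishart x)), hR.comp hD, hsec.1, ?_⟩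
  have := ae_posChamber (r := r) (m := m) c
  rw [← hsec.1] at this
  filter_upwards [hsec.2, ae_of_ae_map (hR.comp hD).aemeasurable this] with x h1 h2
  exact ⟨h2, h1⟩

open Polynomial in
theorem charpoly_eq_prod_snoc {n m r : ℕ} {M : Matrix (Fin n) (Fin n) ℂ} {t : Fin m → ℝ}
    (h : detSeq M = nodeSeq (r + 1) t) :
    M.charpoly = ∏ j, (X - C ((Fin.snoc t 0 : Fin (m + 1) → ℝ) j : ℂ)) ^
      (Fin.snoc (fun _ : Fin m => 1) (r + 1) : Fin (m + 1) → ℕ) j := by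
  refine charpoly_eq_of_detSeq_eq fun k => ?_
  rw [h]
  simp [nodeSeq, eval_prod, Fin.prod_univ_castSucc, mul_comm]

open Polynomial in
theorem detSeq_eq_nodeSeq_of_charpoly {n m r : ℕ} {M : Matrix (Fin n) (Fin n) ℂ}
    {t : Fin m → ℝ} {l : Fin (m + 1) → ℝ}
    (h : M.charpoly = (∏ j, (X - C ((Fin.snoc t 0 : Fin (m + 1) → ℝ) j : ℂ)) ^
      ((Fin.snoc (fun _ : Fin m => 1) (r + 1) : Fin (m + 1) → ℕ) j - 1)) *
        ∏ j, (X - C (l j : ℂ))) : detSeq M = nodeSeq r l := by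
  funext k
  rw [detSeq, ← Matrix.eval_charpoly, h]
  simp [nodeSeq, eval_prod, Fin.prod_univ_castSucc (fun j => _ ^ _)]

theorem map_detSeq_wishart_zero (n : ℕ) :
    (Measure.pi fun _ : Fin 0 => gaussVec n).map (fun x => detSeq (wishart x)) =
      ((1 : ENNReal) • volume.withDensity (orderedLaguerreDensity n 0)).map (nodeSeq n) := by
  have h1 : (fun x : Fin 0 → Fin n × Fin 2 → ℝ => detSeq (wishart x)) =
      fun _ (k : ℕ) => ((k : ℂ) + 1) ^ n := by
    funext x k
    simp [detSeq, wishart]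
  have h2 : (nodeSeq n (m := 0)) = fun _ (k : ℕ) => ((k : ℂ) + 1) ^ n := by
    funext t k
    simp [nodeSeq]
  have h3 : orderedLaguerreDensity n 0 = 1 := by
    funext t
    have : t ∈ posChamber 0 := ⟨fun i => i.elim0, fun i => i.elim0⟩
    simp [orderedLaguerreDensity, this, vdm]
  rw [h1, h2, h3, Measure.map_const, one_smul, withDensity_one, Measure.map_const, measure_univ,
    volume_pi, Measure.pi_empty_univ]

/-- Induction on the number of rows. The nodes before a step are the m positive eigenvalues, each
simple, and 0 with multiplicity r + 1; the new row has b = 1 and lowers the multiplicity of 0 to r.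
-/
theorem exists_map_detSeq_wishart (n m r : ℕ) (hmr : m + r = n) : ∃ c : ENNReal,
    (Measure.pi fun _ : Fin m => gaussVec n).map (fun x => detSeq (wishart x)) =
      (c • volume.withDensity (orderedLaguerreDensity r m)).map (nodeSeq r) := by
  induction m generalizing r with
  | zero =>
    obtain rfl : r = n := by omega
    exact ⟨1, map_detSeq_wishart_zero r⟩
  | succ m ih =>
    obtain ⟨c, hc⟩ := ih (r + 1) (by omega)
    obtain ⟨T, hT, hTlaw, hTae⟩ := exists_points_of_map_detSeq hc
    let k : Fin (m + 1) → ℕ := Fin.snoc (fun _ : Fin m => 1) (r + 1)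
    let node : (Fin m → ℝ) → Fin (m + 1) → ℝ := fun t => Fin.snoc t 0
    have hnode : Measurable node := by
      refine measurable_pi_lambda _ fun j => ?_
      refine Fin.lastCases ?_ (fun i => ?_) j
      · simp [node]
      · simpa [node] using measurable_pi_apply i
    have hk : ∀ j, 0 < k j := fun j => by
      refine Fin.lastCases ?_ (fun i => ?_) j <;> simp [k]
    let κ : (Fin m → ℝ) → (Fin (m + 1) → ℝ) → ENNReal := fun t => interlaceDensity k 1 (node t)
    have hκ : Measurable (Function.uncurry κ) :=
      (measurable_interlaceDensity_uncurry k 1).comp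
        ((hnode.comp measurable_fst).prodMk measurable_snd)
    let D : (Fin n × Fin 2 → ℝ) × (Fin m → Fin n × Fin 2 → ℝ) → ℕ → ℂ := fun p =>
      detSeq (wishart p.2 + Matrix.vecMulVec (complexVec p.1) (star (complexVec p.1)))
    have hD : Measurable D := by
      refine (continuous_detSeq.comp ((continuous_wishart.comp continuous_snd).add ?_)).measurable
      have := (continuous_complexVec (n := n)).comp
        (continuous_fst (X := Fin n × Fin 2 → ℝ) (Y := Fin m → Fin n × Fin 2 → ℝ))
      exact this.matrix_vecMulVec this.star
    have hstep := map_prod_of_transition (γ := gaussVec n) hT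
      (measurable_orderedLaguerreDensity (r + 1) m) hTlaw hκ
      (g := fun z : (Fin m → ℝ) × (Fin (m + 1) → ℝ) => nodeSeq r z.2)
      ((continuous_nodeSeq r (m + 1)).measurable.comp measurable_snd) hD
      (C := ∏ j, (volume.withDensity (gammaDensity (k j) 1) Set.univ)⁻¹) (by
        filter_upwards [hTae] with ω hω
        obtain ⟨Z, hZ, hZlaw, hZae⟩ := exists_perturbation_points (wishart_isHermitian ω)
          (strictAnti_snoc_zero hω.1) hk (charpoly_eq_prod_snoc hω.2) one_pos
        refine ⟨Z, hZ, hZlaw, ?_⟩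
        filter_upwards [hZae] with x hx
        have h1 := hx.2.1
        rw [Complex.ofReal_one, one_smul] at h1
        exact detSeq_eq_nodeSeq_of_charpoly h1)
    have hF : Measurable fun z : (Fin m → ℝ) × (Fin (m + 1) → ℝ) =>
        orderedLaguerreDensity (r + 1) m z.1 * κ z.1 z.2 :=
      ((measurable_orderedLaguerreDensity (r + 1) m).comp measurable_fst).mul hκ
    have hcons : (Measure.pi fun _ : Fin (m + 1) => gaussVec n).map
        (fun x => detSeq (wishart x)) =
        ((gaussVec n).prod (Measure.pi fun _ : Fin m => gaussVec n)).map D := by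
      have hmp := measurePreserving_piFinSuccAbove (fun _ : Fin (m + 1) => gaussVec n) 0
      rw [← hmp.map_eq, Measure.map_map hD (MeasurableEquiv.measurable _)]
      congr 1
      funext x
      simp only [Function.comp_apply, D]
      congr 1
      rw [wishart, Fin.sum_univ_succ, add_comm]
      rfl
    refine ⟨c * (∏ j, (volume.withDensity (gammaDensity (k j) 1) Set.univ)⁻¹) *
      ENNReal.ofReal (∏ j : Fin m, ((j : ℝ) + 1)⁻¹), ?_⟩
    rw [hcons, hstep]
    change _ • Measure.map (nodeSeq r ∘ Prod.snd) _ = _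
    -- The encoding sees only the new points, so the old ones are marginalized; this is where the
    -- box integral enters.
    rw [← Measure.map_map (continuous_nodeSeq r (m + 1)).measurable measurable_snd,
      map_snd_withDensity hF]
    have : (fun l => ∫⁻ t, orderedLaguerreDensity (r + 1) m t * κ t l) =
        ENNReal.ofReal (∏ j : Fin m, ((j : ℝ) + 1)⁻¹) • orderedLaguerreDensity r (m + 1) := by
      funext l
      exact lintegral_orderedLaguerreDensity_mul_interlaceDensity r m l
    rw [this, withDensity_smul _ (by fun_prop), ← Measure.map_smul, smul_smul]

/-! ### Summation over splittings into two halves -/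

/-- The first half of a tuple. -/
def firstHalf {n : ℕ} (w : Fin (n + n) → ℝ) (j : Fin n) : ℝ := w (Fin.castAdd n j)

/-- The second half of a tuple. -/
def lastHalf {n : ℕ} (w : Fin (n + n) → ℝ) (j : Fin n) : ℝ := w (Fin.natAdd n j)

/-- The alternating sign `∏_j (-1)^{τ_j}` over the first half. -/
def halfSign {n : ℕ} (τ : Equiv.Perm (Fin (n + n))) : ℝ :=
  ∏ j : Fin n, (-1) ^ (τ (Fin.castAdd n j) : ℕ)

theorem vdm_eq_prod_ite {N : ℕ} (z : Fin N → ℝ) :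
    vdm z = ∏ j, ∏ k, if j < k then z j - z k else 1 := by
  refine Finset.prod_congr rfl fun j _ => ?_
  rw [← Finset.prod_filter]
  exact Finset.prod_congr (by ext; simp) fun _ _ => rfl

theorem vdm_eq_halves {n : ℕ} (w : Fin (n + n) → ℝ) :
    vdm w = vdm (firstHalf w) * vdm (lastHalf w) *
      ∏ i, ∏ j, (firstHalf w i - lastHalf w j) := by
  have h1 : ∀ i j : Fin n, Fin.castAdd n i < Fin.natAdd n j := fun i j =>
    Fin.lt_def.2 (by simp; omega)
  have h2 : ∀ i j : Fin n, ¬ Fin.natAdd n i < Fin.castAdd n j := fun i j => (h1 j i).asymm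
  have h3 : ∀ i j : Fin n, Fin.castAdd n i < Fin.castAdd n j ↔ i < j := fun i j =>
    Iff.rfl
  have h4 : ∀ i j : Fin n, Fin.natAdd n i < Fin.natAdd n j ↔ i < j := fun i j =>
    Fin.natAdd_lt_natAdd_iff n
  simp only [vdm_eq_prod_ite, Fin.prod_univ_add, h1, h2, h3, h4, if_true, if_false,
    Finset.prod_const_one, Finset.prod_mul_distrib, firstHalf, lastHalf]
  ring

theorem prod_erase_eq_sign_mul_vdm_sq {N : ℕ} : ∃ κ : ℝ, |κ| = 1 ∧ ∀ z : Fin N → ℝ,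
    ∏ j, ∏ k ∈ Finset.univ.erase j, (z j - z k) = κ * vdm z ^ 2 := by
  refine ⟨∏ j : Fin N, ∏ _k ∈ Finset.Ioi j, (-1), by simp [Finset.abs_prod], fun z => ?_⟩
  rw [prod_erase_eq_mul_Ioi, vdm, ← Finset.prod_pow, ← Finset.prod_mul_distrib]
  refine Finset.prod_congr rfl fun j _ => ?_
  rw [← Finset.prod_pow, ← Finset.prod_mul_distrib]
  exact Finset.prod_congr rfl fun k _ => by ring

theorem vdm_comp_perm {N : ℕ} (z : Fin N → ℝ) (τ : Equiv.Perm (Fin N)) :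
    vdm (z ∘ τ) = ((Equiv.Perm.sign τ : ℤˣ) : ℤ) * vdm z := by
  obtain ⟨ε, hε, h⟩ := exists_sign_det_vandermonde N
  have hε0 : ε ≠ 0 := by rintro rfl; simp at hε
  have h1 : Matrix.vandermonde (z ∘ τ) = (Matrix.vandermonde z).submatrix τ id := by
    ext i j; simp [Matrix.vandermonde_apply]
  have h2 := h (z ∘ τ)
  rw [h1, Matrix.det_permute, h z] at h2
  refine mul_left_cancel₀ hε0 ?_
  rw [← h2]
  ring

/-- For each point of the first half, the product of its differences with all other points has sign
(-1)^rank. Those differences split into the ones within the first half and the cross terms. -/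
theorem halfSign_mul_cross {n : ℕ} {z : Fin (n + n) → ℝ} (hz : StrictAnti z)
    (τ : Equiv.Perm (Fin (n + n))) :
    0 < halfSign τ * (∏ i, ∏ j, (firstHalf (z ∘ τ) i - lastHalf (z ∘ τ) j)) *
      ∏ i, ∏ k ∈ Finset.univ.erase i, (firstHalf (z ∘ τ) i - firstHalf (z ∘ τ) k) := by
  rw [halfSign, ← Finset.prod_mul_distrib, ← Finset.prod_mul_distrib]
  refine Finset.prod_pos fun i _ => ?_
  have h := prod_erase_sub_sign hz (τ (Fin.castAdd n i))
  have h1 : ∏ k ∈ Finset.univ.erase (τ (Fin.castAdd n i)), (z (τ (Fin.castAdd n i)) - z k) =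
      ∏ k ∈ Finset.univ.erase (Fin.castAdd n i), (z (τ (Fin.castAdd n i)) - z (τ k)) := by
    refine (Finset.prod_equiv τ (fun k => ?_) fun k _ => rfl).symm
    simp
  have h2 : ∏ k ∈ Finset.univ.erase (Fin.castAdd n i), (z (τ (Fin.castAdd n i)) - z (τ k)) =
      (∏ k ∈ Finset.univ.erase i, (firstHalf (z ∘ τ) i - firstHalf (z ∘ τ) k)) *
        ∏ j, (firstHalf (z ∘ τ) i - lastHalf (z ∘ τ) j) := by
    have h3 : ∀ {N : ℕ} (i : Fin N) (f : Fin N → ℝ),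
        ∏ k ∈ Finset.univ.erase i, f k = ∏ k, if k ≠ i then f k else 1 := by
      intro N i f
      rw [← Finset.prod_filter]
      exact Finset.prod_congr (by ext; simp) fun _ _ => rfl
    have h4 : ∀ j, Fin.natAdd n j ≠ Fin.castAdd n i := fun j h => by
      have := congrArg Fin.val h
      simp at this
      omega
    rw [h3, h3, Fin.prod_univ_add]
    simp only [h4, firstHalf, lastHalf, Function.comp_apply, ne_eq, not_false_eq_true, if_true,
      (Fin.castAdd_injective n n).eq_iff]
  rw [h1, h2] at h
  linarith

/-- The product vdm(z ∘ τ) factors into the two halves and the cross terms. Its sign is that of τ,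
and the sign of the cross terms is known up to a factor κ depending only on n, so the signed terms
share one sign for all τ. -/
theorem exists_sign_halves {n : ℕ} {z : Fin (n + n) → ℝ} (hz : StrictAnti z) :
    ∃ s : ℝ, |s| = 1 ∧ ∀ τ : Equiv.Perm (Fin (n + n)),
      ((Equiv.Perm.sign τ : ℤˣ) : ℤ) * halfSign τ *
        (vdm (firstHalf (z ∘ τ)) * vdm (lastHalf (z ∘ τ))) =
      s * |vdm (firstHalf (z ∘ τ)) * vdm (lastHalf (z ∘ τ))| := by
  obtain ⟨κ, hκ, hd⟩ := prod_erase_eq_sign_mul_vdm_sq (N := n)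
  refine ⟨κ, hκ, fun τ => ?_⟩
  have h1 := halfSign_mul_cross hz τ
  rw [hd] at h1
  have h2 := vdm_comp_perm z τ
  rw [vdm_eq_halves (z ∘ τ)] at h2
  set c := ∏ i, ∏ j, (firstHalf (z ∘ τ) i - lastHalf (z ∘ τ) j)
  set V1 := vdm (firstHalf (z ∘ τ))
  set V2 := vdm (lastHalf (z ∘ τ))
  set e := halfSign τ
  set σ : ℝ := (((Equiv.Perm.sign τ : ℤˣ) : ℤ) : ℝ) with hσ
  have hv := vdm_pos hz
  have hσ2 : σ * σ = 1 := by
    rw [hσ]; exact_mod_cast Int.units_coe_mul_self _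
  have he : e * e = 1 := by
    simp only [e, halfSign, ← Finset.prod_mul_distrib, ← mul_pow]
    simp
  have hκ2 : κ * κ = 1 := by rw [← abs_mul_abs_self, hκ, one_mul]
  have hpos : 0 < σ * e * (V1 * V2) * κ := by
    have hc : 0 < c ^ 2 * V1 ^ 2 := by
      have hc0 : c ≠ 0 := by rintro h; rw [h] at h1; simp at h1
      have hV0 : V1 ≠ 0 := by rintro h; rw [h] at h1; simp at h1
      positivity
    have h3 : σ * e * (V1 * V2) * κ * (c ^ 2 * V1 ^ 2) =
        (σ * σ) * vdm z * (e * c * (κ * V1 ^ 2)) := by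
      have : σ * (V1 * V2 * c) = σ * (σ * vdm z) := by rw [h2]
      linear_combination (e * κ * c * V1 ^ 2) * this
    have h4 : 0 < σ * e * (V1 * V2) * κ * (c ^ 2 * V1 ^ 2) := by
      rw [h3, hσ2, one_mul]
      exact mul_pos hv h1
    exact (pos_iff_pos_of_mul_pos h4).2 hc
  have habs : |V1 * V2| = σ * e * (V1 * V2) * κ := by
    rw [← abs_of_pos hpos, abs_mul _ κ, abs_mul (σ * e), hκ, mul_one]
    have : |σ * e| = 1 := by
      have : (σ * e) * (σ * e) = 1 := by linear_combination e * e * hσ2 + he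
      rcases mul_self_eq_one_iff.1 this with h | h <;> simp [h]
    rw [this, one_mul]
  rw [habs]
  linear_combination -(σ * e * (V1 * V2)) * hκ2

/-- The matrix with rows `((-1)^i z_i^j)_j, (z_i^j)_j`. -/
def signedVandermonde {n : ℕ} (z : Fin (n + n) → ℝ) : Matrix (Fin (n + n)) (Fin (n + n)) ℝ :=
  Matrix.of fun i => Fin.addCases (fun j : Fin n => (-1) ^ (i : ℕ) * z i ^ (j : ℕ))
    fun j : Fin n => z i ^ (j : ℕ)

/-- A pair of permutations of the two halves. -/
def halvesPerm {n : ℕ} (π : Equiv.Perm (Fin n) × Equiv.Perm (Fin n)) :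
    Equiv.Perm (Fin (n + n)) :=
  finSumFinEquiv.permCongr (Equiv.Perm.sumCongr π.1 π.2)

theorem halvesPerm_castAdd {n : ℕ} (π : Equiv.Perm (Fin n) × Equiv.Perm (Fin n)) (j : Fin n) :
    halvesPerm π (Fin.castAdd n j) = Fin.castAdd n (π.1 j) := by
  simp [halvesPerm, Equiv.permCongr_apply]

theorem halvesPerm_natAdd {n : ℕ} (π : Equiv.Perm (Fin n) × Equiv.Perm (Fin n)) (j : Fin n) :
    halvesPerm π (Fin.natAdd n j) = Fin.natAdd n (π.2 j) := by
  simp [halvesPerm, Equiv.permCongr_apply, -Fin.natAdd_eq_addNat]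

/-- A Laplace expansion along the two column halves, with redundancy: expanding both small
determinants gives pairs π of permutations, and for each of the n!² pairs the shift τ ↦ τ ·
`halvesPerm π` reproduces the full Leibniz sum. -/
theorem sum_sign_mul_det_halves {n : ℕ} (z : Fin (n + n) → ℝ) :
    ∑ τ : Equiv.Perm (Fin (n + n)), ((Equiv.Perm.sign τ : ℤˣ) : ℤ) * halfSign τ *
      ((Matrix.vandermonde (firstHalf (z ∘ τ))).det *
        (Matrix.vandermonde (lastHalf (z ∘ τ))).det) =
      (n.factorial : ℝ) ^ 2 * (signedVandermonde z).det := by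
  let L : Equiv.Perm (Fin (n + n)) → ℝ := fun τ =>
    ((Equiv.Perm.sign τ : ℤˣ) : ℤ) * ∏ i, signedVandermonde z (τ i) i
  have hdet : (signedVandermonde z).det = ∑ τ, L τ := by
    rw [Matrix.det_apply']
  have hL : ∀ τ π, L (τ * halvesPerm π) = ((Equiv.Perm.sign τ : ℤˣ) : ℤ) * halfSign τ *
      ((((Equiv.Perm.sign π.1 : ℤˣ) : ℤ) * ∏ j, firstHalf (z ∘ τ) (π.1 j) ^ (j : ℕ)) *
        (((Equiv.Perm.sign π.2 : ℤˣ) : ℤ) * ∏ j, lastHalf (z ∘ τ) (π.2 j) ^ (j : ℕ))) := by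
    intro τ π
    have hs : Equiv.Perm.sign (halvesPerm π) = Equiv.Perm.sign π.1 * Equiv.Perm.sign π.2 := by
      rw [halvesPerm, Equiv.Perm.sign_permCongr, Equiv.Perm.sign_sumCongr]
    have he : ∏ j : Fin n, (-1 : ℝ) ^ (τ (Fin.castAdd n (π.1 j)) : ℕ) = halfSign τ :=
      Equiv.prod_comp π.1 fun j => (-1 : ℝ) ^ (τ (Fin.castAdd n j) : ℕ)
    simp only [L, Fin.prod_univ_add, Equiv.Perm.mul_apply, halvesPerm_castAdd,
      halvesPerm_natAdd, signedVandermonde, Matrix.of_apply, Fin.addCases_left,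
      Fin.addCases_right, Finset.prod_mul_distrib, he, Equiv.Perm.sign_mul, hs, Units.val_mul,
      Int.cast_mul, firstHalf, lastHalf, Function.comp_apply]
    ring
  have hdet2 : ∀ v : Fin n → ℝ, (Matrix.vandermonde v).det =
      ∑ σ : Equiv.Perm (Fin n), ((Equiv.Perm.sign σ : ℤˣ) : ℤ) * ∏ j, v (σ j) ^ (j : ℕ) := by
    intro v
    rw [Matrix.det_apply']
    rfl
  have h1 : ∀ τ : Equiv.Perm (Fin (n + n)), ((Equiv.Perm.sign τ : ℤˣ) : ℤ) * halfSign τ *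
      ((Matrix.vandermonde (firstHalf (z ∘ τ))).det *
        (Matrix.vandermonde (lastHalf (z ∘ τ))).det) = ∑ π, L (τ * halvesPerm π) := by
    intro τ
    simp_rw [hL]
    rw [hdet2, hdet2, Finset.sum_mul_sum, ← Finset.mul_sum, Fintype.sum_prod_type]
  simp_rw [h1]
  rw [Finset.sum_comm]
  have h2 : ∀ π : Equiv.Perm (Fin n) × Equiv.Perm (Fin n),
      ∑ τ, L (τ * halvesPerm π) = ∑ τ, L τ := fun π =>
    Equiv.sum_comp (Equiv.mulRight (halvesPerm π)) L
  simp_rw [h2]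
  rw [hdet, Finset.sum_const, Finset.card_univ, Fintype.card_prod, Fintype.card_perm, Fintype.card_fin,
    nsmul_eq_mul]
  push_cast
  ring

/-- The labels of `n + n` points: `inl j` is the `j`-th odd label, `inr j` the `j`-th even one. -/
def alternatingEquiv (n : ℕ) : Fin n ⊕ Fin n ≃ Fin (n + n) where
  toFun := Sum.elim (fun j => ⟨2 * j, by omega⟩) fun j => ⟨2 * j + 1, by omega⟩
  invFun i := if (i : ℕ) % 2 = 0 then Sum.inl ⟨i / 2, by omega⟩ else Sum.inr ⟨i / 2, by omega⟩
  left_inv := by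
    rintro (j | j)
    · simp
    · have : (2 * (j : ℕ) + 1) / 2 = j := by omega
      simp [Nat.add_mod, this]
  right_inv i := by
    by_cases h : (i : ℕ) % 2 = 0
    · simp only [h, if_true, Sum.elim_inl, Fin.ext_iff]; omega
    · simp only [h, if_false, Sum.elim_inr, Fin.ext_iff]; omega

/-- Sorting the rows by parity gives blocks (Vo, Vo; -Ve, Ve). Subtracting the first block column
from the second makes this triangular with diagonal blocks Vo and 2 Ve, whence the factor 2^n. -/
theorem abs_det_signedVandermonde {n : ℕ} (z : Fin (n + n) → ℝ) :
    |(signedVandermonde z).det| = 2 ^ n *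
      (|vdm fun j : Fin n => z (alternatingEquiv n (Sum.inl j))| *
        |vdm fun j : Fin n => z (alternatingEquiv n (Sum.inr j))|) := by
  set Vo := Matrix.vandermonde fun j : Fin n => z (alternatingEquiv n (Sum.inl j))
  set Ve := Matrix.vandermonde fun j : Fin n => z (alternatingEquiv n (Sum.inr j))
  have h1 : (signedVandermonde z).submatrix (alternatingEquiv n) finSumFinEquiv =
      Matrix.fromBlocks Vo Vo (-Ve) Ve := by
    ext i j
    rcases i with i | i <;> rcases j with j | j <;>
      simp [signedVandermonde, Vo, Ve, Matrix.vandermonde_apply, alternatingEquiv, pow_succ,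
        -Fin.natAdd_eq_addNat]
  have h2 : Matrix.fromBlocks Vo Vo (-Ve) Ve * Matrix.fromBlocks 1 (-1) 0 1 =
      Matrix.fromBlocks Vo 0 (-Ve) ((2 : ℝ) • Ve) := by
    rw [Matrix.fromBlocks_multiply]
    simp [two_smul]
  have h3 := congrArg Matrix.det h2
  rw [Matrix.det_mul, Matrix.det_fromBlocks_zero₂₁, Matrix.det_fromBlocks_zero₁₂,
    Matrix.det_one, Matrix.det_smul] at h3
  rw [← Matrix.abs_det_submatrix_equiv_equiv (alternatingEquiv n) finSumFinEquiv, h1]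
  simp only [mul_one] at h3
  rw [h3, abs_mul, abs_mul, abs_det_vandermonde, abs_det_vandermonde]
  simp
  ring

/-- Since the signed terms do not cancel, the sum of absolute values is the absolute value of the
determinant sum. -/
theorem sum_abs_vdm_halves {n : ℕ} {z : Fin (n + n) → ℝ} (hz : StrictAnti z) :
    ∑ τ : Equiv.Perm (Fin (n + n)),
      |vdm (firstHalf (z ∘ τ))| * |vdm (lastHalf (z ∘ τ))| =
    (n.factorial : ℝ) ^ 2 * (2 ^ n *
      (|vdm fun j : Fin n => z (alternatingEquiv n (Sum.inl j))| *
        |vdm fun j : Fin n => z (alternatingEquiv n (Sum.inr j))|)) := by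
  obtain ⟨s, hs, h⟩ := exists_sign_halves hz
  obtain ⟨ε, hε, hV⟩ := exists_sign_det_vandermonde n
  have h1 := congrArg abs (sum_sign_mul_det_halves z)
  have h2 : ∀ τ : Equiv.Perm (Fin (n + n)), ((Equiv.Perm.sign τ : ℤˣ) : ℤ) * halfSign τ *
      ((Matrix.vandermonde (firstHalf (z ∘ τ))).det *
        (Matrix.vandermonde (lastHalf (z ∘ τ))).det) =
      ε ^ 2 * s * (|vdm (firstHalf (z ∘ τ))| * |vdm (lastHalf (z ∘ τ))|) := by
    intro τ
    rw [hV, hV, ← abs_mul, mul_assoc (ε ^ 2), ← h τ]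
    ring
  simp_rw [h2] at h1
  rw [← Finset.mul_sum, abs_mul, abs_mul, abs_pow, hε, hs, abs_of_nonneg (Finset.sum_nonneg
    fun τ _ => mul_nonneg (abs_nonneg _) (abs_nonneg _)), abs_mul, abs_det_signedVandermonde] at h1
  simpa using h1

/-! ### Laws of sorted samples -/

theorem sortDesc_antitone {N : ℕ} (z : Fin N → ℝ) : Antitone (sortDesc z) := fun _ _ hij =>
  Tuple.monotone_sort z (Fin.rev_le_rev.2 hij)

theorem map_univ_comp_perm {N : ℕ} (z : Fin N → ℝ) (σ : Equiv.Perm (Fin N)) :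
    Multiset.map (z ∘ σ) Finset.univ.val = Multiset.map z Finset.univ.val := by
  rw [← Multiset.map_map]
  congr 1
  simp

theorem sortDesc_eq_comp {N : ℕ} (z : Fin N → ℝ) :
    sortDesc z = z ∘ (Fin.revPerm.trans (Tuple.sort z)) := rfl

theorem sortDesc_eq_of_antitone {N : ℕ} {z : Fin N → ℝ} {σ : Equiv.Perm (Fin N)}
    (h : Antitone (z ∘ σ)) : sortDesc z = z ∘ σ := by
  refine antitone_eq_of_map_eq (sortDesc_antitone z) h ?_
  rw [sortDesc_eq_comp, map_univ_comp_perm, map_univ_comp_perm]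

/-- The polynomial with given roots ignores their order, so sorting is the encoding followed by its
Borel left inverse. -/
theorem measurable_sortDesc (N : ℕ) : Measurable (sortDesc (N := N)) := by
  obtain ⟨R, hR, hRt⟩ := exists_nodeSeq_leftInverse 0 N
  have h : sortDesc (N := N) = fun z => R (nodeSeq 0 z) := by
    funext z
    rw [← hRt _ (sortDesc_antitone z)]
    congr 1
    funext k
    rw [sortDesc_eq_comp]
    simp only [nodeSeq, Function.comp_apply]
    congr 1
    exact Equiv.prod_comp (Fin.revPerm.trans (Tuple.sort z)) fun j => ((k : ℂ) + 1 - z j)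
  rw [h]
  exact hR.comp (continuous_nodeSeq 0 N).measurable

theorem ae_apply_ne_apply {N : ℕ} {i j : Fin N} (hij : i ≠ j) :
    ∀ᵐ z : Fin N → ℝ, z i ≠ z j := by
  let L : (Fin N → ℝ) →ₗ[ℝ] ℝ := LinearMap.proj (R := ℝ) (φ := fun _ : Fin N => ℝ) i - LinearMap.proj j
  have h := Measure.addHaar_submodule (volume : Measure (Fin N → ℝ)) (LinearMap.ker L) (by
    intro htop
    have : Pi.single i (1 : ℝ) ∈ LinearMap.ker L := by rw [htop]; trivial
    simp [L, hij.symm] at this)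
  refine measure_mono_null (fun z hz => ?_) h
  simp only [Set.mem_compl_iff, Set.mem_ofPred_eq, not_not] at hz
  simp [L, hz]

theorem ae_injective (N : ℕ) : ∀ᵐ z : Fin N → ℝ, Function.Injective z := by
  have h : ∀ᵐ z : Fin N → ℝ, ∀ i j : Fin N, i ≠ j → z i ≠ z j := by
    rw [ae_all_iff]; intro i
    rw [ae_all_iff]; intro j
    by_cases hij : i = j
    · simp [hij]
    · filter_upwards [ae_apply_ne_apply hij] with z hz _ using hz
  filter_upwards [h] with z hz i j hij
  by_contra hne
  exact hz i j hne hij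

theorem ae_apply_ne_zero (N : ℕ) : ∀ᵐ z : Fin N → ℝ, ∀ i, z i ≠ 0 := by
  rw [ae_all_iff]; intro i
  let L : (Fin N → ℝ) →ₗ[ℝ] ℝ := LinearMap.proj (R := ℝ) (φ := fun _ : Fin N => ℝ) i
  have h := Measure.addHaar_submodule (volume : Measure (Fin N → ℝ)) (LinearMap.ker L) (by
    intro htop
    have : Pi.single i (1 : ℝ) ∈ LinearMap.ker L := by rw [htop]; trivial
    simp [L] at this)
  refine measure_mono_null (fun z hz => ?_) h
  simp only [Set.mem_compl_iff, Set.mem_ofPred_eq, not_not] at hz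
  simp [L, hz]

/-- Exactly one permutation sorts a tuple of distinct numbers. -/
theorem sum_perm_indicator_strictAnti {N : ℕ} {z : Fin N → ℝ} (hz : Function.Injective z)
    (φ : (Fin N → ℝ) → ENNReal) :
    ∑ σ : Equiv.Perm (Fin N), {y : Fin N → ℝ | StrictAnti y}.indicator φ (z ∘ σ) =
      φ (sortDesc z) := by
  have h0 : StrictAnti (z ∘ (Fin.revPerm.trans (Tuple.sort z))) :=
    (sortDesc_antitone z).strictAnti_of_injective (hz.comp (Fin.revPerm.trans (Tuple.sort z)).injective)
  rw [Finset.sum_eq_single (Fin.revPerm.trans (Tuple.sort z)), Set.indicator_of_mem h0,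
    sortDesc_eq_comp]
  · intro σ _ hσ
    refine Set.indicator_of_notMem (fun h => hσ ?_) _
    have h : StrictAnti (z ∘ σ) := h
    have := (sortDesc_eq_of_antitone h.antitone).symm.trans (sortDesc_eq_comp z)
    exact Equiv.ext fun i => hz (congrFun this i)
  · simp

theorem measurePreserving_comp_perm {N : ℕ} (σ : Equiv.Perm (Fin N)) :
    MeasurePreserving (fun z : Fin N → ℝ => z ∘ σ) volume volume := by
  refine ⟨by fun_prop, (Measure.pi_eq fun s hs => ?_).symm⟩
  rw [Measure.map_apply (by fun_prop) (MeasurableSet.univ_pi hs)]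
  have : (fun z : Fin N → ℝ => z ∘ σ) ⁻¹' Set.univ.pi s = Set.univ.pi fun i => s (σ.symm i) := by
    ext z
    simp only [Set.mem_preimage, Set.mem_univ_pi, Function.comp_apply]
    exact ⟨fun h i => by simpa using h (σ.symm i), fun h i => by simpa using h (σ i)⟩
  rw [this, volume_pi_pi]
  exact Equiv.prod_comp σ.symm fun i => volume (s i)

/-- Almost every tuple is sorted by exactly one permutation. Summing over all permutations and
moving each one onto the density by invariance of Lebesgue measure symmetrizes f. -/
theorem map_sortDesc_withDensity {N : ℕ} {f : (Fin N → ℝ) → ENNReal} (hf : Measurable f) :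
    (volume.withDensity f).map sortDesc = volume.withDensity
      ({z : Fin N → ℝ | StrictAnti z}.indicator fun z =>
        ∑ σ : Equiv.Perm (Fin N), f (z ∘ σ)) := by
  have hS := measurableSet_strictAnti N
  have hsum : Measurable fun z => ∑ σ : Equiv.Perm (Fin N), f (z ∘ σ) :=
    Finset.measurable_sum _ fun σ _ => hf.comp (measurePreserving_comp_perm σ).measurable
  refine Measure.ext_of_lintegral _ fun φ hφ => ?_
  have hφs := hφ.comp (measurable_sortDesc N)
  rw [lintegral_map hφ (measurable_sortDesc N), lintegral_withDensity_eq_lintegral_mul _ hf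
    (g := fun z => φ (sortDesc z)) hφs,
    lintegral_withDensity_eq_lintegral_mul _ (hsum.indicator hS) hφ]
  have hind : Measurable ({y : Fin N → ℝ | StrictAnti y}.indicator φ) := hφ.indicator hS
  have h1 : ∫⁻ z, (f * fun z => φ (sortDesc z)) z = ∫⁻ z, ∑ σ : Equiv.Perm (Fin N),
      f z * {y : Fin N → ℝ | StrictAnti y}.indicator φ (z ∘ σ) := by
    refine lintegral_congr_ae ?_
    filter_upwards [ae_injective N] with z hz
    rw [← Finset.mul_sum, sum_perm_indicator_strictAnti hz]
    rfl
  have h2 : ∀ σ : Equiv.Perm (Fin N),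
      ∫⁻ z, f z * {y : Fin N → ℝ | StrictAnti y}.indicator φ (z ∘ σ) =
      ∫⁻ z, f (z ∘ σ.symm) * {y : Fin N → ℝ | StrictAnti y}.indicator φ z := by
    intro σ
    rw [← (measurePreserving_comp_perm σ).lintegral_comp
      (f := fun z => f (z ∘ σ.symm) * {y : Fin N → ℝ | StrictAnti y}.indicator φ z)]
    · refine lintegral_congr fun z => ?_
      congr 2
      funext i
      simp
    · exact (hf.comp (measurePreserving_comp_perm σ.symm).measurable).mul hind
  rw [h1, lintegral_finsetSum]
  · simp_rw [h2]
    rw [← lintegral_finsetSum]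
    · refine lintegral_congr fun z => ?_
      have hinv : ∑ σ : Equiv.Perm (Fin N), f (z ∘ σ.symm) =
          ∑ σ : Equiv.Perm (Fin N), f (z ∘ σ) :=
        Equiv.sum_comp (Equiv.inv (Equiv.Perm (Fin N))) fun σ => f (z ∘ σ)
      rw [← Finset.sum_mul, Pi.mul_apply, hinv]
      by_cases hz : StrictAnti z
      · have hz' : z ∈ {z : Fin N → ℝ | StrictAnti z} := hz
        rw [Set.indicator_of_mem hz', Set.indicator_of_mem hz']
      · have hz' : z ∉ {z : Fin N → ℝ | StrictAnti z} := hz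
        rw [Set.indicator_of_notMem hz', Set.indicator_of_notMem hz', mul_zero, zero_mul]
    · intro σ _
      exact (hf.comp (measurePreserving_comp_perm σ.symm).measurable).mul hind
  · intro σ _
    exact hf.mul (hind.comp (measurePreserving_comp_perm σ).measurable)

/-! ### Joining two tuples -/

/-- Reading two tuples as one along an equivalence of index types. -/
def pairEquiv {α β δ : Type*} (e : α ⊕ β ≃ δ) : (α → ℝ) × (β → ℝ) ≃ᵐ (δ → ℝ) where
  toFun p i := Sum.elim p.1 p.2 (e.symm i)
  invFun z := (fun a => z (e (Sum.inl a)), fun b => z (e (Sum.inr b)))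
  left_inv p := by simp
  right_inv z := by
    funext i
    obtain ⟨s, rfl⟩ := e.surjective i
    rcases s with a | b <;> simp
  measurable_toFun := by
    refine measurable_pi_lambda _ fun i => ?_
    change Measurable fun p : (α → ℝ) × (β → ℝ) => Sum.elim p.1 p.2 (e.symm i)
    rcases e.symm i with a | b
    · exact (measurable_pi_apply a).comp measurable_fst
    · exact (measurable_pi_apply b).comp measurable_snd
  measurable_invFun := by
    change Measurable fun z : δ → ℝ => (fun a => z (e (Sum.inl a)), fun b => z (e (Sum.inr b)))
    fun_prop

theorem pairEquiv_inl {α β δ : Type*} (e : α ⊕ β ≃ δ) (p : (α → ℝ) × (β → ℝ)) (a : α) :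
    pairEquiv e p (e (Sum.inl a)) = p.1 a := by simp [pairEquiv]

theorem pairEquiv_inr {α β δ : Type*} (e : α ⊕ β ≃ δ) (p : (α → ℝ) × (β → ℝ)) (b : β) :
    pairEquiv e p (e (Sum.inr b)) = p.2 b := by simp [pairEquiv]

theorem measurePreserving_pairEquiv {α β δ : Type*} [Fintype α] [Fintype β] [Fintype δ]
    (e : α ⊕ β ≃ δ) : MeasurePreserving (pairEquiv e)
      ((volume : Measure (α → ℝ)).prod (volume : Measure (β → ℝ))) volume := by
  refine ⟨MeasurableEquiv.measurable _, (Measure.pi_eq fun s hs => ?_).symm⟩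
  rw [Measure.map_apply (MeasurableEquiv.measurable _) (MeasurableSet.univ_pi hs)]
  have : pairEquiv e ⁻¹' Set.univ.pi s =
      (Set.univ.pi fun a => s (e (Sum.inl a))) ×ˢ Set.univ.pi fun b => s (e (Sum.inr b)) := by
    ext p
    simp only [Set.mem_preimage, Set.mem_univ_pi, Set.mem_prod]
    constructor
    · intro h
      exact ⟨fun a => by simpa [pairEquiv_inl] using h (e (Sum.inl a)),
        fun b => by simpa [pairEquiv_inr] using h (e (Sum.inr b))⟩
    · rintro ⟨h1, h2⟩ i
      obtain ⟨q, rfl⟩ := e.surjective i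
      rcases q with a | b
      · rw [pairEquiv_inl]; exact h1 a
      · rw [pairEquiv_inr]; exact h2 b
  rw [this, Measure.prod_prod, volume_pi_pi, volume_pi_pi, ← e.prod_comp, Fintype.prod_sum_type]

theorem map_pairEquiv_withDensity {α β δ : Type*} [Fintype α] [Fintype β] [Fintype δ]
    (e : α ⊕ β ≃ δ) {F : (δ → ℝ) → ENNReal} (hF : Measurable F) :
    (((volume : Measure (α → ℝ)).prod (volume : Measure (β → ℝ))).withDensity
      fun p => F (pairEquiv e p)).map (pairEquiv e) = volume.withDensity F := by
  have hm : Measurable (pairEquiv e) := MeasurableEquiv.measurable _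
  refine Measure.ext_of_lintegral _ fun φ hφ => ?_
  rw [lintegral_map hφ hm, lintegral_withDensity_eq_lintegral_mul _
    (f := fun p => F (pairEquiv e p)) (hF.comp hm)
    (g := fun p => φ (pairEquiv e p)) (hφ.comp hm), lintegral_withDensity_eq_lintegral_mul _ hF hφ,
    ← (measurePreserving_pairEquiv e).lintegral_comp (hF.mul hφ)]
  rfl

/-! ### Normalization and identification with the Laguerre ensembles -/

theorem normalizedMeasure_eq_inv_smul {N : ℕ} {f : (Fin N → ℝ) → ℝ} (hf : Measurable f)
    (h0 : ∀ z, 0 ≤ f z) (hpos : ∫⁻ z, ENNReal.ofReal (f z) ≠ 0)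
    (htop : ∫⁻ z, ENNReal.ofReal (f z) ≠ ⊤) :
    Integrable f ∧ 0 < (∫ z, f z) ∧ normalizedMeasure f =
      (∫⁻ z, ENNReal.ofReal (f z))⁻¹ • volume.withDensity fun z => ENNReal.ofReal (f z) := by
  have hint : Integrable f := by
    refine ⟨hf.aestronglyMeasurable, ?_⟩
    rw [hasFiniteIntegral_iff_ofReal (Filter.Eventually.of_forall h0)]
    exact htop.lt_top
  have heq := ofReal_integral_eq_lintegral_ofReal hint (Filter.Eventually.of_forall h0)
  have hI : 0 < ∫ z, f z := by
    by_contra hneg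
    rw [← heq, Ne, ENNReal.ofReal_eq_zero] at hpos
    exact hpos (not_lt.1 hneg)
  refine ⟨hint, hI, ?_⟩
  rw [normalizedMeasure, ← withDensity_smul _ (by fun_prop), ← heq]
  congr 1
  funext z
  rw [Pi.smul_apply, smul_eq_mul, ← ENNReal.ofReal_inv_of_pos hI,
    ← ENNReal.ofReal_mul (inv_nonneg.2 hI.le), div_eq_inv_mul]

theorem lintegral_ne_of_smul {α : Type*} [MeasurableSpace α] {μ ν : Measure α}
    [IsProbabilityMeasure μ] {c : ENNReal} (h : μ = c • ν) :
    ν Set.univ ≠ 0 ∧ ν Set.univ ≠ ⊤ := by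
  have h1 : c * ν Set.univ = 1 := by
    rw [← smul_eq_mul, ← Measure.smul_apply, ← h, measure_univ]
  constructor
  · intro h0; rw [h0, mul_zero] at h1; exact zero_ne_one h1
  · intro h0
    rw [h0] at h1
    by_cases hc : c = 0
    · rw [hc, zero_mul] at h1; exact zero_ne_one h1
    · rw [ENNReal.mul_top hc] at h1; exact ENNReal.top_ne_one h1

theorem eq_normalizedMeasure_of_eq_smul {N : ℕ} {f : (Fin N → ℝ) → ℝ} (hf : Measurable f)
    (h0 : ∀ z, 0 ≤ f z) {μ : Measure (Fin N → ℝ)} [IsProbabilityMeasure μ] {c : ENNReal}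
    (h : μ = c • volume.withDensity fun z => ENNReal.ofReal (f z)) :
    Integrable f ∧ 0 < (∫ z, f z) ∧ μ = normalizedMeasure f := by
  have hne := lintegral_ne_of_smul h
  rw [withDensity_apply _ MeasurableSet.univ, Measure.restrict_univ] at hne
  obtain ⟨h1, h2, h3⟩ := normalizedMeasure_eq_inv_smul hf h0 hne.1 hne.2
  refine ⟨h1, h2, ?_⟩
  rw [h3, eq_inv_smul_of_eq_smul h, withDensity_apply _ MeasurableSet.univ,
    Measure.restrict_univ]

theorem ensembleDensity_eq (β : ℕ) (g : ℝ → ℝ) (N : ℕ) (z : Fin N → ℝ) :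
    ensembleDensity β g N z = (∏ l, g (z l)) * |vdm z| ^ β := by
  simp only [ensembleDensity, vdm, Finset.abs_prod, ← Finset.prod_pow, abs_sub_comm]

@[fun_prop]
theorem measurable_laguerreWeight (c : ℝ) : Measurable (laguerreWeight c) :=
  Measurable.ite measurableSet_Ici (by fun_prop) measurable_const

theorem laguerreWeight_nonneg (c t : ℝ) : 0 ≤ laguerreWeight c t := by
  unfold laguerreWeight
  split_ifs <;> positivity

theorem measurable_ensembleDensity {β : ℕ} {g : ℝ → ℝ} (hg : Measurable g) (N : ℕ) :
    Measurable (ensembleDensity β g N) := by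
  unfold ensembleDensity
  fun_prop

theorem ensembleDensity_nonneg {β : ℕ} {g : ℝ → ℝ} (hg : ∀ t, 0 ≤ g t) {N : ℕ}
    (z : Fin N → ℝ) : 0 ≤ ensembleDensity β g N z :=
  mul_nonneg (Finset.prod_nonneg fun _ _ => hg _)
    (Finset.prod_nonneg fun _ _ => Finset.prod_nonneg fun _ _ => by positivity)

theorem ensembleDensity_comp_perm (β : ℕ) (g : ℝ → ℝ) {N : ℕ} (z : Fin N → ℝ)
    (σ : Equiv.Perm (Fin N)) : ensembleDensity β g N (z ∘ σ) = ensembleDensity β g N z := by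
  have h : |vdm (z ∘ σ)| = |vdm z| := by
    rw [vdm_comp_perm, abs_mul]
    rcases Int.units_eq_one_or (Equiv.Perm.sign σ) with h | h <;> simp [h]
  rw [ensembleDensity_eq, ensembleDensity_eq, h]
  congr 1
  exact Equiv.prod_comp σ fun i => g (z i)

theorem isProbabilityMeasure_inv_smul {α : Type*} [MeasurableSpace α] {ν : Measure α}
    (h0 : ν Set.univ ≠ 0) (htop : ν Set.univ ≠ ⊤) :
    IsProbabilityMeasure ((ν Set.univ)⁻¹ • ν) :=
  ⟨by rw [Measure.smul_apply, smul_eq_mul, ENNReal.inv_mul_cancel h0 htop]⟩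

theorem eq_of_eq_smul {α : Type*} [MeasurableSpace α] {μ μ' ν : Measure α}
    [IsProbabilityMeasure μ] [IsProbabilityMeasure μ'] {c c' : ENNReal} (h : μ = c • ν)
    (h' : μ' = c' • ν) : μ = μ' := by
  rw [eq_inv_smul_of_eq_smul h, eq_inv_smul_of_eq_smul h']

theorem ofReal_ensembleDensity_ae_eq (n : ℕ) :
    ({z : Fin n → ℝ | StrictAnti z}.indicator fun z => ∑ σ : Equiv.Perm (Fin n),
      ENNReal.ofReal (ensembleDensity 2 (laguerreWeight 1) n (z ∘ σ))) =ᵐ[volume]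
    (n.factorial : ENNReal) • orderedLaguerreDensity 0 n := by
  filter_upwards [ae_apply_ne_zero n] with z hz
  by_cases hs : StrictAnti z
  · rw [Set.indicator_of_mem (show z ∈ {z : Fin n → ℝ | StrictAnti z} from hs)]
    simp only [ensembleDensity_comp_perm, Finset.sum_const, Finset.card_univ, Fintype.card_perm,
      Fintype.card_fin, nsmul_eq_mul, Pi.smul_apply, smul_eq_mul]
    congr 1
    -- The ensemble weight includes the boundary point 0 and the chamber excludes it; almost
    -- everywhere no coordinate vanishes.
    by_cases hp : ∀ j, 0 < z j
    · rw [orderedLaguerreDensity, Set.indicator_of_mem (show z ∈ posChamber n from ⟨hs, hp⟩),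
        ensembleDensity_eq, sq_abs]
      simp [laguerreWeight, (hp _).le]
    · rw [orderedLaguerreDensity, Set.indicator_of_notMem (fun h => hp h.2), ensembleDensity_eq]
      push Not at hp
      obtain ⟨j, hj⟩ := hp
      rw [Finset.prod_eq_zero (Finset.mem_univ j), zero_mul, ENNReal.ofReal_zero]
      exact if_neg (not_le.2 (lt_of_le_of_ne hj (hz j)))
  · rw [Set.indicator_of_notMem (show z ∉ {z : Fin n → ℝ | StrictAnti z} from hs),
      Pi.smul_apply, orderedLaguerreDensity, Set.indicator_of_notMem (fun h => hs h.1), smul_zero]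

/-- No Selberg integral is evaluated: that the normalizing integral is finite and nonzero follows
from the existence of a probability measure proportional to the same density. -/
theorem eq_orderedLaguerreUnitary {n : ℕ} {μ : Measure (Fin n → ℝ)} [IsProbabilityMeasure μ]
    {c : ENNReal} (h : μ = c • volume.withDensity (orderedLaguerreDensity 0 n)) :
    μ = orderedLaguerreUnitary n := by
  have hm : Measurable (ensembleDensity 2 (laguerreWeight 1) n) :=
    measurable_ensembleDensity (by fun_prop) n
  have hsort := map_sortDesc_withDensity (f := fun z =>
    ENNReal.ofReal (ensembleDensity 2 (laguerreWeight 1) n z)) hm.ennreal_ofReal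
  rw [withDensity_congr_ae (ofReal_ensembleDensity_ae_eq n),
    withDensity_smul _ (by fun_prop)] at hsort
  obtain ⟨h0, htop⟩ := lintegral_ne_of_smul h
  have hI := congrArg (fun m => m Set.univ) hsort
  simp only [Measure.map_apply (measurable_sortDesc n) MeasurableSet.univ, Set.preimage_univ,
    Measure.smul_apply, smul_eq_mul] at hI
  have hf0 : (n.factorial : ENNReal) ≠ 0 := by exact_mod_cast n.factorial_ne_zero
  have hI0 := mul_ne_zero hf0 h0
  have hItop := ENNReal.mul_ne_top (ENNReal.natCast_ne_top n.factorial) htop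
  rw [← hI] at hI0 hItop
  have hp := isProbabilityMeasure_inv_smul hI0 hItop
  rw [withDensity_apply _ MeasurableSet.univ, Measure.restrict_univ] at hI0 hItop hp
  obtain ⟨-, -, hN⟩ := normalizedMeasure_eq_inv_smul hm
    (ensembleDensity_nonneg (laguerreWeight_nonneg 1)) hI0 hItop
  rw [← hN] at hp
  have : IsProbabilityMeasure (orderedLaguerreUnitary n) :=
    Measure.isProbabilityMeasure_map (μ := normalizedMeasure _) (measurable_sortDesc n).aemeasurable
  refine eq_of_eq_smul h (c' := (∫⁻ z, ENNReal.ofReal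
    (ensembleDensity 2 (laguerreWeight 1) n z))⁻¹ * (n.factorial : ENNReal)) ?_
  rw [orderedLaguerreUnitary, laguerreUnitary, hN, Measure.map_smul, hsort, smul_smul]

theorem interpolatingDensity_of_mem {n : ℕ} {A : ℝ} {z : Fin (2 * n) → ℝ} (hz : StrictAnti z)
    (h0 : ∀ i, 0 ≤ z i) : interpolatingDensity n A z = (∏ i, Real.exp (-z i / 2)) *
      (∏ j : Fin n, Real.exp (A * (oddLabelled z j - evenLabelled z j) / 2)) *
      (vdm (oddLabelled z) * vdm (evenLabelled z)) := by
  rw [interpolatingDensity, if_pos ⟨hz, h0⟩]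
  simp only [vdm, ← Finset.prod_mul_distrib]

theorem strictAnti_oddLabelled {n : ℕ} {z : Fin (2 * n) → ℝ} (hz : StrictAnti z) :
    StrictAnti (oddLabelled z) := fun i j hij => hz (by
  have : (i : ℕ) < j := hij
  exact Fin.lt_def.2 (by simp; omega))

theorem strictAnti_evenLabelled {n : ℕ} {z : Fin (2 * n) → ℝ} (hz : StrictAnti z) :
    StrictAnti (evenLabelled z) := fun i j hij => hz (by
  have : (i : ℕ) < j := hij
  exact Fin.lt_def.2 (by simp; omega))

theorem interpolatingDensity_nonneg (n : ℕ) (A : ℝ) (z : Fin (2 * n) → ℝ) :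
    0 ≤ interpolatingDensity n A z := by
  by_cases h : StrictAnti z ∧ ∀ i, 0 ≤ z i
  · rw [interpolatingDensity_of_mem h.1 h.2]
    have h1 := vdm_pos (strictAnti_oddLabelled h.1)
    have h2 := vdm_pos (strictAnti_evenLabelled h.1)
    positivity
  · rw [interpolatingDensity, if_neg h]

@[fun_prop]
theorem measurable_oddLabelled (n : ℕ) : Measurable (oddLabelled (n := n)) := by
  unfold oddLabelled
  fun_prop

@[fun_prop]
theorem measurable_evenLabelled (n : ℕ) : Measurable (evenLabelled (n := n)) := by
  unfold evenLabelled
  fun_prop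

theorem measurable_interpolatingDensity (n : ℕ) (A : ℝ) :
    Measurable (interpolatingDensity n A) := by
  unfold interpolatingDensity
  refine Measurable.ite ?_ ?_ measurable_const
  · refine (measurableSet_strictAnti _).inter ?_
    change MeasurableSet {z : Fin (2 * n) → ℝ | ∀ i, 0 ≤ z i}
    simp only [Set.ofPred_forall]
    exact MeasurableSet.iInter fun i => measurableSet_le measurable_const (measurable_pi_apply i)
  · unfold oddLabelled evenLabelled
    fun_prop

/-- Concatenation of two index sets. -/
def concatEquiv (n : ℕ) : Fin n ⊕ Fin n ≃ Fin (2 * n) :=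
  finSumFinEquiv.trans (finCongr (two_mul n).symm)

theorem pairEquiv_concatEquiv {n : ℕ} (p : (Fin n → ℝ) × (Fin n → ℝ)) :
    pairEquiv (concatEquiv n) p = fun i => Fin.append p.1 p.2 (Fin.cast (two_mul n) i) := by
  funext i
  obtain ⟨s, rfl⟩ := (concatEquiv n).surjective i
  rcases s with j | j
  · rw [pairEquiv_inl]; simp [concatEquiv]
  · rw [pairEquiv_inr]; simp [concatEquiv, -Fin.natAdd_eq_addNat]

/-- The joint density of two independent samples of the orthogonal ensemble. -/
def concatDensity (n : ℕ) (z : Fin (2 * n) → ℝ) : ENNReal :=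
  ENNReal.ofReal (ensembleDensity 1 (laguerreWeight (1 / 2)) n
    fun j => z (concatEquiv n (Sum.inl j))) *
  ENNReal.ofReal (ensembleDensity 1 (laguerreWeight (1 / 2)) n
    fun j => z (concatEquiv n (Sum.inr j)))

theorem measurable_concatDensity (n : ℕ) : Measurable (concatDensity n) := by
  have hm : Measurable (ensembleDensity 1 (laguerreWeight (1 / 2)) n) :=
    measurable_ensembleDensity (by fun_prop) n
  unfold concatDensity
  fun_prop

theorem concatDensity_comp_perm {n : ℕ} (z : Fin (2 * n) → ℝ)
    (τ : Equiv.Perm (Fin (n + n))) :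
    concatDensity n (z ∘ (finCongr (two_mul n).symm).permCongr τ) =
      ENNReal.ofReal ((∏ i, laguerreWeight (1 / 2) (z i)) *
        (|vdm (firstHalf ((z ∘ finCongr (two_mul n).symm) ∘ τ))| *
          |vdm (lastHalf ((z ∘ finCongr (two_mul n).symm) ∘ τ))|)) := by
  have h1 : ∀ j, z ((finCongr (two_mul n).symm).permCongr τ (concatEquiv n (Sum.inl j))) =
      firstHalf ((z ∘ finCongr (two_mul n).symm) ∘ τ) j := fun j => by
    simp [concatEquiv, Equiv.permCongr_apply, firstHalf]
  have h2 : ∀ j, z ((finCongr (two_mul n).symm).permCongr τ (concatEquiv n (Sum.inr j))) =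
      lastHalf ((z ∘ finCongr (two_mul n).symm) ∘ τ) j := fun j => by
    simp [concatEquiv, Equiv.permCongr_apply, lastHalf, -Fin.natAdd_eq_addNat]
  have h3 : ∏ i, laguerreWeight (1 / 2) (z i) =
      (∏ j, laguerreWeight (1 / 2) (firstHalf ((z ∘ finCongr (two_mul n).symm) ∘ τ) j)) *
      ∏ j, laguerreWeight (1 / 2) (lastHalf ((z ∘ finCongr (two_mul n).symm) ∘ τ) j) := by
    rw [← (τ.trans (finCongr (two_mul n).symm)).prod_comp, Fin.prod_univ_add]
    rfl
  rw [concatDensity, ← ENNReal.ofReal_mul (ensembleDensity_nonneg (laguerreWeight_nonneg _) _)]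
  simp only [Function.comp_apply, h1, h2]
  rw [ensembleDensity_eq, ensembleDensity_eq, pow_one, pow_one, h3]
  congr 1
  ring

/-- The one-point weights are symmetric and come out of the sum over permutations. The remaining sum
over splittings gives the odd and even Vandermonde products, which is the case A = 0. -/
theorem sum_concatDensity {n : ℕ} {z : Fin (2 * n) → ℝ} (hz : StrictAnti z) :
    ∑ σ : Equiv.Perm (Fin (2 * n)), concatDensity n (z ∘ σ) =
      ENNReal.ofReal ((n.factorial : ℝ) ^ 2 * 2 ^ n) *
        ENNReal.ofReal (interpolatingDensity n 0 z) := by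
  have hz' : StrictAnti (z ∘ finCongr (two_mul n).symm) := fun i j hij => hz hij
  rw [← (finCongr (two_mul n).symm).permCongr.sum_comp]
  simp_rw [concatDensity_comp_perm]
  have hW : 0 ≤ ∏ i, laguerreWeight (1 / 2) (z i) :=
    Finset.prod_nonneg fun _ _ => laguerreWeight_nonneg _ _
  rw [← ENNReal.ofReal_sum_of_nonneg fun τ _ => by positivity, ← Finset.mul_sum,
    sum_abs_vdm_halves hz', ← ENNReal.ofReal_mul (by positivity)]
  congr 1
  by_cases h0 : ∀ i, 0 ≤ z i
  · rw [interpolatingDensity_of_mem hz h0,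
      ← abs_of_pos (vdm_pos (strictAnti_oddLabelled hz)),
      ← abs_of_pos (vdm_pos (strictAnti_evenLabelled hz))]
    have hW' : ∏ i, laguerreWeight (1 / 2) (z i) = ∏ i, Real.exp (-z i / 2) :=
      Finset.prod_congr rfl fun i _ => by
        rw [laguerreWeight, if_pos (h0 i)]; congr 1; ring
    have ho : (fun j => (z ∘ finCongr (two_mul n).symm) (alternatingEquiv n (Sum.inl j))) =
      oddLabelled z := rfl
    have he : (fun j => (z ∘ finCongr (two_mul n).symm) (alternatingEquiv n (Sum.inr j))) =
      evenLabelled z := rfl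
    rw [hW', ho, he]
    simp
    ring
  · rw [interpolatingDensity, if_neg (fun h => h0 h.2), mul_zero]
    push Not at h0
    obtain ⟨i, hi⟩ := h0
    rw [Finset.prod_eq_zero (Finset.mem_univ i), zero_mul]
    exact if_neg (not_le.2 hi)

theorem eq_orderedLaguerreOrthogonalUnion {n : ℕ} {μ : Measure (Fin (2 * n) → ℝ)}
    [IsProbabilityMeasure μ] {c : ENNReal}
    (h : μ = c • volume.withDensity fun z => ENNReal.ofReal (interpolatingDensity n 0 z)) :
    μ = orderedLaguerreOrthogonalUnion n := by
  let F : (Fin n → ℝ) → ℝ := ensembleDensity 1 (laguerreWeight (1 / 2)) n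
  have hm : Measurable F := measurable_ensembleDensity (by fun_prop) n
  let K : ENNReal := ENNReal.ofReal ((n.factorial : ℝ) ^ 2 * 2 ^ n)
  have hK0 : K ≠ 0 := by
    simp only [K, Ne, ENNReal.ofReal_eq_zero, not_le]
    have := n.factorial_pos
    positivity
  have hKtop : K ≠ ⊤ := ENNReal.ofReal_ne_top
  have hF : Measurable fun z => ENNReal.ofReal (F z) := hm.ennreal_ofReal
  have hprod : ((volume.withDensity fun z => ENNReal.ofReal (F z)).prod
      (volume.withDensity fun z => ENNReal.ofReal (F z))).map (pairEquiv (concatEquiv n)) =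
      volume.withDensity (concatDensity n) := by
    rw [prod_withDensity hF hF, ← map_pairEquiv_withDensity (concatEquiv n) (measurable_concatDensity n)]
    congr 2
    funext p
    simp only [concatDensity, pairEquiv_inl, pairEquiv_inr, F]
  have hsort : (volume.withDensity (concatDensity n)).map sortDesc =
      K • volume.withDensity fun z => ENNReal.ofReal (interpolatingDensity n 0 z) := by
    rw [map_sortDesc_withDensity (measurable_concatDensity n),
      ← withDensity_smul _ (measurable_interpolatingDensity n 0).ennreal_ofReal]
    congr 1
    funext z
    by_cases hz : StrictAnti z
    · rw [Set.indicator_of_mem (show z ∈ {z : Fin (2 * n) → ℝ | StrictAnti z} from hz),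
        sum_concatDensity hz]
      rfl
    · rw [Set.indicator_of_notMem (show z ∉ {z : Fin (2 * n) → ℝ | StrictAnti z} from hz),
        Pi.smul_apply, interpolatingDensity, if_neg (fun h => hz h.1), ENNReal.ofReal_zero,
        smul_zero]
  have hpm : Measurable (pairEquiv (concatEquiv n)) := MeasurableEquiv.measurable _
  have hall := hsort
  rw [← hprod, Measure.map_map (measurable_sortDesc _) hpm] at hall
  obtain ⟨h0, htop⟩ := lintegral_ne_of_smul h
  have hI := congrArg (fun m => m Set.univ) hall
  simp only [Measure.map_apply ((measurable_sortDesc _).comp hpm) MeasurableSet.univ,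
    Set.preimage_univ, Measure.smul_apply, smul_eq_mul] at hI
  rw [← Set.univ_prod_univ, Measure.prod_prod] at hI
  have hI0 := mul_ne_zero hK0 h0
  have hItop := ENNReal.mul_ne_top hKtop htop
  rw [← hI] at hI0 hItop
  -- The total mass of the product is the square of the LOE mass, so a finite nonzero square
  -- controls the single ensemble.
  have hJ0 := left_ne_zero_of_mul hI0
  have hJtop : (volume.withDensity fun z => ENNReal.ofReal (F z)) Set.univ ≠ ⊤ := fun h =>
    hItop (by rw [h, ENNReal.top_mul_top])
  have hp := isProbabilityMeasure_inv_smul hJ0 hJtop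
  rw [withDensity_apply _ MeasurableSet.univ, Measure.restrict_univ] at hJ0 hJtop hp
  obtain ⟨-, -, hN⟩ := normalizedMeasure_eq_inv_smul hm
    (ensembleDensity_nonneg (laguerreWeight_nonneg _)) hJ0 hJtop
  rw [← hN] at hp
  have hunion : orderedLaguerreOrthogonalUnion n =
      ((normalizedMeasure F).prod (normalizedMeasure F)).map
        (sortDesc ∘ pairEquiv (concatEquiv n)) := by
    rw [orderedLaguerreOrthogonalUnion]
    congr 1
    funext p
    rw [Function.comp_apply, pairEquiv_concatEquiv]
  have : IsProbabilityMeasure (orderedLaguerreOrthogonalUnion n) := by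
    rw [hunion]
    exact Measure.isProbabilityMeasure_map ((measurable_sortDesc _).comp hpm).aemeasurable
  refine eq_of_eq_smul h (c' := (∫⁻ z, ENNReal.ofReal (F z))⁻¹ *
    (∫⁻ z, ENNReal.ofReal (F z))⁻¹ * K) ?_
  rw [hunion, hN, Measure.prod_smul_left, Measure.prod_smul_right, Measure.map_smul,
    Measure.map_smul, hall, smul_smul, smul_smul]

/-! ### Joint density of the even and odd points -/

/-- Alternation of two tuples: `inl j` carries the `j`-th even label, `inr j` the `j`-th odd one. -/
def alternateEquiv (n : ℕ) : Fin n ⊕ Fin n ≃ Fin (2 * n) :=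
  (Equiv.sumComm _ _).trans ((alternatingEquiv n).trans (finCongr (two_mul n).symm))

theorem pairEquiv_alternateEquiv_labels {n : ℕ} (p : (Fin n → ℝ) × (Fin n → ℝ)) :
    evenLabelled (pairEquiv (alternateEquiv n) p) = p.1 ∧
      oddLabelled (pairEquiv (alternateEquiv n) p) = p.2 := by
  constructor
  · funext j
    exact pairEquiv_inl (alternateEquiv n) p j
  · funext j
    exact pairEquiv_inr (alternateEquiv n) p j

theorem strictAnti_iff_mem_interlace {n : ℕ} (z : Fin (2 * n) → ℝ) :
    StrictAnti z ↔ oddLabelled z ∈ Interlace (evenLabelled z) := by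
  constructor
  · intro h
    refine ⟨fun j => h (Fin.lt_def.2 (by simp)), fun j k hjk => h (Fin.lt_def.2 ?_)⟩
    have : (j : ℕ) < k := hjk
    simp only
    omega
  · intro h i k hik
    have ho := Interlace.strictAnti h
    have hik' : (i : ℕ) < k := hik
    have key : ∀ i : Fin (2 * n), (∃ j : Fin n, (i : ℕ) = 2 * j ∧ z i = oddLabelled z j) ∨
        ∃ j : Fin n, (i : ℕ) = 2 * j + 1 ∧ z i = evenLabelled z j := by
      intro i
      rcases Nat.even_or_odd' (i : ℕ) with ⟨m, hm | hm⟩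
      · exact Or.inl ⟨⟨m, by omega⟩, hm, congrArg z (Fin.ext hm)⟩
      · exact Or.inr ⟨⟨m, by omega⟩, hm, congrArg z (Fin.ext hm)⟩
    rcases key i with ⟨j, hj, hzi⟩ | ⟨j, hj, hzi⟩ <;>
      rcases key k with ⟨l, hl, hzk⟩ | ⟨l, hl, hzk⟩ <;> rw [hzi, hzk]
    · exact ho (Fin.lt_def.2 (by omega))
    · exact (h.1 l).trans_le (ho.antitone (Fin.le_def.2 (by omega)))
    · exact h.2 j l (Fin.lt_def.2 (by omega))
    · have hjl : j < l := Fin.lt_def.2 (by omega)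
      exact (h.1 l).trans (h.2 j l hjl)

theorem prod_oddLabelled_mul_evenLabelled {n : ℕ} (z : Fin (2 * n) → ℝ) (f : ℝ → ℝ) :
    ∏ i, f (z i) = (∏ j, f (evenLabelled z j)) * ∏ j, f (oddLabelled z j) := by
  rw [← (alternateEquiv n).prod_comp, Fintype.prod_sum_type]
  rfl

theorem orderedLaguerreDensity_mul_interlaceDensity_alternate {n : ℕ} (b : ℝ)
    {z : Fin (2 * n) → ℝ} (hz : ∀ i, z i ≠ 0) :
    orderedLaguerreDensity 0 n (evenLabelled z) *
      interlaceDensity (fun _ => 1) b (evenLabelled z) (oddLabelled z) =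
    ENNReal.ofReal (interpolatingDensity n (1 - 2 / b) z) := by
  by_cases hs : StrictAnti z
  swap
  · rw [interlaceDensity, Set.indicator_of_notMem
      (fun h => hs ((strictAnti_iff_mem_interlace z).2 h)), mul_zero, interpolatingDensity,
      if_neg (fun h => hs h.1), ENNReal.ofReal_zero]
  have hI := (strictAnti_iff_mem_interlace z).1 hs
  have he := strictAnti_evenLabelled hs
  by_cases h0 : ∀ i, 0 ≤ z i
  · have hpos : evenLabelled z ∈ posChamber n :=
      ⟨he, fun j => lt_of_le_of_ne (h0 _) (hz _).symm⟩
    have hw := residues_pos he hI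
    have hve := vdm_pos he
    have hvo := vdm_pos (Interlace.strictAnti hI)
    rw [interpolatingDensity_of_mem hs h0, interlaceDensity, Set.indicator_of_mem hI,
      orderedLaguerreDensity, Set.indicator_of_mem hpos, prod_gammaDensity _ _ hw,
      sum_residues he.injective, ← ENNReal.ofReal_mul (by positivity),
      ← ENNReal.ofReal_mul (by positivity)]
    congr 1
    rw [prod_oddLabelled_mul_evenLabelled z fun t => Real.exp (-t / 2)]
    simp only [pow_zero, one_mul, Nat.sub_self, Finset.prod_const_one, ← Real.exp_sum]
    -- This fixes A: the exponent -t - (z - t)/b equals -t/2 - z/2 + A(z - t)/2 exactly for A = 1 -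
    -- 2/b.
    have hexp : Real.exp (∑ j, -evenLabelled z j) *
        Real.exp (-(∑ j, oddLabelled z j - ∑ j, evenLabelled z j) / b) =
        Real.exp (∑ j, -evenLabelled z j / 2) * Real.exp (∑ j, -oddLabelled z j / 2) *
        Real.exp (∑ j, (1 - 2 / b) * (oddLabelled z j - evenLabelled z j) / 2) := by
      rw [← Real.exp_add, ← Real.exp_add, ← Real.exp_add, ← Finset.sum_sub_distrib,
        neg_div, Finset.sum_div, ← Finset.sum_neg_distrib, ← Finset.sum_add_distrib,
        ← Finset.sum_add_distrib, ← Finset.sum_add_distrib]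
      congr 1
      exact Finset.sum_congr rfl fun j _ => by ring
    rw [← hexp]
    field_simp
  · rw [interpolatingDensity, if_neg (fun h => h0 h.2), ENNReal.ofReal_zero,
      orderedLaguerreDensity, Set.indicator_of_notMem, zero_mul]
    intro hp
    refine h0 fun i => ?_
    obtain ⟨s, rfl⟩ := (alternateEquiv n).surjective i
    rcases s with j | j
    · exact (hp.2 j).le
    · exact ((hp.2 j).trans (hI.1 j)).le

/-! ### The spectrum of the perturbed Gram matrix -/

theorem perturbedGramEigenvalues_antitone {n : ℕ} (b : ℝ) (X : Matrix (Fin n) (Fin n) ℂ)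
    (x : Fin n × Fin 2 → ℝ) : Antitone (perturbedGramEigenvalues b X x) := fun _ _ hij =>
  (perturbedGram_isHermitian b X x).eigenvalues₀_antitone hij

open Polynomial in
theorem charpoly_perturbedGram {n : ℕ} (b : ℝ) (X : Matrix (Fin n) (Fin n) ℂ)
    (x : Fin n × Fin 2 → ℝ) : (perturbedGram b X x).charpoly =
      ∏ i, (Polynomial.X - C (perturbedGramEigenvalues b X x i)) := by
  rw [(perturbedGram_isHermitian b X x).charpoly_eq,
    ← ((finCongr (card_index n)).trans (Fintype.equivOfCardEq (Fintype.card_fin _))).prod_comp]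
  refine Finset.prod_congr rfl fun i _ => ?_
  simp [Matrix.IsHermitian.eigenvalues, perturbedGramEigenvalues]

theorem perturbedGram_eq {n : ℕ} (b : ℝ) (X : Matrix (Fin n) (Fin n) ℂ)
    (x : Fin n × Fin 2 → ℝ) :
    perturbedGram b X x = realRep (X.conjTranspose * X) + b • Matrix.vecMulVec x x := by
  rw [perturbedGram, realRep_mul, realRep_conjTranspose]

theorem nodeSeq_perturbedGramEigenvalues {n : ℕ} (b : ℝ) (X : Matrix (Fin n) (Fin n) ℂ)
    (x : Fin n × Fin 2 → ℝ) (k : ℕ) : nodeSeq 0 (perturbedGramEigenvalues b X x) k =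
      ((Matrix.scalar (Fin n × Fin 2) ((k : ℝ) + 1) - perturbedGram b X x).det : ℝ) := by
  rw [← Matrix.eval_charpoly, charpoly_perturbedGram]
  simp [nodeSeq, Polynomial.eval_prod]

/-- The decreasing eigenvalues are decoded from determinants, which are polynomial in the entries.
-/
theorem measurable_perturbedGramEigenvalues {α : Type*} [MeasurableSpace α] {n : ℕ} (b : ℝ)
    {X : α → Matrix (Fin n) (Fin n) ℂ} {x : α → Fin n × Fin 2 → ℝ}
    (hX : ∀ i j, Measurable fun a => X a i j) (hx : Measurable x) :
    Measurable fun a => perturbedGramEigenvalues b (X a) (x a) := by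
  obtain ⟨R, hR, hRt⟩ := exists_nodeSeq_leftInverse 0 (2 * n)
  have h : (fun a => perturbedGramEigenvalues b (X a) (x a)) =
      fun a => R (nodeSeq 0 (perturbedGramEigenvalues b (X a) (x a))) := by
    funext a
    rw [hRt _ (perturbedGramEigenvalues_antitone b _ _)]
  rw [h]
  refine hR.comp (measurable_pi_lambda _ fun k => ?_)
  simp_rw [nodeSeq_perturbedGramEigenvalues]
  have hrep : ∀ p q, Measurable fun a => realRep (X a) p q := by
    rintro ⟨i, s⟩ ⟨j, r⟩
    have hre : Measurable fun a => (X a i j).re := Complex.measurable_re.comp (hX i j)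
    have him : Measurable fun a => (X a i j).im := Complex.measurable_im.comp (hX i j)
    fin_cases s <;> fin_cases r
    · simpa [realRep] using hre
    · simpa [realRep] using him
    · exact him.neg
    · simpa [realRep] using hre
  have hgram : ∀ p q, Measurable fun a => perturbedGram b (X a) (x a) p q := by
    intro p q
    simp only [perturbedGram, Matrix.add_apply, Matrix.mul_apply, Matrix.transpose_apply,
      Matrix.smul_apply, Matrix.vecMulVec_apply, smul_eq_mul]
    refine (Finset.measurable_sum _ fun r _ => (hrep r p).mul (hrep r q)).add ?_
    fun_prop
  refine Complex.measurable_ofReal.comp ?_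
  simp_rw [Matrix.det_apply]
  refine Finset.measurable_sum _ fun σ _ => Measurable.const_smul ?_ _
  refine Finset.measurable_prod _ fun p _ => ?_
  simp only [Matrix.sub_apply]
  exact measurable_const.sub (hgram _ _)

/-- The complex matrix whose entries have the real and imaginary parts listed in `ω`. -/
def complexMatrix {n : ℕ} (ω : Fin n → Fin n × Fin 2 → ℝ) : Matrix (Fin n) (Fin n) ℂ :=
  Matrix.of fun i j => ⟨ω i (j, 0), ω i (j, 1)⟩

theorem complexMatrix_gram {n : ℕ} (ω : Fin n → Fin n × Fin 2 → ℝ) :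
    (complexMatrix ω).conjTranspose * complexMatrix ω = wishart ω := by
  ext i j
  rw [Matrix.mul_apply, wishart, Matrix.sum_apply]
  refine Finset.sum_congr rfl fun k _ => ?_
  apply Complex.ext <;> simp [complexMatrix, complexVec, Matrix.vecMulVec_apply]

theorem measurable_complexMatrix_apply {n : ℕ} (i j : Fin n) :
    Measurable fun ω : Fin n → Fin n × Fin 2 → ℝ => complexMatrix ω i j := by
  have : (fun ω : Fin n → Fin n × Fin 2 → ℝ => complexMatrix ω i j) =
      fun ω => (ω i (j, 0) : ℂ) + ω i (j, 1) * Complex.I := by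
    funext ω; apply Complex.ext <;> simp [complexMatrix]
  rw [this]
  fun_prop

/-- The decreasing eigenvalues of the perturbed Gram matrix as a function of the entries. -/
def spectrumMap {n : ℕ} (b : ℝ)
    (p : (Fin n × Fin 2 → ℝ) × (Fin n → Fin n × Fin 2 → ℝ)) : Fin (2 * n) → ℝ :=
  perturbedGramEigenvalues b (complexMatrix p.2) p.1

theorem measurable_spectrumMap {n : ℕ} (b : ℝ) : Measurable (spectrumMap (n := n) b) :=
  measurable_perturbedGramEigenvalues b
    (fun i j => (measurable_complexMatrix_apply i j).comp measurable_snd) measurable_fst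

/-- Each t_j survives once, since its doubled multiplicity drops by one. Interlacing then places the
t_j at the even labels and the new points at the odd ones. -/
theorem spectrumMap_eq_alternate {n : ℕ} {b : ℝ} {ω : Fin n → Fin n × Fin 2 → ℝ}
    {x : Fin n × Fin 2 → ℝ} {t z : Fin n → ℝ} (hz : z ∈ Interlace t)
    (h : (realRep (wishart ω) + b • Matrix.vecMulVec x x).charpoly =
      (∏ j, (Polynomial.X - Polynomial.C (t j)) ^ (2 * 1 - 1)) *
        ∏ j, (Polynomial.X - Polynomial.C (z j))) :
    spectrumMap b (x, ω) = pairEquiv (alternateEquiv n) (t, z) := by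
  obtain ⟨h1, h2⟩ := pairEquiv_alternateEquiv_labels (t, z)
  have hanti : StrictAnti (pairEquiv (alternateEquiv n) (t, z)) := by
    rw [strictAnti_iff_mem_interlace, h1, h2]
    exact hz
  refine antitone_eq_of_prod_eq (perturbedGramEigenvalues_antitone b _ _) hanti.antitone ?_
  rw [← complexMatrix_gram, ← perturbedGram_eq] at h
  change ∏ i, (Polynomial.X - Polynomial.C (perturbedGramEigenvalues b (complexMatrix ω) x i)) = _
  rw [← charpoly_perturbedGram, h, ← (alternateEquiv n).prod_comp, Fintype.prod_sum_type]
  simp only [pairEquiv_inl, pairEquiv_inr, pow_one, Nat.reduceMul, Nat.reduceSub]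

theorem exists_map_spectrumMap (n : ℕ) {b : ℝ} (hb : 0 < b) :
    (∃ c : ENNReal, ((gaussVec n).prod (Measure.pi fun _ : Fin n => gaussVec n)).map
      (spectrumMap b) = c • volume.withDensity fun z =>
        ENNReal.ofReal (interpolatingDensity n (1 - 2 / b) z)) ∧
    ∃ c : ENNReal, ((gaussVec n).prod (Measure.pi fun _ : Fin n => gaussVec n)).map
      (fun p => evenLabelled (spectrumMap b p)) =
        c • volume.withDensity (orderedLaguerreDensity 0 n) := by
  obtain ⟨c, hc⟩ := exists_map_detSeq_wishart n n 0 (add_zero n)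
  obtain ⟨T, hT, hTlaw, hTae⟩ := exists_points_of_map_detSeq hc
  have hker : ∀ᵐ ω ∂(Measure.pi fun _ : Fin n => gaussVec n),
      ∃ Z : (Fin n × Fin 2 → ℝ) → Fin n → ℝ, Measurable Z ∧
        (gaussVec n).map Z = (∏ _j : Fin n, (volume.withDensity (gammaDensity 1 b) Set.univ)⁻¹) •
          volume.withDensity (interlaceDensity (fun _ => 1) b (T ω)) ∧
        ∀ᵐ x ∂(gaussVec n), spectrumMap b (x, ω) = pairEquiv (alternateEquiv n) (T ω, Z x) := by
    filter_upwards [hTae] with ω hω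
    have hchar : (wishart ω).charpoly =
        ∏ j, (Polynomial.X - Polynomial.C (T ω j : ℂ)) ^ 1 := by
      refine charpoly_eq_of_detSeq_eq fun k => ?_
      rw [hω.2]
      simp [nodeSeq, Polynomial.eval_prod]
    obtain ⟨Z, hZ, hZlaw, hZae⟩ := exists_perturbation_points (wishart_isHermitian ω)
      hω.1.1 (k := fun _ => 1) (fun _ => one_pos) hchar hb
    refine ⟨Z, hZ, hZlaw, ?_⟩
    filter_upwards [hZae] with x hx
    exact spectrumMap_eq_alternate hx.1 hx.2.2
  have hem : Measurable (pairEquiv (alternateEquiv n)) := MeasurableEquiv.measurable _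
  constructor
  · refine ⟨c * ∏ _j : Fin n, (volume.withDensity (gammaDensity 1 b) Set.univ)⁻¹, ?_⟩
    rw [map_prod_of_transition (γ := gaussVec n) hT (measurable_orderedLaguerreDensity 0 n) hTlaw
      (measurable_interlaceDensity_uncurry (fun _ => 1) b) hem (measurable_spectrumMap b) hker]
    congr 1
    have hF : Measurable fun z => orderedLaguerreDensity 0 n (evenLabelled z) *
        interlaceDensity (fun _ => 1) b (evenLabelled z) (oddLabelled z) :=
      ((measurable_orderedLaguerreDensity 0 n).comp (measurable_evenLabelled n)).mul
        ((measurable_interlaceDensity_uncurry (fun _ => 1) b).comp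
          ((measurable_evenLabelled n).prodMk (measurable_oddLabelled n)))
    have hmap := map_pairEquiv_withDensity (alternateEquiv n) hF
    simp only [(pairEquiv_alternateEquiv_labels _).1, (pairEquiv_alternateEquiv_labels _).2] at hmap
    rw [hmap]
    refine withDensity_congr_ae ?_
    filter_upwards [ae_apply_ne_zero (2 * n)] with z hz
    exact orderedLaguerreDensity_mul_interlaceDensity_alternate b hz
  -- For almost every matrix the even-labelled eigenvalues equal T ω for almost every x, so
  -- integrating over x changes nothing and no transition density is needed.
  · refine ⟨c, ?_⟩
    have hev : Measurable fun p => evenLabelled (spectrumMap (n := n) b p) :=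
      (measurable_evenLabelled n).comp (measurable_spectrumMap b)
    rw [← hTlaw]
    refine Measure.ext_of_lintegral _ fun φ hφ => ?_
    rw [lintegral_map hφ hev, lintegral_map hφ hT,
      lintegral_prod_symm (fun p => φ (evenLabelled (spectrumMap b p))) (hφ.comp hev).aemeasurable]
    refine lintegral_congr_ae ?_
    filter_upwards [hker] with ω hω
    obtain ⟨Z, -, -, hZ⟩ := hω
    rw [lintegral_congr_ae (g := fun _ => φ (T ω)) (by
      filter_upwards [hZ] with x hx
      rw [hx, (pairEquiv_alternateEquiv_labels _).1]), lintegral_const, measure_univ, mul_one]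

/-! ### Transfer to arbitrary probability spaces and conclusion -/

/-- The list of all real entries, for the matrix and the vector. -/
def entries {n : ℕ} (p : (Fin n × Fin 2 → ℝ) × (Fin n → Fin n × Fin 2 → ℝ)) :
    ((Fin n × Fin n) × Fin 2) ⊕ (Fin n × Fin 2) → ℝ :=
  Sum.elim (fun i => p.2 i.1.1 (i.1.2, i.2)) p.1

theorem measurable_entries {n : ℕ} : Measurable (entries (n := n)) := by
  refine measurable_pi_lambda _ fun k => ?_
  rcases k with k | k
  · change Measurable fun p : (Fin n × Fin 2 → ℝ) × (Fin n → Fin n × Fin 2 → ℝ) =>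
      p.2 k.1.1 (k.1.2, k.2)
    fun_prop
  · change Measurable fun p : (Fin n × Fin 2 → ℝ) × (Fin n → Fin n × Fin 2 → ℝ) => p.1 k
    fun_prop

theorem map_entries (n : ℕ) :
    ((gaussVec n).prod (Measure.pi fun _ : Fin n => gaussVec n)).map entries =
      Measure.pi fun _ => gaussianReal 0 (1 / 2) := by
  refine (Measure.pi_eq fun s hs => ?_).symm
  rw [Measure.map_apply measurable_entries (MeasurableSet.univ_pi hs)]
  have : entries ⁻¹' Set.univ.pi s = (Set.univ.pi fun q : Fin n × Fin 2 => s (Sum.inr q)) ×ˢ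
      Set.univ.pi fun i : Fin n => Set.univ.pi fun q : Fin n × Fin 2 =>
        s (Sum.inl ((i, q.1), q.2)) := by
    ext p
    simp only [Set.mem_preimage, Set.mem_univ_pi, Set.mem_prod, entries, Sum.forall, Sum.elim_inl,
      Sum.elim_inr, Prod.forall]
    tauto
  rw [this, Measure.prod_prod, Measure.pi_pi, Measure.pi_pi, Fintype.prod_sum_type, mul_comm]
  congr 1
  simp_rw [Measure.pi_pi, Fintype.prod_prod_type]

/-- Independence makes the joint law a product of the marginals, which are all the same Gaussian. -/
theorem hasLaw_entries {Ω : Type*} [MeasurableSpace Ω] {μ : Measure Ω} [IsProbabilityMeasure μ]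
    {n : ℕ} {X : Ω → Matrix (Fin n) (Fin n) ℂ} {x : Ω → Fin n × Fin 2 → ℝ}
    (hind : iIndepFun (realComponents X x) μ)
    (hlaw : ∀ k, HasLaw (realComponents X x k) (gaussianReal 0 (1 / 2)) μ) :
    HasLaw (fun ω k => realComponents X x k ω) (Measure.pi fun _ => gaussianReal 0 (1 / 2)) μ := by
  have hm : ∀ k, AEMeasurable (realComponents X x k) μ := fun k => (hlaw k).aemeasurable
  refine ⟨aemeasurable_pi_lambda _ hm, ?_⟩
  rw [(iIndepFun_iff_map_fun_eq_pi_map hm).1 hind]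
  congr 1
  funext k
  exact (hlaw k).map_eq

/-- The inverse of `entries`. -/
def ofEntries {n : ℕ} (u : ((Fin n × Fin n) × Fin 2) ⊕ (Fin n × Fin 2) → ℝ) :
    (Fin n × Fin 2 → ℝ) × (Fin n → Fin n × Fin 2 → ℝ) :=
  (fun q => u (Sum.inr q), fun i q => u (Sum.inl ((i, q.1), q.2)))

theorem measurable_ofEntries {n : ℕ} : Measurable (ofEntries (n := n)) := by
  unfold ofEntries
  fun_prop

theorem hasLaw_ofEntries (n : ℕ) : HasLaw (ofEntries (n := n))
    ((gaussVec n).prod (Measure.pi fun _ : Fin n => gaussVec n))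
    (Measure.pi fun _ => gaussianReal 0 (1 / 2)) := by
  refine ⟨measurable_ofEntries.aemeasurable, ?_⟩
  rw [← map_entries, Measure.map_map measurable_ofEntries measurable_entries]
  exact Measure.map_id

theorem spectrumMap_ofEntries {Ω : Type*} {n : ℕ} (b : ℝ) (X : Ω → Matrix (Fin n) (Fin n) ℂ)
    (x : Ω → Fin n × Fin 2 → ℝ) (ω : Ω) :
    spectrumMap b (ofEntries fun k => realComponents X x k ω) =
      perturbedGramEigenvalues b (X ω) (x ω) := by
  have : complexMatrix (ofEntries fun k => realComponents X x k ω).2 = X ω := by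
    ext i j
    apply Complex.ext <;> simp [complexMatrix, ofEntries, realComponents]
  rw [spectrumMap, this]
  rfl

theorem hasLaw_spectrumMap (n : ℕ) {b : ℝ} (hb : 0 < b) :
    (Integrable (interpolatingDensity n (1 - 2 / b)) ∧
      0 < (∫ z, interpolatingDensity n (1 - 2 / b) z) ∧
      HasLaw (spectrumMap b) (normalizedMeasure (interpolatingDensity n (1 - 2 / b)))
        ((gaussVec n).prod (Measure.pi fun _ : Fin n => gaussVec n))) ∧
    HasLaw (fun p => evenLabelled (spectrumMap b p)) (orderedLaguerreUnitary n)
      ((gaussVec n).prod (Measure.pi fun _ : Fin n => gaussVec n)) ∧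
    (b = 2 → HasLaw (spectrumMap b) (orderedLaguerreOrthogonalUnion n)
      ((gaussVec n).prod (Measure.pi fun _ : Fin n => gaussVec n))) := by
  have hm := measurable_spectrumMap (n := n) b
  have hev : Measurable fun p => evenLabelled (spectrumMap (n := n) b p) :=
    (measurable_evenLabelled n).comp hm
  obtain ⟨⟨c, hc⟩, c', hc'⟩ := exists_map_spectrumMap n hb
  have hp := Measure.isProbabilityMeasure_map
    (μ := (gaussVec n).prod (Measure.pi fun _ : Fin n => gaussVec n)) hm.aemeasurable
  have hp' := Measure.isProbabilityMeasure_map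
    (μ := (gaussVec n).prod (Measure.pi fun _ : Fin n => gaussVec n)) hev.aemeasurable
  obtain ⟨h1, h2, h3⟩ := eq_normalizedMeasure_of_eq_smul (measurable_interpolatingDensity n _)
    (interpolatingDensity_nonneg n _) hc
  refine ⟨⟨h1, h2, hm.aemeasurable, h3⟩, ⟨hev.aemeasurable, eq_orderedLaguerreUnitary hc'⟩, ?_⟩
  rintro rfl
  rw [div_self two_ne_zero, sub_self] at hc
  exact ⟨hm.aemeasurable, eq_orderedLaguerreOrthogonalUnion hc⟩

theorem mainTheorem4 (n : ℕ) :
    (∀ (b : ℝ), 0 < b →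
      ∀ (Ω : Type*) [MeasurableSpace Ω] (μ : Measure Ω) [IsProbabilityMeasure μ]
        (X : Ω → Matrix (Fin n) (Fin n) ℂ) (x : Ω → Fin n × Fin 2 → ℝ),
        iIndepFun (realComponents X x) μ →
        (∀ k, HasLaw (realComponents X x k) (gaussianReal 0 (1 / 2)) μ) →
        (Integrable (interpolatingDensity n (1 - 2 / b)) ∧
          0 < (∫ z, interpolatingDensity n (1 - 2 / b) z) ∧
          HasLaw (fun ω => perturbedGramEigenvalues b (X ω) (x ω))
            (normalizedMeasure (interpolatingDensity n (1 - 2 / b))) μ) ∧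
        HasLaw (fun ω => evenLabelled (perturbedGramEigenvalues b (X ω) (x ω)))
          (orderedLaguerreUnitary n) μ ∧
        (b = 2 → HasLaw (fun ω => perturbedGramEigenvalues b (X ω) (x ω))
          (orderedLaguerreOrthogonalUnion n) μ)) ∧
    HasLaw evenLabelled (orderedLaguerreUnitary n) (orderedLaguerreOrthogonalUnion n) := by
  constructor
  · intro b hb Ω _ μ _ X x hind hlaw
    obtain ⟨⟨h1, h2, h3⟩, h4, h5⟩ := hasLaw_spectrumMap n hb
    have hcomp := (hasLaw_ofEntries n).fun_comp (hasLaw_entries hind hlaw)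
    have k3 := h3.fun_comp hcomp
    have k4 := h4.fun_comp hcomp
    have k5 := fun h => (h5 h).fun_comp hcomp
    simp only [spectrumMap_ofEntries] at k3 k4 k5
    exact ⟨⟨h1, h2, k3⟩, k4, k5⟩
  -- At b = 2 the law of LOE ∪ LOE is realized by a spectrum on the concrete Gaussian space, where
  -- the law of the even points is already known.
  · obtain ⟨-, h4, h5⟩ := hasLaw_spectrumMap n (two_pos (α := ℝ))
    refine ⟨(measurable_evenLabelled n).aemeasurable, ?_⟩
    rw [← (h5 rfl).map_eq, Measure.map_map (measurable_evenLabelled n) (measurable_spectrumMap 2)]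
    exact h4.map_eq

end
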